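/- Let $N\ge 1$, let $\mathcal A$ be a (nonempty) control set, and for $\alpha\in\mathcal A$ let $f^\alpha,c^\alpha:\mathbb R^N\to\mathbb R$, $\eta^\alpha:\mathbb R^N\to\mathbb R^N$, and let $\nu_\alpha$ be a nonnegative Borel measure on $\mathbb R^N$. Let $\sigma\in(0,2)$ and assume: (A1) $\mathcal A$ is a separable metric space, $c^\alpha(x)\ge\lambda$ for some constant $\lambda>0$, and $c^\alpha(x),f^\alpha(x),\eta^\alpha(z)$ are continuous in $\alpha$, in $x$ and in $z$. (A2) $f^\alpha$ and $c^\alpha$ are bounded and Lipschitz continuous and $\eta^\alpha$ is bounded, uniformly in $\alpha$. (A3) There is $K>0$ with $|\eta^\alpha(z)|\le K|z|$ for $|z|<1$, $\alpha\in\mathcal A$. (A4) There is $K>0$ with $\int_{|z|\le1}|z|^2\,\nu_\alpha(dz)+\int_{|z|>1}\nu_\alpha(dz)\le K$ for $\alpha\in\mathcal A$. (A5) $\nu_\alpha(dz)1_{|z|<1}$ is symmetric for $\alpha\in\mathcal A$. (A6) On $|z|<1$, $\nu_\alpha$ is absolutely continuous, and there is a constant $C_\nu>0$ such that $0\le\frac{d\nu_\alpha}{dz}\le\frac{C_\nu}{|z|^{N+\sigma}}$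 for $|z|<1$, $\alpha\in\mathcal A$. (A7) $\eta^\alpha(-z)=-\eta^\alpha(z)$ for $|z|<1$, $\alpha\in\mathcal A$. Consider the nonlocal HJB equation $$\sup_{\alpha\in\mathcal A}\{f^\alpha(x)+c^\alpha(x)u(x)-\mathcal I^\alpha[u](x)\}=0\quad\text{in }\mathbb R^N,\qquad(1)$$ $$\mathcal I^\alpha[\phi](x)=\int_{\mathbb R^N\setminus\{0\}}\big(\phi(x+\eta^\alpha(z))-\phi(x)-\eta^\alpha(z)\cdot\nabla\phi(x)1_{|z|<1}\big)\,\nu_\alpha(dz).$$ A bounded upper (lower) semicontinuous $u$ is a viscosity subsolution (supersolution) of (1) if, for all $r\in(0,1)$, all $\phi\in C^2(\mathbb R^N)$ and all global maximum (minimum) points $x$ of $u-\phi$, $$\sup_{\alpha}\Big\{f^\alpha(x)+c^\alpha(x)u(x)-\int_{|z|<r}\big(\phi(x+\eta^\alpha(z))-\phi(x)-\eta^\alpha(z)\cdot\nabla\phi(x)\big)\nu_\alpha(dz)-\int_{|z|\ge r}\big(u(x+\eta^\alpha(z))-u(x)-\eta^\alpha(z)\cdot\nabla\phi(x)1_{|z|<1}\big)\nu_\alpha(dz)\Big\}\le0\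 (\ge0);$$ a viscosity solution is both. For $h>0$ let $x_{\mathbf j}=h\mathbf j$, $\omega_{\mathbf j}(y)=\prod_{i=1}^N\max(0,1-|y_i/h-j_i|)$, $\mathbf j\in\mathbb Z^N$, be the grid and the multilinear interpolation basis. For $k>0$, $\delta\in(0,1)$ let $a^\alpha_\delta=\frac12\int_{|z|<\delta}\eta^\alpha(z)\eta^\alpha(z)^T\nu_\alpha(dz)$, let $s_i=(\sqrt{a^\alpha_\delta})_i$ be the columns of its nonnegative square root, and set $$\mathcal L^\alpha_{\delta,k,h}[\phi](x)=\sum_{i=1}^N\frac{1}{k^2}\Big(\sum_{\mathbf j}\phi(x+x_{\mathbf j})\big(\omega_{\mathbf j}(ks_i)+\omega_{\mathbf j}(-ks_i)\big)-2\phi(x)\Big),$$ $$\mathcal I^{\alpha,\delta}_h[\phi](x)=\sum_{\mathbf j\in\mathbb Z^N}\big(\phi(x+x_{\mathbf j})-\phi(x)\big)\int_{|z|>\delta}\omega_{\mathbf j}(\eta^\alpha(z))\,\nu_\alpha(dz).$$ The scheme is $$\sup_{\alpha\in\mathcal A}\{f^\alpha(x)+c^\alpha(x)u_h(x)-\mathcal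 L^\alpha_{\delta,k,h}[u_h](x)-\mathcal I^{\alpha,\delta}_h[u_h](x)\}=0\quad\text{for all }x\in\mathbb R^N,\qquad u_h\in C_b(\mathbb R^N).\qquad(2)$$ Then for all $0<c_1\le c_2$ there is a constant $C>0$ such that, for all $h\in(0,1)$, all $k$ with $c_1h^{\frac{2\sigma}{4+\sigma}}\le k\le c_2h^{\frac{2\sigma}{4+\sigma}}$ and all $\delta\in(0,1)$ with $c_1h^{\frac4{4+\sigma}}\le\delta\le c_2h^{\frac4{4+\sigma}}$, the viscosity solution $u\in C_b(\mathbb R^N)$ of (1) and the solution $u_h$ of (2) satisfy $$|u(x)-u_h(x)|\le C\,h^{\frac{4-\sigma}{4+\sigma}}\qquad\text{for all }x\in\mathbb R^N.$$ -/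

import Mathlib

open MeasureTheory Set

open scoped Matrix.Norms.L2Operator MatrixOrder

noncomputable section

/-- Euclidean space `ℝ^N`. -/
abbrev Euc (N : ℕ) : Type := EuclideanSpace ℝ (Fin N)

/-- The data of the nonlocal HJB equation
`sup_α { f^α(x) + c^α(x) u(x) - I^α[u](x) } = 0` on `ℝ^N`, with control set `A`. -/
structure HJBData (N : ℕ) (A : Type*) where
  /-- source term `f^α(x)` -/
  f : A → Euc N → ℝ
  /-- zeroth order coefficient `c^α(x)` -/
  c : A → Euc N → ℝ
  /-- jump function `η^α(z)` -/
  η : A → Euc N → Euc N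
  /-- Lévy measure `ν_α` -/
  ν : A → Measure (Euc N)

namespace HJBData

variable {N : ℕ} {A : Type*}

/-! ## Assumptions (the control set is a separable metric space) -/

/-- (A1): `c ≥ λ > 0`, and `c, f, η` are continuous in each of their variables. -/
def A1 [TopologicalSpace A] (P : HJBData N A) : Prop :=
  (∃ lam : ℝ, 0 < lam ∧ ∀ α x, lam ≤ P.c α x) ∧
  (∀ α, Continuous (P.c α)) ∧ (∀ x, Continuous fun α => P.c α x) ∧
  (∀ α, Continuous (P.f α)) ∧ (∀ x, Continuous fun α => P.f α x) ∧
  (∀ α, Continuous (P.η α)) ∧ (∀ z, Continuous fun α => P.η α z)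

/-- (A2): `f` and `c` are bounded and Lipschitz in `x`, and `η` is bounded, uniformly in `α`. -/
def A2 (P : HJBData N A) : Prop :=
  ∃ K : ℝ, 0 < K ∧ ∀ α,
    (∀ x, |P.f α x| ≤ K) ∧ (∀ x y, |P.f α x - P.f α y| ≤ K * ‖x - y‖) ∧
    (∀ x, |P.c α x| ≤ K) ∧ (∀ x y, |P.c α x - P.c α y| ≤ K * ‖x - y‖) ∧
    (∀ z, ‖P.η α z‖ ≤ K)

/-- (A3): `|η^α(z)| ≤ K |z|` for `|z| < 1`, uniformly in `α`. -/
def A3 (P : HJBData N A) : Prop :=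
  ∃ K : ℝ, 0 < K ∧ ∀ α z, ‖z‖ < 1 → ‖P.η α z‖ ≤ K * ‖z‖

/-- (A4): `∫_{|z| ≤ 1} |z|² dν_α + ν_α(|z| > 1) ≤ K`, uniformly in `α`. -/
def A4 (P : HJBData N A) : Prop :=
  ∃ K : ℝ, 0 < K ∧ ∀ α,
    (∫⁻ z in {z : Euc N | ‖z‖ ≤ 1}, ENNReal.ofReal (‖z‖ ^ 2) ∂(P.ν α))
      + P.ν α {z : Euc N | 1 < ‖z‖} ≤ ENNReal.ofReal K

/-- (A5): `ν_α` restricted to the open unit ball is symmetric. -/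
def A5 (P : HJBData N A) : Prop :=
  ∀ α, Measure.map (fun z : Euc N => -z) ((P.ν α).restrict {z : Euc N | ‖z‖ < 1})
    = (P.ν α).restrict {z : Euc N | ‖z‖ < 1}

/-- (A6): on `|z| < 1`, `ν_α` has a Lebesgue density bounded by `C |z|^{-(N+σ)}`,
uniformly in `α`. -/
def A6 (P : HJBData N A) (σ : ℝ) : Prop :=
  ∃ C : ℝ, 0 < C ∧ ∀ α, ∃ g : Euc N → ENNReal, Measurable g ∧
    (P.ν α).restrict {z : Euc N | ‖z‖ < 1}
      = ((volume : Measure (Euc N)).restrict {z : Euc N | ‖z‖ < 1}).withDensity g ∧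
    ∀ z : Euc N, 0 < ‖z‖ → ‖z‖ < 1 → g z ≤ ENNReal.ofReal (C / ‖z‖ ^ ((N : ℝ) + σ))

/-- (A7): `η^α` is odd on the open unit ball. -/
def A7 (P : HJBData N A) : Prop :=
  ∀ α z, ‖z‖ < 1 → P.η α (-z) = -P.η α z

/-! ## Viscosity solutions -/

/-- The nonlocal operator with the test function `φ` in the small jumps and in the compensator,
and `u` in the large jumps:
`∫_{|z|<r} (φ(x+η(z)) - φ(x) - η(z)·∇φ(x)) dν
  + ∫_{|z|≥r} (u(x+η(z)) - u(x) - η(z)·∇φ(x) 1_{|z|<1}) dν`.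
For `φ = u` and `0 < r < 1` this is `I^α[u](x)`. -/
def nonlocalOp (P : HJBData N A) (α : A) (r : ℝ) (φ u : Euc N → ℝ) (x : Euc N) : ℝ :=
  (∫ z in {z : Euc N | ‖z‖ < r},
      (φ (x + P.η α z) - φ x - fderiv ℝ φ x (P.η α z)) ∂(P.ν α)) +
  ∫ z in {z : Euc N | r ≤ ‖z‖},
      (u (x + P.η α z) - u x
        - {z : Euc N | ‖z‖ < 1}.indicator (fun z => fderiv ℝ φ x (P.η α z)) z) ∂(P.ν α)

/-- `sup_α { f^α(x) + c^α(x) u(x) - I^α }`, with the supremum taken in `[-∞, ∞]`. -/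
def testedHamiltonian (P : HJBData N A) (r : ℝ) (φ u : Euc N → ℝ) (x : Euc N) : EReal :=
  ⨆ α, ((P.f α x + P.c α x * u x - P.nonlocalOp α r φ u x : ℝ) : EReal)

/-- Viscosity subsolution inequality at every global maximum of `u - φ`, `φ ∈ C²`. -/
def IsViscositySubsolution (P : HJBData N A) (u : Euc N → ℝ) : Prop :=
  UpperSemicontinuous u ∧ (∃ B : ℝ, ∀ x, |u x| ≤ B) ∧
  ∀ r : ℝ, 0 < r → r < 1 → ∀ φ : Euc N → ℝ, ContDiff ℝ 2 φ → ∀ x,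
    (∀ y, u y - φ y ≤ u x - φ x) → P.testedHamiltonian r φ u x ≤ 0

/-- Viscosity supersolution inequality at every global minimum of `u - φ`, `φ ∈ C²`. -/
def IsViscositySupersolution (P : HJBData N A) (u : Euc N → ℝ) : Prop :=
  LowerSemicontinuous u ∧ (∃ B : ℝ, ∀ x, |u x| ≤ B) ∧
  ∀ r : ℝ, 0 < r → r < 1 → ∀ φ : Euc N → ℝ, ContDiff ℝ 2 φ → ∀ x,
    (∀ y, u x - φ x ≤ u y - φ y) → 0 ≤ P.testedHamiltonian r φ u x

/-- Viscosity solution (automatically bounded and continuous). -/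
def IsViscositySolution (P : HJBData N A) (u : Euc N → ℝ) : Prop :=
  P.IsViscositySubsolution u ∧ P.IsViscositySupersolution u

end HJBData

/-! ## Multilinear interpolation on the grid `h ℤ^N` -/

/-- The grid point `x_j = h j`. -/
def gridNode {N : ℕ} (h : ℝ) (j : Fin N → ℤ) : Euc N :=
  WithLp.toLp 2 fun i => h * (j i : ℝ)

/-- The multilinear (tensor product hat function) basis `ω_j(y; h)`. -/
def hat {N : ℕ} (h : ℝ) (j : Fin N → ℤ) (y : Euc N) : ℝ :=
  ∏ i, max 0 (1 - |y i / h - (j i : ℝ)|)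

/-- The multilinear interpolant `i_h(ψ)(y) = ∑_j ψ(x_j) ω_j(y; h)` (locally a finite sum). -/
def interpolant {N : ℕ} (h : ℝ) (ψ : Euc N → ℝ) (y : Euc N) : ℝ :=
  ∑' j : Fin N → ℤ, ψ (gridNode h j) * hat h j y

namespace HJBData

variable {N : ℕ} {A : Type*}

/-! ## The diffusion corrected semi-Lagrangian / quadrature scheme -/

/-- `a_δ^α = (1/2) ∫_{|z|<δ} η^α(z) η^α(z)ᵀ ν_α(dz)`. -/
def diffMatrix (P : HJBData N A) (α : A) (δ : ℝ) : Matrix (Fin N) (Fin N) ℝ :=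
  Matrix.of fun i j =>
    (1 / 2) * ∫ z in {z : Euc N | ‖z‖ < δ}, P.η α z i * P.η α z j ∂(P.ν α)

/-- The `i`-th column of the nonnegative square root of `a_δ^α`. -/
def sqrtCol (P : HJBData N A) (α : A) (δ : ℝ) (i : Fin N) : Euc N :=
  WithLp.toLp 2 fun l => CFC.sqrt (P.diffMatrix α δ) l i

/-- The semi-Lagrangian approximation of `tr[a_δ^α D²φ](x)`: central second differences with
step `k` along the columns of the square root, the off-grid values being interpolated
on the grid `x + h ℤ^N`. -/
def localDiscrete (P : HJBData N A) (α : A) (δ k h : ℝ) (φ : Euc N → ℝ) (x : Euc N) : ℝ :=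
  ∑ i : Fin N,
    (interpolant h (fun y => φ (x + y)) (k • P.sqrtCol α δ i)
      + interpolant h (fun y => φ (x + y)) (-(k • P.sqrtCol α δ i)) - 2 * φ x) / k ^ 2

/-- The quadrature weight `κ_{h,j}^{α,δ} = ∫_{|z|>δ} ω_j(η^α(z); h) ν_α(dz)`. -/
def weight (P : HJBData N A) (α : A) (δ h : ℝ) (j : Fin N → ℤ) : ℝ :=
  ∫ z in {z : Euc N | δ < ‖z‖}, hat h j (P.η α z) ∂(P.ν α)

/-- The quadrature `∑_j (φ(x + x_j) - φ(x)) κ_{h,j}^{α,δ}`; only finitely many weights are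
nonzero, as `η^α` is bounded. -/
def nonlocalDiscrete (P : HJBData N A) (α : A) (δ h : ℝ) (φ : Euc N → ℝ) (x : Euc N) : ℝ :=
  ∑' j : Fin N → ℤ, (φ (x + gridNode h j) - φ x) * P.weight α δ h j

/-- `v ∈ C_b(ℝ^N)` solves the scheme with parameters `h`, `k`, `δ` at every point of `ℝ^N`. -/
def IsSchemeSolution (P : HJBData N A) (h k δ : ℝ) (v : Euc N → ℝ) : Prop :=
  Continuous v ∧ (∃ B : ℝ, ∀ x, |v x| ≤ B) ∧
  ∀ x, (⨆ α, ((P.f α x + P.c α x * v x - P.localDiscrete α δ k h v x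
    - P.nonlocalDiscrete α δ h v x : ℝ) : EReal)) = 0

end HJBData

end

/-! The scheme is monotone: for each `α` its two discrete operators together form the jump operator
of a finite nonnegative atomic measure (`LevyPair.exists_scheme_measure`). For such operators
`jump_comparison` gives a comparison principle whose constant does not see the mass of the measures,
which blows up as the grid is refined. Since `η` does not depend on `x`, the operators commute with
translations. Comparing a solution with its translates yields a Lipschitz constant `L` that is
independent of `h`, `k`, `δ` (`jump_solution_lipschitz`).

Mollifying a Lipschitz subsolution at scale `ε` keeps it a subsolution up to `O(ε)`, because for
each fixed `α` the inequality is linear (`mollify_subsolution`). Derivatives of order `n` of the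
result are of size `L ε^(1-n)`. On such functions `LevyPair.scheme_consistency` bounds the
difference between scheme and Lévy operator by a multiple of `ε⁻³ (δ^(4-σ) + k² δ^(4-2σ)) + ε⁻¹
(h²/k² + h² δ^(-σ))`. For `k ~ h^(2σ/(4+σ))`, `δ ~ h^(4/(4+σ))` and `ε = h^((4-σ)/(4+σ))` all four
terms are `O(ε)`, and this is the rate.

Bound for `v - u`: the mollified scheme solution is a smooth approximate subsolution of the
equation, so it lies below the viscosity solution up to `O(ε)` (`HJBData.smooth_le_supersolution`).

Bound for `u - v`: mollifying `u` itself would need Lipschitz bounds for `u` and a linear theory of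
viscosity subsolutions. Both are avoided by an intermediate function `w`, the solution of the
equation with the jumps `|z| < r` deleted. Its jump measures are finite again, so
`exists_jump_solution` provides `w` with the same constants, whatever `r` is. Doubling of variables
puts `u` below `w` up to an error that vanishes with `r` (`HJBData.subsolution_le_truncated`). The
mollified `w` is an approximate subsolution of the scheme and is compared with `v`, and finally `r →
0`. -/

/-! ## Jump operators of finite measures -/

/-- The translation invariant jump operator `φ ↦ ∫ (φ(x + y) - φ(x)) μ(dy)`. -/
noncomputable def jumpOp {N : ℕ} (μ : Measure (Euc N)) (φ : Euc N → ℝ) (x : Euc N) : ℝ :=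
  ∫ y, (φ (x + y) - φ x) ∂μ

theorem integrable_of_abs_le {X : Type*} [MeasurableSpace X] {μ : Measure X} [IsFiniteMeasure μ]
    {g : X → ℝ} (hg : AEStronglyMeasurable g μ) {B : ℝ} (hB : ∀ x, |g x| ≤ B) :
    Integrable g μ :=
  Integrable.of_bound hg B (Filter.Eventually.of_forall hB)

theorem integrable_translate {N : ℕ} {μ : Measure (Euc N)} [IsFiniteMeasure μ] {w : Euc N → ℝ}
    (hw : Continuous w) {B : ℝ} (hB : ∀ x, |w x| ≤ B) (x : Euc N) :
    Integrable (fun y => w (x + y)) μ :=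
  integrable_of_abs_le (hw.comp (continuous_const.add continuous_id)).aestronglyMeasurable
    (fun y => hB (x + y))

theorem integrable_increment {N : ℕ} {μ : Measure (Euc N)} [IsFiniteMeasure μ] {w : Euc N → ℝ}
    (hw : Continuous w) {B : ℝ} (hB : ∀ x, |w x| ≤ B) (x : Euc N) :
    Integrable (fun y => w (x + y) - w x) μ :=
  (integrable_translate hw hB x).sub (integrable_const _)

theorem jumpOp_eq_sub {N : ℕ} {μ : Measure (Euc N)} [IsFiniteMeasure μ] {w : Euc N → ℝ}
    (hw : Continuous w) {B : ℝ} (hB : ∀ x, |w x| ≤ B) (x : Euc N) :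
    jumpOp μ w x = (∫ y, w (x + y) ∂μ) - μ.real univ * w x := by
  unfold jumpOp
  rw [integral_sub (integrable_translate hw hB x) (integrable_const _), integral_const, smul_eq_mul]

/-- Approximate comparison principle for sub- and supersolutions of equations with jump operators
of uniformly bounded mass. -/
theorem jump_comparison {N : ℕ} {A : Type*} {μ : A → Measure (Euc N)}
    [∀ α, IsFiniteMeasure (μ α)] {M : ℝ} (hM0 : 0 ≤ M) (hM : ∀ α, (μ α).real univ ≤ M)
    {lam : ℝ} (hlam : 0 < lam) {f₁ f₂ c₁ c₂ : A → Euc N → ℝ} (hc : ∀ α x, lam ≤ c₁ α x)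
    {w₁ w₂ : Euc N → ℝ} (hw₁ : Continuous w₁) (hw₂ : Continuous w₂)
    {B₁ B₂ : ℝ} (hB₁ : ∀ x, |w₁ x| ≤ B₁) (hB₂ : ∀ x, |w₂ x| ≤ B₂) {e : ℝ} (he : 0 ≤ e)
    (hsub : ∀ α x, f₁ α x + c₁ α x * w₁ x - jumpOp (μ α) w₁ x ≤ 0)
    (hsup : ∀ x, ∀ κ > 0, ∃ α, -κ ≤ f₂ α x + c₂ α x * w₂ x - jumpOp (μ α) w₂ x)
    (herr : ∀ α x, f₂ α x - f₁ α x + (c₂ α x - c₁ α x) * w₂ x ≤ e) (x : Euc N) :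
    w₁ x - w₂ x ≤ e / lam := by
  have hbdd : BddAbove (range fun x => w₁ x - w₂ x) := by
    refine ⟨B₁ + B₂, ?_⟩
    rintro _ ⟨y, rfl⟩
    have h1 := abs_le.1 (hB₁ y)
    have h2 := abs_le.1 (hB₂ y)
    simp only
    linarith
  set S : ℝ := ⨆ x, (w₁ x - w₂ x) with hS
  have hle : ∀ y, w₁ y - w₂ y ≤ S := fun y => le_ciSup hbdd y
  refine (hle x).trans ?_
  by_contra! hcon
  rw [div_lt_iff₀ hlam] at hcon
  have hSpos : 0 < S := by
    by_contra! h
    nlinarith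
  -- The supremum need not be attained, so a point within `κ` of it is used. This costs `lam κ` in
  -- the zeroth order term, `M κ` in the jump term and `κ` in the supersolution inequality. The
  -- denominator exceeds `M + 1 + lam`, so the total stays strictly below `S lam - e`.
  set κ : ℝ := (S * lam - e) / (M + 2 + lam) with hκ
  have hden : 0 < M + 2 + lam := by linarith
  have hκpos : 0 < κ := div_pos (by linarith) hden
  have hκeq : κ * (M + 2 + lam) = S * lam - e := by rw [hκ]; field_simp
  obtain ⟨y, hy⟩ := exists_lt_of_lt_ciSup (show S - κ < ⨆ x, (w₁ x - w₂ x) by linarith)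
  obtain ⟨α, hα⟩ := hsup y κ hκpos
  have h1 := hsub α y
  have hJ : jumpOp (μ α) w₁ y - jumpOp (μ α) w₂ y ≤ M * κ := by
    unfold jumpOp
    rw [← integral_sub (integrable_increment hw₁ hB₁ y) (integrable_increment hw₂ hB₂ y)]
    calc ∫ z, (w₁ (y + z) - w₁ y - (w₂ (y + z) - w₂ y)) ∂(μ α)
        ≤ ∫ _z, κ ∂(μ α) := by
          refine integral_mono ((integrable_increment hw₁ hB₁ y).sub
            (integrable_increment hw₂ hB₂ y)) (integrable_const _) fun z => ?_
          have := hle (y + z)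
          simp only
          linarith
      _ = (μ α).real univ * κ := by rw [integral_const, smul_eq_mul]
      _ ≤ M * κ := by gcongr; exact hM α
  have h2 := herr α y
  have hSκ : κ < S := by
    by_contra! h
    nlinarith
  have hd : 0 ≤ w₁ y - w₂ y := by linarith
  have h3 : lam * (S - κ) ≤ c₁ α y * (w₁ y - w₂ y) := by
    have := mul_le_mul_of_nonneg_right (hc α y) hd
    nlinarith
  nlinarith

/-- A pointwise solution of `sup_α (f + c w - J w) = 0`, the supremum being split into an upper
bound and an almost attained lower bound. -/
def IsJumpSolution {N : ℕ} {A : Type*} (μ : A → Measure (Euc N)) (f c : A → Euc N → ℝ)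
    (w : Euc N → ℝ) : Prop :=
  (∀ α x, f α x + c α x * w x - jumpOp (μ α) w x ≤ 0) ∧
    ∀ x, ∀ κ > 0, ∃ α, -κ ≤ f α x + c α x * w x - jumpOp (μ α) w x

theorem jumpOp_const {N : ℕ} (μ : Measure (Euc N)) (b : ℝ) (x : Euc N) :
    jumpOp μ (fun _ => b) x = 0 := by
  simp [jumpOp]

theorem jumpOp_translate {N : ℕ} (μ : Measure (Euc N)) (w : Euc N → ℝ) (e x : Euc N) :
    jumpOp μ (fun x => w (x + e)) x = jumpOp μ w (x + e) := by
  unfold jumpOp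
  simp only [add_right_comm]

/-- The constants `±K / lam` are barriers, because jump operators annihilate constants and `c ≥
lam`. -/
theorem jump_solution_bound {N : ℕ} {A : Type*} [Nonempty A] {μ : A → Measure (Euc N)}
    [∀ α, IsFiniteMeasure (μ α)] {M : ℝ} (hM0 : 0 ≤ M) (hM : ∀ α, (μ α).real univ ≤ M)
    {lam K : ℝ} (hlam : 0 < lam) (hK : 0 ≤ K) {f c : A → Euc N → ℝ} (hc : ∀ α x, lam ≤ c α x)
    (hf : ∀ α x, |f α x| ≤ K) {w : Euc N → ℝ} (hw : Continuous w)
    {B : ℝ} (hB : ∀ x, |w x| ≤ B) (hsol : IsJumpSolution μ f c w) (x : Euc N) :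
    |w x| ≤ K / lam := by
  have hKl : 0 ≤ K / lam := by positivity
  have habs : ∀ b : ℝ, |b| ≤ |b| := fun _ => le_rfl
  have hmul : lam * (K / lam) = K := by field_simp
  rw [abs_le]
  constructor
  · have := jump_comparison hM0 hM hlam hc (f₁ := f) (f₂ := f) (c₂ := c)
      (w₁ := fun _ => -(K / lam)) (w₂ := w) continuous_const hw (fun _ => habs _) hB le_rfl
      (fun α y => ?_) hsol.2 (fun α y => by simp) x
    · simp only [zero_div] at this
      linarith
    · rw [jumpOp_const]
      have h1 := (abs_le.1 (hf α y)).2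
      have h2 := mul_le_mul_of_nonneg_right (hc α y) hKl
      nlinarith
  · have := jump_comparison hM0 hM hlam hc (f₁ := f) (f₂ := f) (c₂ := c)
      (w₁ := w) (w₂ := fun _ => K / lam) hw continuous_const hB (fun _ => habs _) le_rfl
      hsol.1 (fun y κ hκ => ?_) (fun α y => by simp) x
    · simp only [zero_div] at this
      linarith
    · obtain ⟨α⟩ := ‹Nonempty A›
      refine ⟨α, ?_⟩
      rw [jumpOp_const]
      have h1 := (abs_le.1 (hf α y)).1
      have h2 := mul_le_mul_of_nonneg_right (hc α y) hKl
      nlinarith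

/-- A translate of the solution solves the equation with translated coefficients, which differ from
the original ones by at most `K ‖x - y‖`. Comparison turns this into a Lipschitz bound that is free
of `M`. -/
theorem jump_solution_lipschitz {N : ℕ} {A : Type*} {μ : A → Measure (Euc N)}
    [∀ α, IsFiniteMeasure (μ α)] {M : ℝ} (hM0 : 0 ≤ M) (hM : ∀ α, (μ α).real univ ≤ M)
    {lam K : ℝ} (hlam : 0 < lam) (hK : 0 ≤ K) {f c : A → Euc N → ℝ} (hc : ∀ α x, lam ≤ c α x)
    (hf : ∀ α x y, |f α x - f α y| ≤ K * ‖x - y‖) (hcl : ∀ α x y, |c α x - c α y| ≤ K * ‖x - y‖)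
    {w : Euc N → ℝ} (hw : Continuous w) {B : ℝ} (hB : ∀ x, |w x| ≤ B)
    (hsol : IsJumpSolution μ f c w) (x y : Euc N) :
    |w x - w y| ≤ K * (1 + B) / lam * ‖x - y‖ := by
  have hB0 : 0 ≤ B := (abs_nonneg _).trans (hB x)
  have key : ∀ x y : Euc N, w x - w y ≤ K * (1 + B) / lam * ‖x - y‖ := by
    intro x y
    have h := jump_comparison hM0 hM hlam (f₁ := fun α z => f α (z + (x - y))) (f₂ := f)
      (c₁ := fun α z => c α (z + (x - y))) (c₂ := c) (w₁ := fun z => w (z + (x - y))) (w₂ := w)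
      (fun α z => hc α _) (hw.comp (continuous_id.add continuous_const)) hw (fun z => hB _) hB
      (e := K * (1 + B) * ‖x - y‖) (by positivity)
      (fun α z => by rw [jumpOp_translate]; exact hsol.1 α _) hsol.2 (fun α z => ?_) y
    · simp only [add_sub_cancel] at h
      rw [div_mul_eq_mul_div]
      exact h
    · have h1 := (abs_le.1 (hf α z (z + (x - y)))).2
      have h2 : (c α z - c α (z + (x - y))) * w z ≤ K * ‖z - (z + (x - y))‖ * B := by
        refine (le_abs_self _).trans ?_
        rw [abs_mul]
        exact mul_le_mul (hcl α _ _) (hB z) (abs_nonneg _) (by positivity)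
      have h3 : ‖z - (z + (x - y))‖ = ‖x - y‖ := by
        rw [sub_add_cancel_left, norm_neg]
      rw [h3] at h1 h2
      linarith
  rw [abs_le]
  have h1 := key x y
  have h2 := key y x
  rw [norm_sub_rev] at h2
  constructor <;> linarith

/-! ### Existence for finite jump measures by a contracting Euler iteration. -/

theorem ciInf_le_ciInf_add {A : Type*} [Nonempty A] {F G : A → ℝ} {B D : ℝ}
    (hF : ∀ α, -B ≤ F α) (h : ∀ α, F α ≤ G α + D) : (⨅ α, F α) ≤ (⨅ α, G α) + D := by
  rw [← sub_le_iff_le_add]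
  refine le_ciInf fun α => ?_
  have h1 : (⨅ α, F α) ≤ F α := ciInf_le ⟨-B, by rintro _ ⟨a, rfl⟩; exact hF a⟩ α
  linarith [h α]

/-- One explicit Euler step of size `τ` for the linear equation `f + c w - J w = 0`. -/
noncomputable def eulerStep {N : ℕ} (μ : Measure (Euc N)) (f c : Euc N → ℝ) (τ : ℝ)
    (w : Euc N → ℝ) (x : Euc N) : ℝ :=
  w x - τ * (f x + c x * w x - jumpOp μ w x)

/-- The CFL condition `τ (K + M) ≤ 1` makes the coefficient of `w x` nonnegative, so the step is
monotone, and `c ≥ lam` gives the factor `1 - τ lam`. Two base points with common increments are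
allowed so that one estimate serves three times: `w' = 0` or `w = 0` for the sup bound, `w' = w` for
the Lipschitz bound, `x' = x` for the contraction. -/
theorem eulerStep_sub_le {N : ℕ} {μ : Measure (Euc N)} [IsFiniteMeasure μ] {M : ℝ}
    (hM : μ.real univ ≤ M) {lam K : ℝ} {f c : Euc N → ℝ}
    (hc : ∀ x, lam ≤ c x) (hcK : ∀ x, |c x| ≤ K) (hf : ∀ x y, |f x - f y| ≤ K * ‖x - y‖)
    (hcl : ∀ x y, |c x - c y| ≤ K * ‖x - y‖) {τ : ℝ} (hτ : 0 ≤ τ) (hτM : τ * (K + M) ≤ 1)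
    {w w' : Euc N → ℝ} (hw : Continuous w) (hw' : Continuous w') {B B' : ℝ}
    (hB : ∀ x, |w x| ≤ B) (hB' : ∀ x, |w' x| ≤ B') {D : ℝ} (hD : 0 ≤ D) (x x' : Euc N)
    (h : ∀ y, w (x + y) - w' (x' + y) ≤ D) :
    eulerStep μ f c τ w x - eulerStep μ f c τ w' x'
      ≤ (1 - τ * lam) * D + τ * (K * ‖x - x'‖ * (1 + B')) := by
  unfold eulerStep
  rw [jumpOp_eq_sub hw hB, jumpOp_eq_sub hw' hB']
  have hint : (∫ y, w (x + y) ∂μ) - ∫ y, w' (x' + y) ∂μ ≤ μ.real univ * D := by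
    rw [← integral_sub (integrable_translate hw hB x) (integrable_translate hw' hB' x')]
    calc _ ≤ ∫ _y, D ∂μ := integral_mono ((integrable_translate hw hB x).sub
            (integrable_translate hw' hB' x')) (integrable_const _) h
      _ = _ := by rw [integral_const, smul_eq_mul]
  have h0 : w x - w' x' ≤ D := by simpa using h 0
  have hcx := abs_le.1 (hcK x)
  have ha : 0 ≤ 1 - τ * (c x + μ.real univ) := by
    have : τ * (c x + μ.real univ) ≤ τ * (K + M) := by gcongr; exact hcx.2
    linarith
  have h1 := mul_le_mul_of_nonneg_left h0 ha
  have h2 := mul_le_mul_of_nonneg_left hint hτ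
  have h3 : -(f x - f x') ≤ K * ‖x - x'‖ := (neg_le_abs _).trans (hf x x')
  have h4 : -((c x - c x') * w' x') ≤ K * ‖x - x'‖ * B' := by
    refine (neg_le_abs _).trans ?_
    rw [abs_mul]
    exact mul_le_mul (hcl _ _) (hB' _) (abs_nonneg _) ((abs_nonneg _).trans (hcl x x'))
  have h5 := mul_le_mul_of_nonneg_left (add_le_add h3 h4) hτ
  have h6 : τ * lam * D ≤ τ * c x * D := by gcongr; exact hc x
  nlinarith

theorem continuous_of_abs_sub_le {N : ℕ} {w : Euc N → ℝ} {L : ℝ}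
    (hL : ∀ x y, |w x - w y| ≤ L * ‖x - y‖) : Continuous w := by
  have : LipschitzWith L.toNNReal w := by
    refine LipschitzWith.of_dist_le_mul fun x y => ?_
    rw [Real.dist_eq, dist_eq_norm]
    refine (hL x y).trans ?_
    gcongr
    exact Real.le_coe_toNNReal L
  exact this.continuous

/-- Existence of a Lipschitz solution, with bounds independent of the mass of the jump measures. -/
theorem exists_jump_solution {N : ℕ} {A : Type*} [Nonempty A] {μ : A → Measure (Euc N)}
    [∀ α, IsFiniteMeasure (μ α)] {M : ℝ} (hM0 : 0 ≤ M) (hM : ∀ α, (μ α).real univ ≤ M)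
    {lam K : ℝ} (hlam : 0 < lam) (hK : 0 < K) {f c : A → Euc N → ℝ} (hc : ∀ α x, lam ≤ c α x)
    (hcK : ∀ α x, |c α x| ≤ K) (hfK : ∀ α x, |f α x| ≤ K)
    (hf : ∀ α x y, |f α x - f α y| ≤ K * ‖x - y‖)
    (hcl : ∀ α x y, |c α x - c α y| ≤ K * ‖x - y‖) :
    ∃ w : Euc N → ℝ, (∀ x, |w x| ≤ K / lam) ∧
      (∀ x y, |w x - w y| ≤ K * (1 + K / lam) / lam * ‖x - y‖) ∧ IsJumpSolution μ f c w := by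
  set B : ℝ := K / lam with hBdef
  have hB0 : 0 < B := by positivity
  set L : ℝ := K * (1 + B) / lam with hLdef
  have hL0 : 0 < L := by positivity
  have hlB : lam * B = K := by rw [hBdef]; field_simp
  have hlL : lam * L = K * (1 + B) := by rw [hLdef]; field_simp
  have hlamK : lam ≤ K := by
    obtain ⟨α⟩ := ‹Nonempty A›
    exact (hc α 0).trans ((le_abs_self _).trans (hcK α 0))
  set τ : ℝ := 1 / (K + M) with hτdef
  have hτ0 : 0 < τ := by positivity
  have hτM : τ * (K + M) = 1 := by rw [hτdef]; field_simp
  have hτlam : 0 ≤ 1 - τ * lam := by nlinarith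
  -- The relations `lam B = K` and `lam L = K (1 + B)` are exactly what makes both bounds invariant
  -- under every Euler step. They therefore pass to the fixed point without any dependence on `M`.
  let S : Set (BoundedContinuousFunction (Euc N) ℝ) :=
    {w | (∀ x, |w x| ≤ B) ∧ ∀ x y, |w x - w y| ≤ L * ‖x - y‖}
  have hScl : IsClosed S := by
    have h1 : S = (⋂ x, {w : BoundedContinuousFunction (Euc N) ℝ | |w x| ≤ B}) ∩
        ⋂ x, ⋂ y, {w : BoundedContinuousFunction (Euc N) ℝ | |w x - w y| ≤ L * ‖x - y‖} := by
      ext w; simp [S]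
    have hev : ∀ x, Continuous fun w : BoundedContinuousFunction (Euc N) ℝ => w x :=
      fun x => by fun_prop
    rw [h1]
    refine (isClosed_iInter fun x => isClosed_le (hev x).abs continuous_const).inter
      (isClosed_iInter fun x => isClosed_iInter fun y =>
        isClosed_le ((hev x).sub (hev y)).abs continuous_const)
  have hstepB : ∀ w ∈ S, ∀ α x, |eulerStep (μ α) (f α) (c α) τ w x| ≤ B := by
    intro w hw α x
    have e0 : eulerStep (μ α) (f α) (c α) τ (fun _ => (0 : ℝ)) x = -(τ * f α x) := by
      simp [eulerStep, jumpOp_const]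
    have h1 := eulerStep_sub_le (hM α) (hc α) (hcK α) (hf α) (hcl α) hτ0.le hτM.le w.continuous
      continuous_const hw.1 (w' := fun _ => 0) (B' := 0) (by simp) hB0.le x x
      (fun y => by simpa using (abs_le.1 (hw.1 (x + y))).2)
    have h2 := eulerStep_sub_le (hM α) (hc α) (hcK α) (hf α) (hcl α) hτ0.le hτM.le
      continuous_const w.continuous (w := fun _ => 0) (B := 0) (by simp) hw.1 hB0.le x x
      (fun y => by have := (abs_le.1 (hw.1 (x + y))).1; linarith)
    rw [e0] at h1 h2
    simp only [sub_self, norm_zero, mul_zero, zero_mul, add_zero] at h1 h2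
    have h3 := abs_le.1 (hfK α x)
    have h4 := mul_le_mul_of_nonneg_left h3.1 hτ0.le
    have h5 := mul_le_mul_of_nonneg_left h3.2 hτ0.le
    have h6 : τ * lam * B = τ * K := by rw [mul_assoc, hlB]
    rw [abs_le]
    constructor <;> linarith
  have hstepL : ∀ w ∈ S, ∀ α x y, eulerStep (μ α) (f α) (c α) τ w x
      ≤ eulerStep (μ α) (f α) (c α) τ w y + L * ‖x - y‖ := by
    intro w hw α x y
    have h1 := eulerStep_sub_le (hM α) (hc α) (hcK α) (hf α) (hcl α) hτ0.le hτM.le w.continuous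
      w.continuous hw.1 hw.1 (D := L * ‖x - y‖) (by positivity) x y
      (fun z => by
        have := (abs_le.1 (hw.2 (x + z) (y + z))).2
        rwa [add_sub_add_right_eq_sub] at this)
    have h6 : τ * lam * (L * ‖x - y‖) = τ * (K * ‖x - y‖ * (1 + B)) := by
      rw [show τ * lam * (L * ‖x - y‖) = τ * (lam * L) * ‖x - y‖ by ring, hlL]; ring
    linarith
  have hT : ∀ w ∈ S, ∃ v ∈ S, ∀ x, v x = ⨅ α, eulerStep (μ α) (f α) (c α) τ w x := by
    intro w hw
    have hb : ∀ x, |⨅ α, eulerStep (μ α) (f α) (c α) τ w x| ≤ B := by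
      intro x
      rw [abs_le]
      refine ⟨le_ciInf fun α => (abs_le.1 (hstepB w hw α x)).1, ?_⟩
      obtain ⟨α⟩ := ‹Nonempty A›
      refine (ciInf_le ⟨-B, ?_⟩ α).trans (abs_le.1 (hstepB w hw α x)).2
      rintro _ ⟨a, rfl⟩
      exact (abs_le.1 (hstepB w hw a x)).1
    have hl : ∀ x y, |(⨅ α, eulerStep (μ α) (f α) (c α) τ w x)
        - ⨅ α, eulerStep (μ α) (f α) (c α) τ w y| ≤ L * ‖x - y‖ := by
      intro x y
      have h1 := ciInf_le_ciInf_add (fun α => (abs_le.1 (hstepB w hw α x)).1)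
        (fun α => hstepL w hw α x y)
      have h2 := ciInf_le_ciInf_add (fun α => (abs_le.1 (hstepB w hw α y)).1)
        (fun α => hstepL w hw α y x)
      rw [norm_sub_rev] at h2
      rw [abs_le]
      constructor <;> linarith
    refine ⟨BoundedContinuousFunction.ofNormedAddCommGroup _ (continuous_of_abs_sub_le hl) B
      (fun x => by simpa using hb x), ⟨fun x => by simpa using hb x, fun x y => by
        simpa using hl x y⟩, fun x => by simp⟩
  choose! T hTS hTv using hT
  have hcontr : ∀ w ∈ S, ∀ w' ∈ S, dist (T w) (T w') ≤ (1 - τ * lam) * dist w w' := by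
    have key : ∀ w ∈ S, ∀ w' ∈ S, ∀ x, T w x ≤ T w' x + (1 - τ * lam) * dist w w' := by
      intro w hw w' hw' x
      rw [hTv w hw, hTv w' hw']
      refine ciInf_le_ciInf_add (fun α => (abs_le.1 (hstepB w hw α x)).1) fun α => ?_
      have h1 := eulerStep_sub_le (hM α) (hc α) (hcK α) (hf α) (hcl α) hτ0.le hτM.le w.continuous
        w'.continuous hw.1 hw'.1 (D := dist w w') dist_nonneg x x
        (fun z => (le_abs_self _).trans (by
          rw [← Real.dist_eq]; exact BoundedContinuousFunction.dist_coe_le_dist (x + z)))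
      simp only [sub_self, norm_zero, mul_zero, zero_mul, add_zero] at h1
      linarith
    intro w hw w' hw'
    rw [BoundedContinuousFunction.dist_le (by positivity)]
    intro x
    have h1 := key w hw w' hw' x
    have h2 := key w' hw' w hw x
    rw [dist_comm w' w] at h2
    rw [Real.dist_eq, abs_le]
    constructor <;> linarith
  have hmaps : MapsTo T S S := fun w hw => hTS w hw
  have hCW : ContractingWith (Real.toNNReal (1 - τ * lam)) (hmaps.restrict T S S) := by
    refine ⟨?_, LipschitzWith.of_dist_le_mul fun w w' => ?_⟩
    · rw [← Real.toNNReal_one, Real.toNNReal_lt_toNNReal_iff one_pos]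
      nlinarith [mul_pos hτ0 hlam]
    · rw [Real.coe_toNNReal _ hτlam]
      exact hcontr w w.2 w' w'.2
  have h0S : (0 : BoundedContinuousFunction (Euc N) ℝ) ∈ S :=
    ⟨fun x => by simpa using hB0.le, fun x y => by
      simpa using mul_nonneg hL0.le (norm_nonneg (x - y))⟩
  -- As `τ > 0`, the fixed point relation `w = inf_α (w - τ G_α)` says that `sup_α G_α = 0`.
  obtain ⟨w, hwS, hfix, -⟩ := hCW.exists_fixedPoint' hScl.isComplete hmaps h0S (edist_ne_top _ _)
  have hinf : ∀ x, (⨅ α, eulerStep (μ α) (f α) (c α) τ w x) = w x := by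
    intro x
    rw [← hTv w hwS, hfix]
  refine ⟨w, hwS.1, hwS.2, fun α x => ?_, fun x κ hκ => ?_⟩
  · have h1 : w x ≤ eulerStep (μ α) (f α) (c α) τ w x := by
      conv_lhs => rw [← hinf x]
      refine ciInf_le ⟨-B, ?_⟩ α
      rintro _ ⟨a, rfl⟩
      exact (abs_le.1 (hstepB w hwS a x)).1
    unfold eulerStep at h1
    by_contra! hcon
    nlinarith
  · obtain ⟨α, hα⟩ := exists_lt_of_ciInf_lt
      (show (⨅ α, eulerStep (μ α) (f α) (c α) τ w x) < w x + τ * κ by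
        rw [hinf]; linarith [mul_pos hτ0 hκ])
    refine ⟨α, ?_⟩
    unfold eulerStep at hα
    by_contra! hcon
    nlinarith

/-! ## Mollification -/

/-- A bump function on the unit ball. -/
noncomputable def unitBump (N : ℕ) : ContDiffBump (0 : Euc N) :=
  ⟨1 / 2, 1, by norm_num, by norm_num⟩

/-- A smooth probability density supported in the unit ball. -/
noncomputable def mollKernel (N : ℕ) : Euc N → ℝ := (unitBump N).normed volume

theorem mollKernel_nonneg {N : ℕ} (z : Euc N) : 0 ≤ mollKernel N z :=
  (unitBump N).nonneg_normed z

theorem mollKernel_contDiff {N : ℕ} (n : ℕ∞) : ContDiff ℝ n (mollKernel N) :=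
  (unitBump N).contDiff_normed

theorem mollKernel_tsupport {N : ℕ} : tsupport (mollKernel N) = Metric.closedBall 0 1 :=
  (unitBump N).tsupport_normed_eq

theorem mollKernel_integrable {N : ℕ} : Integrable (mollKernel N) :=
  (unitBump N).integrable_normed

theorem mollKernel_integral {N : ℕ} : ∫ z, mollKernel N z = 1 :=
  (unitBump N).integral_normed

theorem norm_lt_one_of_mollKernel_ne_zero {N : ℕ} {z : Euc N} (h : mollKernel N z ≠ 0) :
    ‖z‖ < 1 := by
  have : z ∈ Function.support ((unitBump N).normed volume) := h
  rw [(unitBump N).support_normed_eq] at this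
  simpa [unitBump] using this

/-- The mollification of `v` at scale `ε`. -/
noncomputable def mollify {N : ℕ} (ε : ℝ) (v : Euc N → ℝ) (x : Euc N) : ℝ :=
  ∫ z, mollKernel N z * v (x - ε • z)

theorem integrable_mollKernel_mul {N : ℕ} {g : Euc N → ℝ} (hg : Continuous g) {B : ℝ}
    (hB : ∀ x, |g x| ≤ B) : Integrable fun z => mollKernel N z * g z :=
  mollKernel_integrable.mul_bdd (c := B) hg.aestronglyMeasurable (Filter.Eventually.of_forall hB)

theorem integral_mollKernel_mul_le {N : ℕ} {g : Euc N → ℝ} (hg : Continuous g) {B : ℝ}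
    (hB : ∀ x, |g x| ≤ B) {b : ℝ} (hb : ∀ z, ‖z‖ < 1 → g z ≤ b) :
    ∫ z, mollKernel N z * g z ≤ b := by
  calc ∫ z, mollKernel N z * g z ≤ ∫ z, mollKernel N z * b := by
        refine integral_mono (integrable_mollKernel_mul hg hB) (mollKernel_integrable.mul_const b)
          fun z => ?_
        by_cases h : mollKernel N z = 0
        · simp [h]
        · exact mul_le_mul_of_nonneg_left (hb z (norm_lt_one_of_mollKernel_ne_zero h))
            (mollKernel_nonneg z)
    _ = b := by rw [integral_mul_const, mollKernel_integral, one_mul]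

theorem abs_integral_mollKernel_mul_le {N : ℕ} {g : Euc N → ℝ} (hg : Continuous g) {B : ℝ}
    (hB : ∀ x, |g x| ≤ B) {b : ℝ} (hb : ∀ z, ‖z‖ < 1 → |g z| ≤ b) :
    |∫ z, mollKernel N z * g z| ≤ b := by
  rw [abs_le]
  constructor
  · have := integral_mollKernel_mul_le hg.neg (B := B) (fun x => by simpa using hB x) (b := b)
      (fun z hz => by have := (abs_le.1 (hb z hz)).1; simp only [Pi.neg_apply]; linarith)
    simp only [Pi.neg_apply, mul_neg, integral_neg] at this
    linarith
  · exact integral_mollKernel_mul_le hg hB fun z hz => (abs_le.1 (hb z hz)).2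

theorem abs_mollify_le {N : ℕ} {v : Euc N → ℝ} (hv : Continuous v) {B : ℝ}
    (hB : ∀ x, |v x| ≤ B) (ε : ℝ) (x : Euc N) : |mollify ε v x| ≤ B :=
  abs_integral_mollKernel_mul_le (g := fun z => v (x - ε • z)) (by fun_prop) (fun z => hB _)
    fun z _ => hB _

theorem abs_mollify_sub_le {N : ℕ} {v : Euc N → ℝ} {B L : ℝ}
    (hB : ∀ x, |v x| ≤ B) (hL : ∀ x y, |v x - v y| ≤ L * ‖x - y‖) (hL0 : 0 ≤ L)
    {ε : ℝ} (hε : 0 ≤ ε) (x : Euc N) : |mollify ε v x - v x| ≤ L * ε := by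
  have hv := continuous_of_abs_sub_le hL
  have h1 : mollify ε v x - v x = ∫ z, mollKernel N z * (v (x - ε • z) - v x) := by
    simp only [mul_sub]
    rw [integral_sub (integrable_mollKernel_mul (g := fun z => v (x - ε • z)) (by fun_prop)
      (fun z => hB _)) (mollKernel_integrable.mul_const _), integral_mul_const,
      mollKernel_integral, one_mul]
    rfl
  rw [h1]
  refine abs_integral_mollKernel_mul_le (g := fun z => v (x - ε • z) - v x) (by fun_prop)
    (B := B + B) (fun z => ?_) fun z hz => ?_
  · exact (abs_sub _ _).trans (add_le_add (hB _) (hB _))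
  · refine (hL _ _).trans ?_
    gcongr
    rw [sub_sub_cancel_left, norm_neg, norm_smul, Real.norm_of_nonneg hε]
    exact mul_le_of_le_one_right hε hz.le

/-- Mollification averages translates and the jump operator commutes with translations; Fubini
applies since `v` is bounded and both measures are finite after weighting. -/
theorem jumpOp_mollify {N : ℕ} {μ : Measure (Euc N)} [IsFiniteMeasure μ] {v : Euc N → ℝ}
    (hv : Continuous v) {B : ℝ} (hB : ∀ x, |v x| ≤ B) (ε : ℝ) (x : Euc N) :
    jumpOp μ (mollify ε v) x = ∫ z, mollKernel N z * jumpOp μ v (x - ε • z) := by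
  have h1 : ∀ y, mollify ε v (x + y) - mollify ε v x
      = ∫ z, mollKernel N z * (v (x + y - ε • z) - v (x - ε • z)) := by
    intro y
    simp only [mul_sub]
    rw [integral_sub]
    · rfl
    · exact integrable_mollKernel_mul (g := fun z => v (x + y - ε • z)) (by fun_prop)
        (fun z => hB _)
    · exact integrable_mollKernel_mul (g := fun z => v (x - ε • z)) (by fun_prop)
        (fun z => hB _)
  have hint : Integrable (Function.uncurry fun (y z : Euc N) =>
      mollKernel N z * (v (x + y - ε • z) - v (x - ε • z))) (μ.prod volume) := by
    refine ((mollKernel_integrable (N := N)).comp_snd μ).mul_bdd (c := B + B) ?_ ?_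
    · exact Continuous.aestronglyMeasurable (by fun_prop)
    · exact Filter.Eventually.of_forall fun p =>
        (abs_sub _ _).trans (add_le_add (hB _) (hB _))
  unfold jumpOp
  simp only [h1]
  rw [integral_integral_swap hint]
  refine integral_congr_ae (Filter.Eventually.of_forall fun z => ?_)
  simp only
  rw [integral_const_mul]
  simp only [sub_add_eq_add_sub]

/-- Mollifying a Lipschitz subsolution produces an approximate subsolution. -/
theorem mollify_subsolution {N : ℕ} {μ : Measure (Euc N)} [IsFiniteMeasure μ] {v f c : Euc N → ℝ}
    {K B L : ℝ} (hB : ∀ x, |v x| ≤ B) (hL : ∀ x y, |v x - v y| ≤ L * ‖x - y‖) (hK : 0 ≤ K)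
    (hf : ∀ x y, |f x - f y| ≤ K * ‖x - y‖) (hc : ∀ x y, |c x - c y| ≤ K * ‖x - y‖)
    (hsub : ∀ x, f x + c x * v x - jumpOp μ v x ≤ 0) {ε : ℝ} (hε : 0 ≤ ε) (x : Euc N) :
    f x + c x * mollify ε v x - jumpOp μ (mollify ε v) x ≤ K * (1 + B) * ε := by
  have hv := continuous_of_abs_sub_le hL
  have hJc : Continuous fun z => jumpOp μ v (x - ε • z) := by
    have hcont : Continuous (jumpOp μ v) := by
      refine continuous_of_abs_sub_le (L := (L + L) * μ.real univ) fun y y' => ?_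
      unfold jumpOp
      rw [← integral_sub (integrable_increment hv hB _) (integrable_increment hv hB _)]
      have : ∀ᵐ t ∂μ, ‖v (y + t) - v y - (v (y' + t) - v y')‖ ≤ (L + L) * ‖y - y'‖ :=
        Filter.Eventually.of_forall fun t => by
          have h1 := abs_le.1 (hL (y + t) (y' + t))
          have h2 := abs_le.1 (hL y y')
          rw [add_sub_add_right_eq_sub] at h1
          rw [Real.norm_eq_abs, abs_le]
          constructor <;> linarith
      refine (norm_integral_le_of_norm_le_const this).trans_eq ?_
      ring
    fun_prop
  have hJb : ∀ z, |jumpOp μ v (x - ε • z)| ≤ (B + B) * μ.real univ := fun z => by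
    rw [← Real.norm_eq_abs]
    exact norm_integral_le_of_norm_le_const (Filter.Eventually.of_forall fun t =>
      (abs_sub _ _).trans (add_le_add (hB _) (hB _)))
  have hvb : ∀ z, |c x * v (x - ε • z)| ≤ |c x| * B := fun z => by
    rw [abs_mul]; gcongr; exact hB _
  -- With `f` and `c` frozen at `x` the expression is affine in `v`, hence an average of values at
  -- nearby points. Unfreezing costs `K (1 + B) ε`. The inequality is needed for each `α`
  -- separately, which is why only subsolutions can be averaged.
  have h1 : f x + c x * mollify ε v x - jumpOp μ (mollify ε v) x
      = ∫ z, mollKernel N z * (f x + c x * v (x - ε • z) - jumpOp μ v (x - ε • z)) := by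
    rw [jumpOp_mollify hv hB]
    simp only [mul_sub, mul_add]
    rw [integral_sub, integral_add, integral_mul_const, mollKernel_integral, one_mul, mollify,
      ← integral_const_mul]
    · simp only [mul_left_comm (c x)]
    · exact mollKernel_integrable.mul_const _
    · exact integrable_mollKernel_mul (g := fun z => c x * v (x - ε • z)) (by fun_prop) hvb
    · exact (mollKernel_integrable.mul_const _).add
        (integrable_mollKernel_mul (g := fun z => c x * v (x - ε • z)) (by fun_prop) hvb)
    · exact integrable_mollKernel_mul hJc hJb
  rw [h1]
  refine integral_mollKernel_mul_le (by fun_prop)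
    (B := |f x| + |c x| * B + (B + B) * μ.real univ) (fun z => ?_) fun z hz => ?_
  · refine (abs_sub _ _).trans (add_le_add ((abs_add_le _ _).trans ?_) (hJb z))
    exact add_le_add le_rfl (hvb z)
  · have hn : ‖x - (x - ε • z)‖ ≤ ε := by
      rw [sub_sub_cancel, norm_smul, Real.norm_of_nonneg hε]
      exact mul_le_of_le_one_right hε hz.le
    have h2 := hsub (x - ε • z)
    have h3 : f x - f (x - ε • z) ≤ K * ε :=
      (le_abs_self _).trans ((hf _ _).trans (by gcongr))
    have h4 : (c x - c (x - ε • z)) * v (x - ε • z) ≤ K * ε * B := by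
      refine (le_abs_self _).trans ?_
      rw [abs_mul]
      exact mul_le_mul ((hc _ _).trans (by gcongr)) (hB _) (abs_nonneg _) (by positivity)
    linarith

/-! ## Taylor estimates along lines -/

/-- On an interval of length one a bound passes from the derivative to the primitive unchanged.
Iterating this gives Taylor remainders without the factorials, which are not needed. -/
theorem abs_le_of_hasDerivAt_of_abs_le {F F' : ℝ → ℝ} {C : ℝ} (hF : ∀ t, HasDerivAt F (F' t) t)
    (h0 : F 0 = 0) (hC : ∀ t ∈ Icc (0 : ℝ) 1, |F' t| ≤ C) : ∀ t ∈ Icc (0 : ℝ) 1, |F t| ≤ C := by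
  intro t ht
  have hC0 : 0 ≤ C := (abs_nonneg _).trans (hC t ht)
  have := norm_image_sub_le_of_norm_deriv_le_segment' (fun x _ => (hF x).hasDerivWithinAt)
    (fun x hx => hC x ⟨hx.1, hx.2.le⟩) t ht
  rw [h0, sub_zero, sub_zero] at this
  exact this.trans (mul_le_of_le_one_right hC0 ht.2)

theorem abs_taylor_one_le {g g₁ g₂ : ℝ → ℝ} {M : ℝ} (h₀ : ∀ t, HasDerivAt g (g₁ t) t)
    (h₁ : ∀ t, HasDerivAt g₁ (g₂ t) t) (hM : ∀ t, |g₂ t| ≤ M) : |g 1 - g 0 - g₁ 0| ≤ M := by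
  have e1 := abs_le_of_hasDerivAt_of_abs_le (F := fun t => g₁ t - g₁ 0) (F' := g₂)
    (fun t => (h₁ t).sub_const _) (by simp) (fun t _ => hM t)
  have e0 := abs_le_of_hasDerivAt_of_abs_le (F := fun t => g t - g 0 - t * g₁ 0)
    (F' := fun t => g₁ t - g₁ 0)
    (fun t => by
      exact (((h₀ t).sub_const (g 0)).fun_sub ((hasDerivAt_id t).mul_const (g₁ 0))).congr_deriv
        (by simp)) (by simp) e1
  simpa using e0 1 (by simp)

/-- In `g t + g (-t)` the odd orders cancel, so after the second order term the remainder is of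
order four. The bound on the fourth derivative descends through four primitives that vanish at `0`.
-/
theorem abs_symm_taylor_three_le {g g₁ g₂ g₃ g₄ : ℝ → ℝ} {M : ℝ}
    (h₀ : ∀ t, HasDerivAt g (g₁ t) t) (h₁ : ∀ t, HasDerivAt g₁ (g₂ t) t)
    (h₂ : ∀ t, HasDerivAt g₂ (g₃ t) t) (h₃ : ∀ t, HasDerivAt g₃ (g₄ t) t)
    (hM : ∀ t, |g₄ t| ≤ M) : |g 1 + g (-1) - 2 * g 0 - g₂ 0| ≤ 2 * M := by
  have hneg : ∀ {k k' : ℝ → ℝ}, (∀ t, HasDerivAt k (k' t) t) →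
      ∀ t, HasDerivAt (fun t => k (-t)) (-(k' (-t))) t := fun hk t => by
    exact (HasDerivAt.comp t (hk (-t)) (hasDerivAt_neg t)).congr_deriv (by simp)
  have e3 := abs_le_of_hasDerivAt_of_abs_le (F := fun t => g₃ t - g₃ (-t))
    (F' := fun t => g₄ t + g₄ (-t)) (C := 2 * M)
    (fun t => ((h₃ t).fun_sub (hneg h₃ t)).congr_deriv (by simp)) (by simp)
    (fun t _ => (abs_add_le _ _).trans (by linarith [hM t, hM (-t)]))
  have e2 := abs_le_of_hasDerivAt_of_abs_le (F := fun t => g₂ t + g₂ (-t) - 2 * g₂ 0)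
    (F' := fun t => g₃ t - g₃ (-t))
    (fun t => (((h₂ t).fun_add (hneg h₂ t)).sub_const (2 * g₂ 0)).congr_deriv
      (by rw [sub_eq_add_neg]))
    (by simp; ring) e3
  have e1 := abs_le_of_hasDerivAt_of_abs_le (F := fun t => g₁ t - g₁ (-t) - t * (2 * g₂ 0))
    (F' := fun t => g₂ t + g₂ (-t) - 2 * g₂ 0)
    (fun t => by
      exact (((h₁ t).fun_sub (hneg h₁ t)).fun_sub
        ((hasDerivAt_id t).mul_const (2 * g₂ 0))).congr_deriv (by simp))
    (by simp) e2
  have e0 := abs_le_of_hasDerivAt_of_abs_le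
    (F := fun t => g t + g (-t) - 2 * g 0 - t ^ 2 * g₂ 0)
    (F' := fun t => g₁ t - g₁ (-t) - t * (2 * g₂ 0))
    (fun t => by
      refine ((((h₀ t).fun_add (hneg h₀ t)).sub_const (2 * g 0)).fun_sub
        ((hasDerivAt_pow 2 t).mul_const (g₂ 0))).congr_deriv ?_
      norm_num
      ring)
    (by simp; ring) e1
  simpa using e0 1 (by simp)

/-! ## Directional derivatives of compactly supported kernels -/

/-- The derivative of `g` in direction `y`. -/
noncomputable def dirDeriv {N : ℕ} (y : Euc N) (g : Euc N → ℝ) (z : Euc N) : ℝ := fderiv ℝ g z y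

open scoped ContDiff in
/-- Smooth kernels with support in the closed unit ball. -/
structure IsUnitKernel {N : ℕ} (g : Euc N → ℝ) : Prop where
  contDiff : ContDiff ℝ ∞ g
  support : tsupport g ⊆ Metric.closedBall 0 1

namespace IsUnitKernel

variable {N : ℕ} {g : Euc N → ℝ}

theorem hasCompactSupport (hg : IsUnitKernel g) : HasCompactSupport g :=
  (isCompact_closedBall 0 1).of_isClosed_subset (isClosed_tsupport _) hg.support

theorem dirDeriv (hg : IsUnitKernel g) (y : Euc N) : IsUnitKernel (dirDeriv y g) :=
  ⟨(hg.contDiff.fderiv_right (by simp)).clm_apply contDiff_const,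
    (tsupport_fderiv_apply_subset ℝ y).trans hg.support⟩

theorem iterate_dirDeriv_eq (hg : IsUnitKernel g) (y : Euc N) (n : ℕ) (z : Euc N) :
    (_root_.dirDeriv y)^[n] g z = iteratedFDeriv ℝ n g z fun _ => y := by
  induction n generalizing z with
  | zero => simp
  | succ n ih =>
    rw [Function.iterate_succ_apply', iteratedFDeriv_succ_apply_left]
    unfold _root_.dirDeriv
    have : (_root_.dirDeriv y)^[n] g = fun z => iteratedFDeriv ℝ n g z fun _ => y := funext ih
    unfold _root_.dirDeriv at this
    rw [this, fderiv_continuousMultilinear_apply_const]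
    · rfl
    · exact (hg.contDiff.differentiable_iteratedFDeriv (by exact_mod_cast ENat.natCast_lt_top n)) z

theorem exists_bound (hg : IsUnitKernel g) (n : ℕ) :
    ∃ C : ℝ, 0 < C ∧ ∀ y z, |(_root_.dirDeriv y)^[n] g z| ≤ C * ‖y‖ ^ n := by
  obtain ⟨C, hC⟩ := (hg.contDiff.continuous_iteratedFDeriv (m := n)
    (by exact_mod_cast le_top)).bounded_above_of_compact_support
    (hg.hasCompactSupport.iteratedFDeriv n)
  refine ⟨max C 1, by positivity, fun y z => ?_⟩
  rw [hg.iterate_dirDeriv_eq]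
  refine ((iteratedFDeriv ℝ n g z).le_opNorm _).trans ?_
  simp only [Finset.prod_const, Finset.card_univ, Fintype.card_fin]
  gcongr
  exact (hC z).trans (le_max_left _ _)

theorem hasDerivAt_line (hg : IsUnitKernel g) (x y : Euc N) (t : ℝ) :
    HasDerivAt (fun t : ℝ => g (x + t • y)) (_root_.dirDeriv y g (x + t • y)) t := by
  have h1 : HasDerivAt (fun t : ℝ => x + t • y) y t := by
    simpa using ((hasDerivAt_id t).smul_const y).const_add x
  exact ((hg.contDiff.differentiable (by simp)) (x + t • y)).hasFDerivAt.comp_hasDerivAt t h1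

theorem exists_second_order_bound (hg : IsUnitKernel g) :
    ∃ C : ℝ, 0 < C ∧ ∀ x y, |g (x + y) - g x - fderiv ℝ g x y| ≤ C * ‖y‖ ^ 2 := by
  obtain ⟨C, hC0, hC⟩ := hg.exists_bound 2
  refine ⟨C, hC0, fun x y => ?_⟩
  have := abs_taylor_one_le (hg.hasDerivAt_line x y) ((hg.dirDeriv y).hasDerivAt_line x y)
    (M := C * ‖y‖ ^ 2) (fun t => hC y (x + t • y))
  simpa [_root_.dirDeriv] using this

end IsUnitKernel

theorem isUnitKernel_mollKernel {N : ℕ} : IsUnitKernel (mollKernel N) :=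
  ⟨mollKernel_contDiff _, mollKernel_tsupport.subset⟩

theorem isUnitKernel_unitBump {N : ℕ} : IsUnitKernel (unitBump N : Euc N → ℝ) :=
  ⟨(unitBump N).contDiff, (unitBump N).tsupport_eq.subset⟩

/-! ### Convolution with compactly supported smooth kernels. -/

/-- Convolution of a kernel with a function. -/
noncomputable def kernelConv {N : ℕ} (g v : Euc N → ℝ) (x : Euc N) : ℝ :=
  ∫ z, g z * v (x - z)

theorem kernelConv_eq_convolution {N : ℕ} (g v : Euc N → ℝ) :
    kernelConv g v = convolution g v (ContinuousLinearMap.mul ℝ ℝ) volume := by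
  ext x
  simp [kernelConv, convolution]

namespace IsUnitKernel

variable {N : ℕ} {g : Euc N → ℝ}

theorem kernelConv_contDiff (hg : IsUnitKernel g) {v : Euc N → ℝ} (hv : Continuous v) :
    ContDiff ℝ 2 (kernelConv g v) := by
  rw [kernelConv_eq_convolution]
  exact hg.hasCompactSupport.contDiff_convolution_left _
    (hg.contDiff.of_le (by exact_mod_cast le_top)) hv.locallyIntegrable

theorem fderiv_kernelConv (hg : IsUnitKernel g) {v : Euc N → ℝ} (hv : Continuous v)
    (x y : Euc N) : fderiv ℝ (kernelConv g v) x y = kernelConv (_root_.dirDeriv y g) v x := by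
  have hg1 : ContDiff ℝ 1 g := hg.contDiff.of_le (by exact_mod_cast le_top)
  have h := hg.hasCompactSupport.hasFDerivAt_convolution_left (ContinuousLinearMap.mul ℝ ℝ)
    hg1 hv.locallyIntegrable (μ := volume) x
  rw [kernelConv_eq_convolution, h.fderiv]
  unfold convolution
  rw [ContinuousLinearMap.integral_apply]
  · simp [kernelConv, _root_.dirDeriv]
  · exact (hg.hasCompactSupport.fderiv ℝ).convolutionExists_left _
      (hg1.continuous_fderiv (by simp)) hv.locallyIntegrable x

theorem hasDerivAt_kernelConv_line (hg : IsUnitKernel g) {v : Euc N → ℝ} (hv : Continuous v)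
    (x y : Euc N) (t : ℝ) :
    HasDerivAt (fun t : ℝ => kernelConv g v (x + t • y))
      (kernelConv (_root_.dirDeriv y g) v (x + t • y)) t := by
  have h1 : HasDerivAt (fun t : ℝ => x + t • y) y t := by
    simpa using ((hasDerivAt_id t).smul_const y).const_add x
  rw [← hg.fderiv_kernelConv hv]
  exact (((hg.kernelConv_contDiff hv).differentiable (by simp)) _).hasFDerivAt.comp_hasDerivAt t h1

theorem integrable_mul (hg : IsUnitKernel g) {v : Euc N → ℝ} (hv : Continuous v) :
    Integrable fun z => g z * v z :=
  (hg.contDiff.continuous.mul hv).integrable_of_hasCompactSupport hg.hasCompactSupport.mul_right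

/-- Convolving with the constant `1` gives a constant function; its derivative vanishes, and it
falls on the kernel. -/
theorem integral_dirDeriv (hg : IsUnitKernel g) (y : Euc N) :
    ∫ z, _root_.dirDeriv y g z = 0 := by
  have h := hg.fderiv_kernelConv (v := fun _ => 1) continuous_const 0 y
  have hc : kernelConv g (fun _ => 1) = fun _ => ∫ z, g z := by
    ext x; simp [kernelConv]
  rw [hc] at h
  simpa [kernelConv] using h.symm

/-- Convolving a Lipschitz function with a mean zero kernel. -/
theorem abs_kernelConv_le (hg : IsUnitKernel g) (h0 : ∫ z, g z = 0) {C L : ℝ}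
    (hC : ∀ z, |g z| ≤ C) {v : Euc N → ℝ} (hL : ∀ x y, |v x - v y| ≤ L * ‖x - y‖) (hL0 : 0 ≤ L)
    (x : Euc N) :
    |kernelConv g v x| ≤ C * L * volume.real (Metric.closedBall (0 : Euc N) 1) := by
  have hC0 : 0 ≤ C := (abs_nonneg _).trans (hC 0)
  have hv := continuous_of_abs_sub_le hL
  -- Mean zero allows `v x` to be subtracted, so the bound involves the Lipschitz constant of `v`
  -- instead of its size. This saves one power of the mollification scale.
  have h1 : kernelConv g v x = ∫ z, g z * (v (x - z) - v x) := by
    simp only [mul_sub]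
    rw [integral_sub (hg.integrable_mul (by fun_prop)) (hg.integrable_mul continuous_const),
      integral_mul_const, h0, zero_mul, sub_zero]
    rfl
  rw [h1, ← setIntegral_eq_integral_of_forall_compl_eq_zero (s := Metric.closedBall (0 : Euc N) 1)]
  · rw [← Real.norm_eq_abs]
    refine norm_setIntegral_le_of_norm_le_const (measure_closedBall_lt_top) fun z hz => ?_
    rw [norm_mul]
    refine mul_le_mul (hC z) ((hL _ _).trans ?_) (norm_nonneg _) hC0
    refine mul_le_of_le_one_right hL0 ?_
    simpa using hz
  · intro z hz
    have : g z = 0 := by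
      by_contra h
      exact hz (hg.support (subset_tsupport _ h))
    rw [this, zero_mul]

end IsUnitKernel

/-! ### Quantitative smoothness of mollified Lipschitz functions. -/

/-- Quantitative smoothness: second and (symmetric) fourth order Taylor estimates. -/
structure SmoothBound {N : ℕ} (φ : Euc N → ℝ) (M₂ M₄ : ℝ) : Prop where
  contDiff : ContDiff ℝ 2 φ
  second : ∀ x y, |φ (x + y) - φ x - fderiv ℝ φ x y| ≤ M₂ * ‖y‖ ^ 2
  fourth : ∀ x, ∃ H : Euc N →L[ℝ] Euc N →L[ℝ] ℝ,
    ∀ y, |φ (x + y) + φ (x - y) - 2 * φ x - H y y| ≤ M₄ * ‖y‖ ^ 4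

theorem SmoothBound.scale {N : ℕ} {φ : Euc N → ℝ} {M₂ M₄ : ℝ} (h : SmoothBound φ M₂ M₄)
    {ε : ℝ} (hε : 0 < ε) :
    SmoothBound (fun x => ε * φ (ε⁻¹ • x)) (M₂ / ε) (M₄ / ε ^ 3) := by
  have hnorm : ∀ y : Euc N, ‖ε⁻¹ • y‖ = ‖y‖ / ε := fun y => by
    rw [norm_smul, norm_inv, Real.norm_of_nonneg hε.le]; field_simp
  refine ⟨contDiff_const.mul (h.contDiff.comp (contDiff_const_smul _)), fun x y => ?_, fun x => ?_⟩
  · have hd : fderiv ℝ (fun x => ε * φ (ε⁻¹ • x)) x y = ε * fderiv ℝ φ (ε⁻¹ • x) (ε⁻¹ • y) := by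
      have h1 : HasFDerivAt (fun x : Euc N => ε⁻¹ • x) (ε⁻¹ • ContinuousLinearMap.id ℝ (Euc N)) x :=
        (hasFDerivAt_id x).const_smul ε⁻¹
      have h2 := ((((h.contDiff.differentiable (by simp)) (ε⁻¹ • x)).hasFDerivAt).comp x
        h1).const_mul ε
      have h3 := h2.fderiv
      simp only [Function.comp_def] at h3
      rw [h3]
      simp
    rw [hd, smul_add]
    have h1 := h.second (ε⁻¹ • x) (ε⁻¹ • y)
    rw [hnorm] at h1
    calc _ = ε * |φ (ε⁻¹ • x + ε⁻¹ • y) - φ (ε⁻¹ • x) - fderiv ℝ φ (ε⁻¹ • x) (ε⁻¹ • y)| := by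
          rw [← abs_of_pos hε, ← abs_mul, abs_of_pos hε]; ring_nf
      _ ≤ ε * (M₂ * (‖y‖ / ε) ^ 2) := by gcongr
      _ = _ := by field_simp
  · obtain ⟨H, hH⟩ := h.fourth (ε⁻¹ • x)
    refine ⟨ε⁻¹ • H, fun y => ?_⟩
    have h1 := hH (ε⁻¹ • y)
    rw [hnorm] at h1
    simp only [map_smul, _root_.smul_apply, smul_eq_mul] at h1 ⊢
    rw [smul_add, smul_sub]
    calc _ = ε * |φ (ε⁻¹ • x + ε⁻¹ • y) + φ (ε⁻¹ • x - ε⁻¹ • y) - 2 * φ (ε⁻¹ • x)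
            - ε⁻¹ * (ε⁻¹ * H y y)| := by
          rw [← abs_of_pos hε, ← abs_mul, abs_of_pos hε]
          congr 1
          field_simp
      _ ≤ ε * (M₄ * (‖y‖ / ε) ^ 4) := by gcongr
      _ = _ := by field_simp

/-- All derivatives along a line are moved onto the kernel, and a differentiated kernel has mean
zero, so `L` alone controls second and fourth derivatives. The form in the fourth order estimate is
the Hessian. -/
theorem exists_smoothBound_kernelConv {N : ℕ} {g : Euc N → ℝ} (hg : IsUnitKernel g) :
    ∃ C : ℝ, 0 < C ∧ ∀ (L : ℝ) (v : Euc N → ℝ), 0 ≤ L → (∀ x y, |v x - v y| ≤ L * ‖x - y‖) →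
      SmoothBound (kernelConv g v) (C * L) (C * L) := by
  obtain ⟨C₂, hC₂, h₂⟩ := hg.exists_bound 2
  obtain ⟨C₄, hC₄, h₄⟩ := hg.exists_bound 4
  set V := volume.real (Metric.closedBall (0 : Euc N) 1)
  have hV : 0 ≤ V := measureReal_nonneg
  refine ⟨(C₂ + 2 * C₄) * (V + 1), by positivity, fun L v hL0 hL => ?_⟩
  have hv := continuous_of_abs_sub_le hL
  refine ⟨hg.kernelConv_contDiff hv, fun x y => ?_, fun x => ?_⟩
  · have hb : ∀ t : ℝ, |kernelConv (dirDeriv y (dirDeriv y g)) v (x + t • y)|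
        ≤ C₂ * ‖y‖ ^ 2 * L * V := fun t =>
      ((hg.dirDeriv y).dirDeriv y).abs_kernelConv_le ((hg.dirDeriv y).integral_dirDeriv y)
        (h₂ y) hL hL0 _
    have h := abs_taylor_one_le (hg.hasDerivAt_kernelConv_line hv x y)
      ((hg.dirDeriv y).hasDerivAt_kernelConv_line hv x y) hb
    simp only [one_smul, zero_smul, add_zero] at h
    rw [hg.fderiv_kernelConv hv]
    refine h.trans ?_
    calc C₂ * ‖y‖ ^ 2 * L * V = C₂ * V * L * ‖y‖ ^ 2 := by ring
      _ ≤ (C₂ + 2 * C₄) * (V + 1) * L * ‖y‖ ^ 2 := by gcongr <;> linarith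
  · refine ⟨fderiv ℝ (fderiv ℝ (kernelConv g v)) x, fun y => ?_⟩
    have hH : fderiv ℝ (fderiv ℝ (kernelConv g v)) x y y
        = kernelConv (dirDeriv y (dirDeriv y g)) v x := by
      rw [← (hg.dirDeriv y).fderiv_kernelConv hv]
      have : kernelConv (dirDeriv y g) v = fun x => fderiv ℝ (kernelConv g v) x y := by
        ext x; rw [hg.fderiv_kernelConv hv]
      rw [this, fderiv_clm_apply]
      · simp
      · exact ((hg.kernelConv_contDiff hv).fderiv_right (m := 1) (by norm_num)).differentiable
          (by simp) x
      · exact differentiableAt_const _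
    have hg2 := (hg.dirDeriv y).dirDeriv y
    have hg3 := hg2.dirDeriv y
    have hb : ∀ t : ℝ, |kernelConv (dirDeriv y (dirDeriv y (dirDeriv y (dirDeriv y g)))) v
        (x + t • y)| ≤ C₄ * ‖y‖ ^ 4 * L * V := fun t =>
      (hg3.dirDeriv y).abs_kernelConv_le (hg3.integral_dirDeriv y) (h₄ y) hL hL0 _
    have h := abs_symm_taylor_three_le (hg.hasDerivAt_kernelConv_line hv x y)
      ((hg.dirDeriv y).hasDerivAt_kernelConv_line hv x y)
      (hg2.hasDerivAt_kernelConv_line hv x y) (hg3.hasDerivAt_kernelConv_line hv x y) hb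
    simp only [one_smul, zero_smul, add_zero, neg_smul, ← sub_eq_add_neg] at h
    rw [hH]
    refine h.trans ?_
    calc 2 * (C₄ * ‖y‖ ^ 4 * L * V) = 2 * C₄ * V * L * ‖y‖ ^ 4 := by ring
      _ ≤ (C₂ + 2 * C₄) * (V + 1) * L * ‖y‖ ^ 4 := by gcongr <;> linarith

/-- Reduction to unit scale: the rescaling `ε⁻¹ v(ε ·)` keeps the Lipschitz constant, and undoing it
produces the powers of `ε`. -/
theorem mollify_eq_scale {N : ℕ} {ε : ℝ} (hε : 0 < ε) (v : Euc N → ℝ) :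
    mollify ε v
      = fun x => ε * kernelConv (mollKernel N) (fun y => ε⁻¹ * v (ε • y)) (ε⁻¹ • x) := by
  ext x
  unfold mollify kernelConv
  rw [← integral_const_mul]
  refine integral_congr_ae (Filter.Eventually.of_forall fun z => ?_)
  simp only
  rw [smul_sub, smul_smul, mul_inv_cancel₀ hε.ne', one_smul]
  field_simp

/-- Derivative bounds of mollified Lipschitz functions. -/
theorem exists_smoothBound_mollify (N : ℕ) :
    ∃ C : ℝ, 0 < C ∧ ∀ (L : ℝ) (v : Euc N → ℝ), 0 ≤ L → (∀ x y, |v x - v y| ≤ L * ‖x - y‖) →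
      ∀ ε : ℝ, 0 < ε → SmoothBound (mollify ε v) (C * L / ε) (C * L / ε ^ 3) := by
  obtain ⟨C, hC, h⟩ := exists_smoothBound_kernelConv (isUnitKernel_mollKernel (N := N))
  refine ⟨C, hC, fun L v hL0 hL ε hε => ?_⟩
  rw [mollify_eq_scale hε]
  refine (h L _ hL0 fun x y => ?_).scale hε
  rw [← mul_sub, abs_mul, abs_of_pos (inv_pos.2 hε)]
  calc ε⁻¹ * |v (ε • x) - v (ε • y)| ≤ ε⁻¹ * (L * ‖ε • x - ε • y‖) := by gcongr; exact hL _ _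
    _ = L * ‖x - y‖ := by
      rw [← smul_sub, norm_smul, Real.norm_of_nonneg hε.le]; field_simp

/-! ## Moments of measures with a singular radial density bound -/

/-- Polar coordinates. A general set `I` of radii covers both the balls of the moment bounds and the
shells of the tail bound. -/
theorem lintegral_radial_rpow {N : ℕ} (hN : 1 ≤ N) {I : Set ℝ} (hI : MeasurableSet I) {s : ℝ}
    (hint : IntegrableOn (fun y : ℝ => y ^ (s + N - 1)) (I ∩ Ioi 0)) :
    ∫⁻ z in {z : Euc N | ‖z‖ ∈ I}, ENNReal.ofReal (‖z‖ ^ s)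
      = ENNReal.ofReal (N * volume.real (Metric.ball (0 : Euc N) 1)
          * ∫ y in I ∩ Ioi 0, y ^ (s + N - 1)) := by
  have : Nonempty (Fin N) := ⟨⟨0, hN⟩⟩
  have hmeas : MeasurableSet {z : Euc N | ‖z‖ ∈ I} := measurable_norm hI
  set f : ℝ → ℝ := I.indicator fun y => y ^ s with hf
  have hcongr : ∀ y ∈ Ioi (0 : ℝ), y ^ (N - 1) • f y = I.indicator (fun y => y ^ (s + N - 1)) y := by
    intro y hy
    by_cases hyI : y ∈ I
    · simp only [hf, indicator_of_mem hyI, smul_eq_mul]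
      rw [← Real.rpow_natCast, ← Real.rpow_add hy, Nat.cast_sub hN]
      congr 1
      push_cast
      ring
    · simp [hf, hyI]
  have hind : ∀ z : Euc N, f ‖z‖ = {z : Euc N | ‖z‖ ∈ I}.indicator (fun z => ‖z‖ ^ s) z := by
    intro z
    by_cases h : ‖z‖ ∈ I <;> simp [hf, h]
  have hi : Integrable (fun z : Euc N => f ‖z‖) := by
    rw [integrable_fun_norm_addHaar, finrank_euclideanSpace_fin,
      integrableOn_congr_fun hcongr measurableSet_Ioi, IntegrableOn, integrable_indicator_iff hI,
      IntegrableOn, Measure.restrict_restrict hI]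
    exact hint
  have hval : ∫ z : Euc N, f ‖z‖ = N * volume.real (Metric.ball (0 : Euc N) 1)
      * ∫ y in I ∩ Ioi 0, y ^ (s + N - 1) := by
    rw [integral_fun_norm_addHaar, finrank_euclideanSpace_fin,
      setIntegral_congr_fun measurableSet_Ioi hcongr, integral_indicator hI,
      Measure.restrict_restrict hI, nsmul_eq_mul, smul_eq_mul, mul_assoc]
  rw [← hval, ofReal_integral_eq_lintegral_ofReal hi (Filter.Eventually.of_forall fun z => by
    simp only [hind]; exact indicator_nonneg (fun z _ => by positivity) z), ← lintegral_indicator hmeas]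
  refine lintegral_congr fun z => ?_
  rw [hind]
  by_cases h : ‖z‖ ∈ I <;> simp [h]

theorem lintegral_norm_rpow_le_of_density {N : ℕ} (hN : 1 ≤ N) {ν : Measure (Euc N)} {σ C : ℝ}
    (hC : 0 < C) {g : Euc N → ENNReal} (hg : Measurable g)
    (hν : ν.restrict {z : Euc N | ‖z‖ < 1}
      = ((volume : Measure (Euc N)).restrict {z : Euc N | ‖z‖ < 1}).withDensity g)
    (hgC : ∀ z : Euc N, 0 < ‖z‖ → ‖z‖ < 1 → g z ≤ ENNReal.ofReal (C / ‖z‖ ^ ((N : ℝ) + σ)))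
    {I : Set ℝ} (hI : MeasurableSet I) (hI1 : ∀ y ∈ I, y < 1) {p : ℝ}
    (hint : IntegrableOn (fun y : ℝ => y ^ (p - σ - 1)) (I ∩ Ioi 0)) :
    ∫⁻ z in {z : Euc N | ‖z‖ ∈ I}, ENNReal.ofReal (‖z‖ ^ p) ∂ν
      ≤ ENNReal.ofReal (C * N * volume.real (Metric.ball (0 : Euc N) 1)
          * ∫ y in I ∩ Ioi 0, y ^ (p - σ - 1)) := by
  have : Nonempty (Fin N) := ⟨⟨0, hN⟩⟩
  have hmeas : MeasurableSet {z : Euc N | ‖z‖ ∈ I} := measurable_norm hI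
  have hsub : {z : Euc N | ‖z‖ ∈ I} ⊆ {z : Euc N | ‖z‖ < 1} := fun z hz => hI1 _ hz
  have hF : Measurable fun z : Euc N => ENNReal.ofReal (‖z‖ ^ p) := by fun_prop
  have hexp : p - (N + σ) + N - 1 = p - σ - 1 := by ring
  have h2 := lintegral_radial_rpow hN hI (s := p - (N + σ)) (by rw [hexp]; exact hint)
  rw [hexp] at h2
  rw [← inter_eq_self_of_subset_left hsub, ← Measure.restrict_restrict hmeas, hν,
    restrict_withDensity hmeas, Measure.restrict_restrict hmeas,
    inter_eq_self_of_subset_left hsub, lintegral_withDensity_eq_lintegral_mul _ hg hF]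
  calc ∫⁻ z in {z : Euc N | ‖z‖ ∈ I}, (g * fun z : Euc N => ENNReal.ofReal (‖z‖ ^ p)) z
      ≤ ∫⁻ z in {z : Euc N | ‖z‖ ∈ I},
          ENNReal.ofReal C * ENNReal.ofReal (‖z‖ ^ (p - (N + σ))) := by
        refine lintegral_mono_ae ?_
        -- The density bound is only assumed off the origin, which is Lebesgue null.
        have h0 : ∀ᵐ z : Euc N, z ≠ 0 := by
          simp [ae_iff, measure_singleton]
        filter_upwards [ae_restrict_mem hmeas, ae_restrict_of_ae h0] with z hz hz0
        have hpos : 0 < ‖z‖ := norm_pos_iff.2 hz0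
        simp only [Pi.mul_apply]
        calc _ ≤ ENNReal.ofReal (C / ‖z‖ ^ ((N : ℝ) + σ)) * ENNReal.ofReal (‖z‖ ^ p) := by
              gcongr; exact hgC z hpos (hsub hz)
          _ = _ := by
            rw [← ENNReal.ofReal_mul (by positivity), ← ENNReal.ofReal_mul hC.le,
              Real.rpow_sub hpos]
            congr 1
            ring
    _ = _ := by
      rw [lintegral_const_mul _ (by fun_prop), h2, ← ENNReal.ofReal_mul hC.le]
      congr 1
      simp only [mul_assoc]

/-- The structural properties of the pair (Lévy measure, jump function) used below. -/
structure LevyPair {N : ℕ} (ν : Measure (Euc N)) (η : Euc N → Euc N) (σ K : ℝ) : Prop where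
  one_le : 1 ≤ K
  cont : Continuous η
  bdd : ∀ z, ‖η z‖ ≤ K
  lin : ∀ z, ‖z‖ < 1 → ‖η z‖ ≤ K * ‖z‖
  odd : ∀ z, ‖z‖ < 1 → η (-z) = -η z
  symm : Measure.map (fun z : Euc N => -z) (ν.restrict {z : Euc N | ‖z‖ < 1})
    = ν.restrict {z : Euc N | ‖z‖ < 1}
  moment_two : ∀ r, 0 < r → r ≤ 1 → ∫⁻ z in {z : Euc N | ‖z‖ < r}, ENNReal.ofReal (‖z‖ ^ 2) ∂ν
    ≤ ENNReal.ofReal (K * r ^ (2 - σ))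
  moment_four : ∀ r, 0 < r → r ≤ 1 → ∫⁻ z in {z : Euc N | ‖z‖ < r}, ENNReal.ofReal (‖z‖ ^ 4) ∂ν
    ≤ ENNReal.ofReal (K * r ^ (4 - σ))
  tail : ∀ r, 0 < r → r ≤ 1 → ν {z : Euc N | r ≤ ‖z‖} ≤ ENNReal.ofReal (K * r ^ (-σ))
  sphere : ∀ r, 0 < r → r < 1 → ν {z : Euc N | ‖z‖ = r} = 0

theorem integrableOn_rpow_small {q r : ℝ} (hq : 0 < q) :
    IntegrableOn (fun y : ℝ => y ^ (q - 1)) (Iio r ∩ Ioi 0) := by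
  rw [Iio_inter_Ioi]
  have := (intervalIntegral.intervalIntegrable_rpow' (a := 0) (b := r)
    (show -1 < q - 1 by linarith)).1
  exact this.mono_set Ioo_subset_Ioc_self

theorem integral_rpow_small {q r : ℝ} (hq : 0 < q) (hr : 0 < r) :
    ∫ y in Iio r ∩ Ioi 0, y ^ (q - 1) = r ^ q / q := by
  rw [Iio_inter_Ioi, ← integral_Ioc_eq_integral_Ioo,
    ← intervalIntegral.integral_of_le hr.le, integral_rpow (Or.inl (by linarith))]
  simp [Real.zero_rpow hq.ne']

/-- Integrating the density bound gives all moments: `σ < 2` makes the second and fourth moments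
finite near the origin, and `σ > 0` gives the tail power. Outside the unit ball only (A4) is
available. -/
theorem exists_levyPair {N : ℕ} (hN : 1 ≤ N) {A : Type*} [TopologicalSpace A]
    (P : HJBData N A) {σ : ℝ} (hσ0 : 0 < σ) (hσ2 : σ < 2)
    (h1 : P.A1) (h2 : P.A2) (h3 : P.A3) (h4 : P.A4) (h5 : P.A5) (h6 : P.A6 σ) (h7 : P.A7) :
    ∃ K : ℝ, ∀ α, LevyPair (P.ν α) (P.η α) σ K := by
  obtain ⟨K₂, hK₂, h2⟩ := h2
  obtain ⟨K₃, hK₃, h3⟩ := h3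
  obtain ⟨K₄, hK₄, h4⟩ := h4
  obtain ⟨C, hC, h6⟩ := h6
  set W : ℝ := C * N * volume.real (Metric.ball (0 : Euc N) 1)
  have hW : 0 ≤ W := by positivity
  have hσ4 : 0 < 4 - σ := by linarith
  have hσ2' : 0 < 2 - σ := by linarith
  set K : ℝ := 1 + K₂ + K₃ + K₄ + W / (2 - σ) + W / (4 - σ) + W / σ with hK
  have p2 : 0 ≤ W / (2 - σ) := by positivity
  have p4 : 0 ≤ W / (4 - σ) := by positivity
  have p0 : 0 ≤ W / σ := by positivity
  refine ⟨K, fun α => ?_⟩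
  obtain ⟨g, hg, hν, hgC⟩ := h6 α
  have hmom : ∀ {q : ℝ} (hq : 0 < q) (r : ℝ), 0 < r → r ≤ 1 →
      ∫⁻ z in {z : Euc N | ‖z‖ < r}, ENNReal.ofReal (‖z‖ ^ (q + σ)) ∂(P.ν α)
        ≤ ENNReal.ofReal (W / q * r ^ q) := by
    intro q hq r hr hr1
    have hexp : q + σ - σ - 1 = q - 1 := by ring
    have := lintegral_norm_rpow_le_of_density hN hC hg hν hgC (I := Iio r) measurableSet_Iio
      (fun y hy => lt_of_lt_of_le hy hr1) (p := q + σ)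
      (by rw [hexp]; exact integrableOn_rpow_small hq)
    rw [hexp, integral_rpow_small hq hr] at this
    refine this.trans_eq ?_
    congr 1
    ring
  refine ⟨by linarith, h1.2.2.2.2.2.1 α, fun z => ((h2 α).2.2.2.2 z).trans (by linarith),
    fun z hz => (h3 α z hz).trans (by gcongr; linarith), h7 α, h5 α, fun r hr hr1 => ?_,
    fun r hr hr1 => ?_, fun r hr hr1 => ?_, fun r hr hr1 => ?_⟩
  · have h := hmom hσ2' r hr hr1
    simp only [sub_add_cancel, Real.rpow_two] at h
    refine h.trans (ENNReal.ofReal_le_ofReal ?_)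
    gcongr
    linarith
  · have h := hmom hσ4 r hr hr1
    have e4 : ∀ z : Euc N, ‖z‖ ^ (4 : ℝ) = ‖z‖ ^ 4 := fun z => by
      exact_mod_cast Real.rpow_natCast ‖z‖ 4
    simp only [sub_add_cancel, e4] at h
    refine h.trans (ENNReal.ofReal_le_ofReal ?_)
    gcongr
    linarith
  · have hsplit : {z : Euc N | r ≤ ‖z‖} ⊆ {z : Euc N | ‖z‖ ∈ Ico r 1} ∪ {z : Euc N | 1 ≤ ‖z‖} := by
      intro z hz
      by_cases hz1 : ‖z‖ < 1
      · exact Or.inl ⟨hz, hz1⟩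
      · exact Or.inr (not_lt.1 hz1)
    have hset : Ico r 1 ∩ Ioi 0 = Ico r 1 :=
      inter_eq_self_of_subset_left fun y hy => lt_of_lt_of_le hr hy.1
    have hIoi : IntegrableOn (fun y : ℝ => y ^ (0 - σ - 1)) (Ioi r) :=
      integrableOn_Ioi_rpow_of_lt (by linarith) hr
    have hIci : IntegrableOn (fun y : ℝ => y ^ (0 - σ - 1)) (Ici r) :=
      integrableOn_Ici_iff_integrableOn_Ioi (by simp) |>.2 hIoi
    have hin := lintegral_norm_rpow_le_of_density hN hC hg hν hgC (I := Ico r 1)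
      measurableSet_Ico (fun y hy => hy.2) (p := 0)
      (by rw [hset]; exact hIci.mono_set Ico_subset_Ici_self)
    simp only [Real.rpow_zero, ENNReal.ofReal_one, lintegral_one, Measure.restrict_apply_univ]
      at hin
    have hle : ∫ y in Ico r 1 ∩ Ioi 0, y ^ (0 - σ - 1) ≤ r ^ (-σ) / σ := by
      rw [hset]
      calc ∫ y in Ico r 1, y ^ (0 - σ - 1) ≤ ∫ y in Ici r, y ^ (0 - σ - 1) := by
            refine setIntegral_mono_set hIci ?_ (Filter.Eventually.of_forall Ico_subset_Ici_self)
            filter_upwards [ae_restrict_mem measurableSet_Ici] with y hy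
            exact Real.rpow_nonneg (hr.le.trans hy) _
        _ = r ^ (-σ) / σ := by
          rw [integral_Ici_eq_integral_Ioi, integral_Ioi_rpow_of_lt (by linarith) hr,
            show 0 - σ - 1 + 1 = -σ by ring, neg_div_neg_eq]
    -- The unit sphere is covered neither by the density bound nor by the tail term of (A4). Since
    -- `‖z‖ ^ 2 = 1` there, the first integral in (A4) controls its mass.
    have hout : P.ν α {z : Euc N | 1 ≤ ‖z‖} ≤ ENNReal.ofReal K₄ := by
      refine le_trans ?_ (h4 α)
      have hs : {z : Euc N | 1 ≤ ‖z‖} ⊆ {z : Euc N | ‖z‖ = 1} ∪ {z : Euc N | 1 < ‖z‖} := by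
        intro z hz
        rcases (show 1 ≤ ‖z‖ from hz).eq_or_lt with h | h
        · exact Or.inl h.symm
        · exact Or.inr h
      refine (measure_mono hs).trans ((measure_union_le _ _).trans (add_le_add ?_ le_rfl))
      have hm1 : MeasurableSet {z : Euc N | ‖z‖ = 1} :=
        measurable_norm (measurableSet_singleton (1 : ℝ))
      calc P.ν α {z : Euc N | ‖z‖ = 1}
          = ∫⁻ z in {z : Euc N | ‖z‖ = 1}, ENNReal.ofReal (‖z‖ ^ 2) ∂(P.ν α) := by
            rw [setLIntegral_congr_fun (g := fun _ => 1) hm1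
              (fun z hz => by simp [show ‖z‖ = 1 from hz])]
            simp
        _ ≤ _ := lintegral_mono_set fun z hz => (show ‖z‖ = 1 from hz).le
    have hr1' : 1 ≤ r ^ (-σ) := Real.one_le_rpow_of_pos_of_le_one_of_nonpos hr hr1 (by linarith)
    refine (measure_mono hsplit).trans ((measure_union_le _ _).trans ?_)
    refine (add_le_add hin hout).trans ?_
    have hnn : 0 ≤ ∫ y in Ico r 1 ∩ Ioi 0, y ^ (0 - σ - 1) := by
      rw [hset]
      exact setIntegral_nonneg measurableSet_Ico fun y hy => Real.rpow_nonneg (hr.le.trans hy.1) _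
    rw [← ENNReal.ofReal_add (mul_nonneg hW hnn) hK₄.le]
    refine ENNReal.ofReal_le_ofReal ?_
    calc W * (∫ y in Ico r 1 ∩ Ioi 0, y ^ (0 - σ - 1)) + K₄
        ≤ W * (r ^ (-σ) / σ) + K₄ * r ^ (-σ) := by
          gcongr
          exact le_mul_of_one_le_right hK₄.le hr1'
      _ = (W / σ + K₄) * r ^ (-σ) := by ring
      _ ≤ K * r ^ (-σ) := by gcongr; linarith
  · have hm : MeasurableSet {z : Euc N | ‖z‖ = r} :=
      measurable_norm (measurableSet_singleton r)
    have hsub : {z : Euc N | ‖z‖ = r} ⊆ {z : Euc N | ‖z‖ < 1} :=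
      fun z hz => (show ‖z‖ = r from hz).trans_lt hr1
    have hvol : volume {z : Euc N | ‖z‖ = r} = 0 := by
      have := Measure.addHaar_sphere_of_ne_zero (volume : Measure (Euc N)) 0 hr.ne'
      convert this using 2
      ext z; simp
    have e : P.ν α {z : Euc N | ‖z‖ = r} = (P.ν α).restrict {z : Euc N | ‖z‖ < 1}
        {z : Euc N | ‖z‖ = r} := by
      rw [Measure.restrict_apply hm, inter_eq_self_of_subset_left hsub]
    rw [e, hν]
    refine withDensity_absolutelyContinuous _ _ ?_
    rw [Measure.restrict_apply hm, inter_eq_self_of_subset_left hsub, hvol]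

/-! ## Splitting of the Lévy operator -/

theorem measurableSet_norm_lt {N : ℕ} (r : ℝ) : MeasurableSet {z : Euc N | ‖z‖ < r} :=
  measurable_norm measurableSet_Iio

theorem measurableSet_le_norm {N : ℕ} (r : ℝ) : MeasurableSet {z : Euc N | r ≤ ‖z‖} :=
  measurable_norm measurableSet_Ici

/-- The pushforward under `η` of the jumps of size at least `r`. -/
noncomputable def largeJumps {N : ℕ} (ν : Measure (Euc N)) (η : Euc N → Euc N) (r : ℝ) :
    Measure (Euc N) :=
  (ν.restrict {z : Euc N | r ≤ ‖z‖}).map η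

/-- The compensated contribution of the jumps of size less than `r`. -/
noncomputable def smallJumpOp {N : ℕ} (ν : Measure (Euc N)) (η : Euc N → Euc N) (r : ℝ)
    (φ : Euc N → ℝ) (x : Euc N) : ℝ :=
  ∫ z in {z : Euc N | ‖z‖ < r}, (φ (x + η z) - φ x - fderiv ℝ φ x (η z)) ∂ν

theorem integrableOn_of_moment {N : ℕ} {ν : Measure (Euc N)} {p : ℕ} {r m C : ℝ} (hm0 : 0 ≤ m)
    (hC : 0 ≤ C)
    (hm : ∫⁻ z in {z : Euc N | ‖z‖ < r}, ENNReal.ofReal (‖z‖ ^ p) ∂ν ≤ ENNReal.ofReal m)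
    {G : Euc N → ℝ} (hG : Continuous G) (hGb : ∀ z, ‖z‖ < r → |G z| ≤ C * ‖z‖ ^ p) :
    IntegrableOn G {z : Euc N | ‖z‖ < r} ν ∧
      |∫ z in {z : Euc N | ‖z‖ < r}, G z ∂ν| ≤ C * m := by
  have hbound : ∫⁻ z in {z : Euc N | ‖z‖ < r}, ENNReal.ofReal ‖G z‖ ∂ν
      ≤ ENNReal.ofReal (C * m) := by
    calc _ ≤ ∫⁻ z in {z : Euc N | ‖z‖ < r}, ENNReal.ofReal C * ENNReal.ofReal (‖z‖ ^ p) ∂ν := by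
          refine setLIntegral_mono' (measurableSet_norm_lt r) fun z hz => ?_
          rw [← ENNReal.ofReal_mul hC]
          exact ENNReal.ofReal_le_ofReal (hGb z hz)
      _ ≤ _ := by
          rw [lintegral_const_mul _ (by fun_prop), ENNReal.ofReal_mul hC]
          gcongr
  refine ⟨⟨hG.aestronglyMeasurable, ?_⟩, ?_⟩
  · rw [hasFiniteIntegral_iff_norm]
    exact hbound.trans_lt ENNReal.ofReal_lt_top
  · rw [← Real.norm_eq_abs]
    refine (norm_integral_le_lintegral_norm _).trans ?_
    exact ENNReal.toReal_le_of_le_ofReal (by positivity) hbound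

namespace LevyPair

variable {N : ℕ} {ν : Measure (Euc N)} {η : Euc N → Euc N} {σ K : ℝ}

theorem K_pos (h : LevyPair ν η σ K) : 0 < K := zero_lt_one.trans_le h.one_le

theorem isFiniteMeasure_restrict (h : LevyPair ν η σ K) {r : ℝ} (hr : 0 < r) (hr1 : r ≤ 1) :
    IsFiniteMeasure (ν.restrict {z : Euc N | r ≤ ‖z‖}) :=
  ⟨by
    rw [Measure.restrict_apply_univ]
    exact (h.tail r hr hr1).trans_lt ENNReal.ofReal_lt_top⟩

theorem real_tail_le (h : LevyPair ν η σ K) {r : ℝ} (hr : 0 < r) (hr1 : r ≤ 1) :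
    ν.real {z : Euc N | r ≤ ‖z‖} ≤ K * r ^ (-σ) :=
  ENNReal.toReal_le_of_le_ofReal (mul_nonneg h.K_pos.le (by positivity)) (h.tail r hr hr1)

theorem isFiniteMeasure_largeJumps (h : LevyPair ν η σ K) {r : ℝ} (hr : 0 < r) (hr1 : r ≤ 1) :
    IsFiniteMeasure (largeJumps ν η r) := by
  have := h.isFiniteMeasure_restrict hr hr1
  unfold largeJumps
  infer_instance

theorem largeJumps_real_le (h : LevyPair ν η σ K) {r : ℝ} (hr : 0 < r) (hr1 : r ≤ 1) :
    (largeJumps ν η r).real univ ≤ K * r ^ (-σ) := by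
  have : (largeJumps ν η r).real univ = ν.real {z : Euc N | r ≤ ‖z‖} := by
    simp [largeJumps, Measure.real, Measure.map_apply h.cont.measurable MeasurableSet.univ]
  rw [this]
  exact h.real_tail_le hr hr1

theorem jumpOp_largeJumps (h : LevyPair ν η σ K) (r : ℝ) {w : Euc N → ℝ} (hw : Continuous w)
    (x : Euc N) :
    jumpOp (largeJumps ν η r) w x = ∫ z in {z : Euc N | r ≤ ‖z‖}, (w (x + η z) - w x) ∂ν := by
  unfold jumpOp largeJumps
  rw [integral_map h.cont.measurable.aemeasurable]
  exact Continuous.aestronglyMeasurable (by fun_prop)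

theorem integral_reflect (h : LevyPair ν η σ K) {S : Set (Euc N)} (hS : MeasurableSet S)
    (hS1 : S ⊆ {z : Euc N | ‖z‖ < 1}) (hneg : ∀ z, -z ∈ S ↔ z ∈ S) (G : Euc N → ℝ) :
    ∫ z in S, G (-z) ∂ν = ∫ z in S, G z ∂ν := by
  have e : ∀ F : Euc N → ℝ, ∫ z in S, F z ∂ν
      = ∫ z, S.indicator F z ∂(ν.restrict {z : Euc N | ‖z‖ < 1}) := fun F => by
    rw [integral_indicator hS, Measure.restrict_restrict hS, inter_eq_self_of_subset_left hS1]
  rw [e, e]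
  conv_rhs => rw [← h.symm]
  rw [show (fun z : Euc N => -z) = MeasurableEquiv.neg (Euc N) from rfl, integral_map_equiv]
  refine integral_congr_ae (Filter.Eventually.of_forall fun z => ?_)
  change _ = S.indicator G (-z)
  by_cases hz : z ∈ S
  · simp [hz, hneg]
  · simp [hz, hneg]

/-- The integrand is odd and the measure symmetric, so the integral equals its own negative; no
integrability is required. -/
theorem integral_odd (h : LevyPair ν η σ K) {S : Set (Euc N)} (hS : MeasurableSet S)
    (hS1 : S ⊆ {z : Euc N | ‖z‖ < 1}) (hneg : ∀ z, -z ∈ S ↔ z ∈ S) (ℓ : Euc N →L[ℝ] ℝ) :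
    ∫ z in S, ℓ (η z) ∂ν = 0 := by
  have h1 := h.integral_reflect hS hS1 hneg fun z => ℓ (η z)
  have h2 : ∫ z in S, ℓ (η (-z)) ∂ν = -∫ z in S, ℓ (η z) ∂ν := by
    rw [← integral_neg]
    refine setIntegral_congr_fun hS fun z hz => ?_
    simp only [h.odd z (hS1 hz), map_neg]
  linarith

theorem integrableOn_increment (h : LevyPair ν η σ K) {r : ℝ} (hr : 0 < r) (hr1 : r ≤ 1)
    {w : Euc N → ℝ} (hw : Continuous w) {B : ℝ} (hB : ∀ x, |w x| ≤ B) (x : Euc N) :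
    IntegrableOn (fun z => w (x + η z) - w x) {z : Euc N | r ≤ ‖z‖} ν := by
  have := h.isFiniteMeasure_restrict hr hr1
  have hη := h.cont
  exact integrable_of_abs_le (Continuous.aestronglyMeasurable (by fun_prop)) (B := B + B)
    fun z => (abs_sub _ _).trans (add_le_add (hB _) (hB _))

theorem integrableOn_linear (h : LevyPair ν η σ K) {r : ℝ} (hr : 0 < r) (hr1 : r ≤ 1)
    (ℓ : Euc N →L[ℝ] ℝ) : IntegrableOn (fun z => ℓ (η z)) {z : Euc N | r ≤ ‖z‖} ν := by
  have := h.isFiniteMeasure_restrict hr hr1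
  have hη := h.cont
  exact integrable_of_abs_le (Continuous.aestronglyMeasurable (by fun_prop)) (B := ‖ℓ‖ * K)
    fun z => (ℓ.le_opNorm _).trans (by gcongr; exact h.bdd z)

theorem smallJump_estimate (h : LevyPair ν η σ K) {r : ℝ} (hr : 0 < r) (hr1 : r ≤ 1)
    {φ : Euc N → ℝ} (hφ : Continuous φ) {M : ℝ} (hM : 0 ≤ M) (x : Euc N)
    (h2 : ∀ y, |φ (x + y) - φ x - fderiv ℝ φ x y| ≤ M * ‖y‖ ^ 2) :
    IntegrableOn (fun z => φ (x + η z) - φ x - fderiv ℝ φ x (η z)) {z : Euc N | ‖z‖ < r} ν ∧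
      |smallJumpOp ν η r φ x| ≤ M * K ^ 3 * r ^ (2 - σ) := by
  have hη := h.cont
  have hK := h.K_pos
  have := integrableOn_of_moment (p := 2) (C := M * K ^ 2) (G := fun z =>
    φ (x + η z) - φ x - fderiv ℝ φ x (η z)) (by positivity) (by positivity)
    (h.moment_two r hr hr1) (by fun_prop) fun z hz => ?_
  · refine ⟨this.1, this.2.trans_eq ?_⟩
    ring
  · refine (h2 _).trans ?_
    calc M * ‖η z‖ ^ 2 ≤ M * (K * ‖z‖) ^ 2 := by gcongr; exact h.lin z (hz.trans_le hr1)
      _ = _ := by ring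

/-- The compensator does not contribute away from the origin. -/
theorem smallJumpOp_add_jumpOp (h : LevyPair ν η σ K) {r s : ℝ} (hr : 0 < r) (hrs : r ≤ s)
    (hs1 : s ≤ 1) {φ : Euc N → ℝ} (hφ : Continuous φ) {B : ℝ} (hB : ∀ x, |φ x| ≤ B) {M : ℝ}
    (hM : 0 ≤ M) (x : Euc N) (h2 : ∀ y, |φ (x + y) - φ x - fderiv ℝ φ x y| ≤ M * ‖y‖ ^ 2) :
    smallJumpOp ν η s φ x + jumpOp (largeJumps ν η s) φ x
      = smallJumpOp ν η r φ x + jumpOp (largeJumps ν η r) φ x := by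
  set S : Set (Euc N) := {z | r ≤ ‖z‖} ∩ {z | ‖z‖ < s} with hS
  have hSm : MeasurableSet S := (measurableSet_le_norm r).inter (measurableSet_norm_lt s)
  have hS1 : S ⊆ {z : Euc N | ‖z‖ < 1} := fun z hz => lt_of_lt_of_le hz.2 hs1
  have hu1 : {z : Euc N | ‖z‖ < s} = {z : Euc N | ‖z‖ < r} ∪ S := by
    ext z
    simp only [hS, mem_union, mem_inter_iff, mem_ofPred_eq]
    constructor
    · intro hz
      by_cases h' : ‖z‖ < r
      · exact Or.inl h'
      · exact Or.inr ⟨not_lt.1 h', hz⟩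
    · rintro (hz | hz)
      · exact hz.trans_le hrs
      · exact hz.2
  have hu2 : {z : Euc N | r ≤ ‖z‖} = S ∪ {z : Euc N | s ≤ ‖z‖} := by
    ext z
    simp only [hS, mem_union, mem_inter_iff, mem_ofPred_eq]
    constructor
    · intro hz
      by_cases h' : ‖z‖ < s
      · exact Or.inl ⟨hz, h'⟩
      · exact Or.inr (not_lt.1 h')
    · rintro (hz | hz)
      · exact hz.1
      · exact hrs.trans hz
  have hd1 : Disjoint {z : Euc N | ‖z‖ < r} S :=
    disjoint_left.2 fun z (hz : ‖z‖ < r) hz' => not_lt.2 hz'.1 hz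
  have hd2 : Disjoint S {z : Euc N | s ≤ ‖z‖} :=
    disjoint_left.2 fun z hz (hz' : s ≤ ‖z‖) => not_lt.2 hz' hz.2
  have hi := (h.smallJump_estimate (hr.trans_le hrs) hs1 hφ hM x h2).1
  have hj := h.integrableOn_increment hr (hrs.trans hs1) hφ hB x
  have hsplit1 : smallJumpOp ν η s φ x = smallJumpOp ν η r φ x
      + ∫ z in S, (φ (x + η z) - φ x - fderiv ℝ φ x (η z)) ∂ν := by
    unfold smallJumpOp
    rw [hu1] at hi ⊢
    exact setIntegral_union hd1 hSm (hi.mono_set subset_union_left) (hi.mono_set subset_union_right)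
  rw [hsplit1, h.jumpOp_largeJumps _ hφ, h.jumpOp_largeJumps _ hφ]
  rw [hu2] at hj
  rw [hu2, setIntegral_union hd2 (measurableSet_le_norm s) (hj.mono_set subset_union_left)
    (hj.mono_set subset_union_right), integral_sub (hj.mono_set subset_union_left)
    ((h.integrableOn_linear hr (hrs.trans hs1) (fderiv ℝ φ x)).mono_set inter_subset_left),
    h.integral_odd hSm hS1 (fun z => by simp [hS])]
  ring

/-- Averaging the integrand with its reflection cancels the gradient and leaves second differences.
These agree with the Hessian form to fourth order, whereas the unsymmetrised integrand would only
give third order. -/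
theorem smallJumpOp_eq_symm (h : LevyPair ν η σ K) {r : ℝ} (hr : 0 < r) (hr1 : r ≤ 1)
    {φ : Euc N → ℝ} (hφ : Continuous φ) {M : ℝ} (hM : 0 ≤ M) (x : Euc N)
    (h2 : ∀ y, |φ (x + y) - φ x - fderiv ℝ φ x y| ≤ M * ‖y‖ ^ 2) :
    smallJumpOp ν η r φ x
      = 1 / 2 * ∫ z in {z : Euc N | ‖z‖ < r}, (φ (x + η z) + φ (x - η z) - 2 * φ x) ∂ν := by
  have hS1 : {z : Euc N | ‖z‖ < r} ⊆ {z : Euc N | ‖z‖ < 1} := fun z hz => lt_of_lt_of_le hz hr1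
  have hη := h.cont
  have hK := h.K_pos
  have hi := (h.smallJump_estimate hr hr1 hφ hM x h2).1
  have hi' : IntegrableOn (fun z => φ (x - η z) - φ x + fderiv ℝ φ x (η z))
      {z : Euc N | ‖z‖ < r} ν :=
    (integrableOn_of_moment (p := 2) (C := M * K ^ 2) (m := K * r ^ (2 - σ)) (by positivity)
      (by positivity) (h.moment_two r hr hr1) (by fun_prop) fun z hz => by
        have := h2 (-η z)
        rw [map_neg, sub_neg_eq_add, norm_neg, ← sub_eq_add_neg] at this
        refine this.trans ?_
        calc M * ‖η z‖ ^ 2 ≤ M * (K * ‖z‖) ^ 2 := by gcongr; exact h.lin z (hS1 hz)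
          _ = _ := by ring).1
  have hrefl := h.integral_reflect (measurableSet_norm_lt r) hS1 (fun z => by simp)
    fun z => φ (x + η z) - φ x - fderiv ℝ φ x (η z)
  have hneg : ∫ z in {z : Euc N | ‖z‖ < r}, (φ (x + η (-z)) - φ x - fderiv ℝ φ x (η (-z))) ∂ν
      = ∫ z in {z : Euc N | ‖z‖ < r}, (φ (x - η z) - φ x + fderiv ℝ φ x (η z)) ∂ν := by
    refine setIntegral_congr_fun (measurableSet_norm_lt r) fun z hz => ?_
    simp only [h.odd z (hS1 hz), map_neg, sub_neg_eq_add, ← sub_eq_add_neg]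
  have hsum : ∫ z in {z : Euc N | ‖z‖ < r}, (φ (x + η z) + φ (x - η z) - 2 * φ x) ∂ν
      = (∫ z in {z : Euc N | ‖z‖ < r}, (φ (x + η z) - φ x - fderiv ℝ φ x (η z)) ∂ν)
        + ∫ z in {z : Euc N | ‖z‖ < r}, (φ (x - η z) - φ x + fderiv ℝ φ x (η z)) ∂ν := by
    rw [← integral_add hi hi']
    refine integral_congr_ae (Filter.Eventually.of_forall fun z => ?_)
    simp only
    ring
  rw [hsum, ← hneg, hrefl]
  unfold smallJumpOp
  ring

end LevyPair

/-- The compensator on `r ≤ ‖z‖ < 1` integrates to zero by oddness. What remains for `u` is a jump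
operator of a finite measure, to which the comparison arguments apply. -/
theorem nonlocalOp_eq {N : ℕ} {A : Type*} (P : HJBData N A) {α : A} {σ K : ℝ}
    (h : LevyPair (P.ν α) (P.η α) σ K) {r : ℝ} (hr : 0 < r) (hr1 : r ≤ 1) (φ : Euc N → ℝ)
    {u : Euc N → ℝ} (hu : Continuous u) {B : ℝ} (hB : ∀ x, |u x| ≤ B) (x : Euc N) :
    P.nonlocalOp α r φ u x
      = smallJumpOp (P.ν α) (P.η α) r φ x + jumpOp (largeJumps (P.ν α) (P.η α) r) u x := by
  unfold HJBData.nonlocalOp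
  rw [h.jumpOp_largeJumps _ hu]
  congr 1
  have hm := measurableSet_norm_lt (N := N) 1
  rw [integral_sub (h.integrableOn_increment hr hr1 hu hB x)
    ((h.integrableOn_linear hr hr1 (fderiv ℝ φ x)).indicator hm), integral_indicator hm,
    Measure.restrict_restrict hm, h.integral_odd (hm.inter (measurableSet_le_norm r))
      inter_subset_left (fun z => by simp), sub_zero]

/-! ## Multilinear interpolation -/

theorem hat_nonneg {N : ℕ} (h : ℝ) (j : Fin N → ℤ) (y : Euc N) : 0 ≤ hat h j y :=
  Finset.prod_nonneg fun _ _ => le_max_left _ _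

theorem hat_le_one {N : ℕ} (h : ℝ) (j : Fin N → ℤ) (y : Euc N) : hat h j y ≤ 1 :=
  Finset.prod_le_one (fun _ _ => le_max_left _ _) fun i _ =>
    max_le zero_le_one (by linarith [abs_nonneg (y i / h - (j i : ℝ))])

theorem continuous_hat {N : ℕ} (h : ℝ) (j : Fin N → ℤ) : Continuous (hat h j) := by
  unfold hat
  fun_prop

theorem hat_eq_zero_of_one_le {N : ℕ} {h : ℝ} {j : Fin N → ℤ} {y : Euc N} {i : Fin N}
    (hi : 1 ≤ |y i / h - (j i : ℝ)|) : hat h j y = 0 :=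
  Finset.prod_eq_zero (Finset.mem_univ i) (max_eq_left (by linarith))

/-- The vertices of the grid cell containing `y`. -/
noncomputable def cellNodes {N : ℕ} (h : ℝ) (y : Euc N) : Finset (Fin N → ℤ) :=
  Fintype.piFinset fun i => {⌊y i / h⌋, ⌊y i / h⌋ + 1}

theorem hat_eq_zero_of_notMem_cellNodes {N : ℕ} {h : ℝ} {j : Fin N → ℤ} {y : Euc N}
    (hj : j ∉ cellNodes h y) : hat h j y = 0 := by
  simp only [cellNodes, Fintype.mem_piFinset, Finset.mem_insert, Finset.mem_singleton,
    not_forall, not_or] at hj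
  obtain ⟨i, h1, h2⟩ := hj
  refine hat_eq_zero_of_one_le (i := i) ?_
  have hf1 := Int.floor_le (y i / h)
  have hf2 := Int.lt_floor_add_one (y i / h)
  rcases lt_or_gt_of_ne h1 with h3 | h3
  · have : ((j i : ℤ) : ℝ) + 1 ≤ ⌊y i / h⌋ := by exact_mod_cast h3
    rw [le_abs]; left; linarith
  · have h4 : ⌊y i / h⌋ + 1 < j i := lt_of_le_of_ne h3 (Ne.symm h2)
    have : ((⌊y i / h⌋ : ℤ) : ℝ) + 1 + 1 ≤ j i := by exact_mod_cast h4
    rw [le_abs]; right; linarith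

theorem hat_one_floor (t : ℝ) : max 0 (1 - |t - (⌊t⌋ : ℝ)|) = 1 - (t - ⌊t⌋) := by
  have hf1 := Int.floor_le t
  have hf2 := Int.lt_floor_add_one t
  rw [abs_of_nonneg (by linarith), max_eq_right (by linarith)]

theorem hat_one_floor_add_one (t : ℝ) :
    max 0 (1 - |t - ((⌊t⌋ + 1 : ℤ) : ℝ)|) = t - ⌊t⌋ := by
  have hf1 := Int.floor_le t
  have hf2 := Int.lt_floor_add_one t
  push_cast
  rw [abs_of_nonpos (by linarith), max_eq_right (by linarith)]
  ring

theorem sum_hat {N : ℕ} (h : ℝ) (y : Euc N) : ∑ j ∈ cellNodes h y, hat h j y = 1 := by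
  unfold cellNodes hat
  rw [← Finset.prod_univ_sum (fun i : Fin N => ({⌊y i / h⌋, ⌊y i / h⌋ + 1} : Finset ℤ))
    fun i (m : ℤ) => max 0 (1 - |y i / h - (m : ℝ)|)]
  refine Finset.prod_eq_one fun i _ => ?_
  rw [Finset.sum_pair (by simp), hat_one_floor, hat_one_floor_add_one]
  ring

/-- The sum over cell vertices factors into one-dimensional sums, all equal to `1` except in the
direction `l`. Reproduction of affine functions is what makes the interpolation second order
accurate. -/
theorem sum_hat_mul_coord {N : ℕ} (h : ℝ) (y : Euc N) (l : Fin N) :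
    ∑ j ∈ cellNodes h y, hat h j y * (j l : ℝ) = y l / h := by
  have e : ∀ j : Fin N → ℤ, hat h j y * (j l : ℝ)
      = ∏ i, (max 0 (1 - |y i / h - (j i : ℝ)|) * if i = l then (j i : ℝ) else 1) := by
    intro j
    rw [Finset.prod_mul_distrib, Finset.prod_ite_eq' Finset.univ l, if_pos (Finset.mem_univ l)]
    rfl
  simp only [e]
  unfold cellNodes
  rw [← Finset.prod_univ_sum (fun i : Fin N => ({⌊y i / h⌋, ⌊y i / h⌋ + 1} : Finset ℤ))
    fun i (m : ℤ) => max 0 (1 - |y i / h - (m : ℝ)|) * if i = l then (m : ℝ) else 1]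
  rw [Finset.prod_eq_single l]
  · rw [Finset.sum_pair (by simp), hat_one_floor, hat_one_floor_add_one]
    simp only [if_true]
    push_cast
    ring
  · intro i _ hi
    rw [Finset.sum_pair (by simp), hat_one_floor, hat_one_floor_add_one]
    simp only [hi, if_false]
    ring
  · simp

theorem sum_hat_smul_gridNode {N : ℕ} {h : ℝ} (hh : h ≠ 0) (y : Euc N) :
    ∑ j ∈ cellNodes h y, hat h j y • gridNode h j = y := by
  ext l
  have h1 : (∑ j ∈ cellNodes h y, hat h j y • gridNode h j).ofLp l
      = ∑ j ∈ cellNodes h y, h * (hat h j y * (j l : ℝ)) := by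
    simp only [WithLp.ofLp_sum, Finset.sum_apply]
    refine Finset.sum_congr rfl fun j _ => ?_
    simp [gridNode]
    ring
  rw [h1, ← Finset.mul_sum, sum_hat_mul_coord]
  field_simp

theorem norm_gridNode_sub_sq_le {N : ℕ} {h : ℝ} (hh : 0 < h) {j : Fin N → ℤ} {y : Euc N}
    (hj : hat h j y ≠ 0) : ‖gridNode h j - y‖ ^ 2 ≤ N * h ^ 2 := by
  rw [EuclideanSpace.norm_sq_eq]
  calc ∑ i, ‖(gridNode h j - y) i‖ ^ 2 ≤ ∑ _i : Fin N, h ^ 2 := by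
        refine Finset.sum_le_sum fun i _ => ?_
        have h1 : |y i / h - (j i : ℝ)| < 1 := by
          by_contra! hc
          exact hj (hat_eq_zero_of_one_le hc)
        have h2 : (gridNode h j - y) i = -(h * (y i / h - (j i : ℝ))) := by
          simp only [gridNode, PiLp.sub_apply]
          field_simp
          ring
        rw [h2, norm_neg, norm_mul, Real.norm_of_nonneg hh.le, Real.norm_eq_abs]
        have : h * |y i / h - (j i : ℝ)| ≤ h := mul_le_of_le_one_right hh.le h1.le
        gcongr
    _ = _ := by simp

theorem interpolant_eq_sum {N : ℕ} {h : ℝ} {s : Finset (Fin N → ℤ)} {y : Euc N}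
    (hs : ∀ j ∉ s, hat h j y = 0) (ψ : Euc N → ℝ) :
    interpolant h ψ y = ∑ j ∈ s, ψ (gridNode h j) * hat h j y :=
  tsum_eq_sum fun j hj => by rw [hs j hj, mul_zero]

theorem sum_hat_eq_one {N : ℕ} {h : ℝ} {s : Finset (Fin N → ℤ)} {y : Euc N}
    (hs : ∀ j ∉ s, hat h j y = 0) : ∑ j ∈ s, hat h j y = 1 := by
  have h1 := interpolant_eq_sum hs fun _ => (1 : ℝ)
  have h2 := interpolant_eq_sum (fun j hj => hat_eq_zero_of_notMem_cellNodes hj)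
    (fun _ => (1 : ℝ)) (h := h) (y := y)
  simp only [one_mul] at h1 h2
  rw [← h1, h2, sum_hat]

/-- Second order accuracy of multilinear interpolation. -/
theorem abs_interpolant_sub_le {N : ℕ} {h : ℝ} (hh : 0 < h) {φ : Euc N → ℝ} {M : ℝ} (hM : 0 ≤ M)
    (h2 : ∀ x y, |φ (x + y) - φ x - fderiv ℝ φ x y| ≤ M * ‖y‖ ^ 2) (x y : Euc N) :
    |interpolant h (fun y => φ (x + y)) y - φ (x + y)| ≤ M * (N * h ^ 2) := by
  rw [interpolant_eq_sum fun j hj => hat_eq_zero_of_notMem_cellNodes hj]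
  -- `y` is the barycentre of the cell vertices with the hat weights, so the first order Taylor
  -- terms at `x + y` cancel.
  have hlin : ∑ j ∈ cellNodes h y, hat h j y * fderiv ℝ φ (x + y) (gridNode h j - y) = 0 := by
    have : ∑ j ∈ cellNodes h y, hat h j y • (gridNode h j - y) = 0 := by
      simp only [smul_sub, Finset.sum_sub_distrib, sum_hat_smul_gridNode hh.ne', ← Finset.sum_smul,
        sum_hat, one_smul, sub_self]
    have h3 := congrArg (fderiv ℝ φ (x + y)) this
    simpa only [map_sum, map_smul, smul_eq_mul, map_zero] using h3
  have hrep : ∑ j ∈ cellNodes h y, φ (x + gridNode h j) * hat h j y - φ (x + y)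
      = ∑ j ∈ cellNodes h y, hat h j y * (φ (x + y + (gridNode h j - y)) - φ (x + y)
        - fderiv ℝ φ (x + y) (gridNode h j - y)) := by
    simp only [mul_sub, Finset.sum_sub_distrib]
    rw [show (∑ j ∈ cellNodes h y, hat h j y * φ (x + y)) = φ (x + y) by
      rw [← Finset.sum_mul, sum_hat, one_mul], ← sub_eq_zero]
    have e : ∀ j, x + y + (gridNode h j - y) = x + gridNode h j := fun j => by abel
    simp only [e, mul_comm (hat h _ y)]
    simp only [mul_comm (hat h _ y)] at hlin
    rw [hlin, sub_zero, sub_self]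
  rw [hrep]
  refine (Finset.abs_sum_le_sum_abs _ _).trans ?_
  calc _ ≤ ∑ j ∈ cellNodes h y, hat h j y * (M * (N * h ^ 2)) := by
        refine Finset.sum_le_sum fun j _ => ?_
        rw [abs_mul, abs_of_nonneg (hat_nonneg h j y)]
        by_cases hz : hat h j y = 0
        · simp [hz]
        · refine mul_le_mul_of_nonneg_left ((h2 _ _).trans ?_) (hat_nonneg h j y)
          gcongr
          exact norm_gridNode_sub_sq_le hh hz
    _ = _ := by rw [← Finset.sum_mul, sum_hat, one_mul]

/-- A finite box of indices whose hat functions cover the ball of radius `R`. -/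
noncomputable def gridBox (N : ℕ) (h R : ℝ) : Finset (Fin N → ℤ) :=
  Fintype.piFinset fun _ => Finset.Icc (-⌈R / h⌉ - 1) (⌈R / h⌉ + 1)

theorem hat_eq_zero_of_notMem_gridBox {N : ℕ} {h R : ℝ} (hh : 0 < h) {y : Euc N} (hy : ‖y‖ ≤ R)
    {j : Fin N → ℤ} (hj : j ∉ gridBox N h R) : hat h j y = 0 := by
  simp only [gridBox, Fintype.mem_piFinset, Finset.mem_Icc, not_forall] at hj
  obtain ⟨i, hi⟩ := hj
  refine hat_eq_zero_of_one_le (i := i) ?_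
  have h1 : |y i| ≤ R := (PiLp.norm_apply_le y i).trans hy
  have h2 : |y i / h| ≤ ⌈R / h⌉ := by
    rw [abs_div, abs_of_pos hh]
    exact (div_le_div_of_nonneg_right h1 hh.le).trans (Int.le_ceil _)
  rw [abs_le] at h2
  by_cases h3 : -⌈R / h⌉ - 1 ≤ j i
  · have h4 : ⌈R / h⌉ + 1 + 1 ≤ j i := by
      have := not_and.1 hi h3
      omega
    have : (⌈R / h⌉ : ℝ) + 1 + 1 ≤ j i := by exact_mod_cast h4
    rw [le_abs]; right; linarith
  · have h4 : j i + 1 ≤ -⌈R / h⌉ - 1 := by omega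
    have : (j i : ℝ) + 1 ≤ -⌈R / h⌉ - 1 := by exact_mod_cast h4
    rw [le_abs]; left; linarith

/-! ## The diffusion matrix -/

theorem bilinear_expand {N : ℕ} (H : Euc N →L[ℝ] Euc N →L[ℝ] ℝ) (y : Euc N) :
    H y y = ∑ l, ∑ m, y l * y m
      * H (EuclideanSpace.single l 1) (EuclideanSpace.single m 1) := by
  have hy : y = ∑ l, y l • EuclideanSpace.single l (1 : ℝ) := by
    ext i
    simp [WithLp.ofLp_sum, Finset.sum_apply, Pi.single_apply]
  conv_lhs => rw [hy]
  simp only [map_sum, map_smul, _root_.sum_apply, _root_.smul_apply, smul_eq_mul,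
    Finset.mul_sum]
  rw [Finset.sum_comm]
  refine Finset.sum_congr rfl fun l _ => Finset.sum_congr rfl fun m _ => ?_
  ring

namespace LevyPair

variable {N : ℕ} {A : Type*} {P : HJBData N A} {α : A} {σ K : ℝ}

theorem integrableOn_coord_mul (h : LevyPair (P.ν α) (P.η α) σ K) {δ : ℝ} (hδ : 0 < δ)
    (hδ1 : δ ≤ 1) (l m : Fin N) :
    IntegrableOn (fun z => P.η α z l * P.η α z m) {z : Euc N | ‖z‖ < δ} (P.ν α) := by
  have hη := h.cont
  have hK := h.K_pos
  refine (integrableOn_of_moment (p := 2) (C := K ^ 2) (m := K * δ ^ (2 - σ)) (by positivity)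
    (by positivity) (h.moment_two δ hδ hδ1) (by fun_prop) fun z hz => ?_).1
  have h1 := h.lin z (hz.trans_le hδ1)
  rw [abs_mul]
  calc |P.η α z l| * |P.η α z m| ≤ (K * ‖z‖) * (K * ‖z‖) :=
        mul_le_mul ((PiLp.norm_apply_le _ l).trans h1) ((PiLp.norm_apply_le _ m).trans h1)
          (abs_nonneg _) (by positivity)
    _ = _ := by ring

theorem sum_diffMatrix_mul (h : LevyPair (P.ν α) (P.η α) σ K) {δ : ℝ} (hδ : 0 < δ)
    (hδ1 : δ ≤ 1) (b : Fin N → Fin N → ℝ) :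
    ∑ l, ∑ m, P.diffMatrix α δ l m * b l m
      = 1 / 2 * ∫ z in {z : Euc N | ‖z‖ < δ},
          (∑ l, ∑ m, P.η α z l * P.η α z m * b l m) ∂(P.ν α) := by
  have hi := fun l m => (h.integrableOn_coord_mul hδ hδ1 l m).mul_const (b l m)
  rw [integral_finsetSum _ fun l _ => integrable_finsetSum _ fun m _ => hi l m, Finset.mul_sum]
  refine Finset.sum_congr rfl fun l _ => ?_
  rw [integral_finsetSum _ fun m _ => hi l m, Finset.mul_sum]
  refine Finset.sum_congr rfl fun m _ => ?_
  rw [integral_mul_const]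
  simp only [HJBData.diffMatrix, Matrix.of_apply]
  ring

theorem diffMatrix_nonneg (h : LevyPair (P.ν α) (P.η α) σ K) {δ : ℝ} (hδ : 0 < δ)
    (hδ1 : δ ≤ 1) : 0 ≤ P.diffMatrix α δ := by
  rw [Matrix.nonneg_iff_posSemidef]
  refine Matrix.PosSemidef.of_dotProduct_mulVec_nonneg ?_ fun x => ?_
  · ext l m
    simp [HJBData.diffMatrix, mul_comm]
  · have e : star x ⬝ᵥ Matrix.mulVec (P.diffMatrix α δ) x
        = ∑ l, ∑ m, P.diffMatrix α δ l m * (x l * x m) := by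
      simp only [dotProduct, Matrix.mulVec, Finset.mul_sum, star_trivial]
      refine Finset.sum_congr rfl fun l _ => Finset.sum_congr rfl fun m _ => ?_
      ring
    rw [e, h.sum_diffMatrix_mul hδ hδ1]
    refine mul_nonneg (by norm_num) (integral_nonneg fun z => ?_)
    have : ∑ l, ∑ m, P.η α z l * P.η α z m * (x l * x m) = (∑ l, P.η α z l * x l) ^ 2 := by
      rw [sq, Finset.sum_mul_sum]
      refine Finset.sum_congr rfl fun l _ => Finset.sum_congr rfl fun m _ => ?_
      ring
    simp only [this]
    exact sq_nonneg _

/-- The square root is symmetric, so its columns satisfy `∑ s_i s_iᵀ = a_δ`. Second differences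
along them thus see the same second order term as the small jumps. -/
theorem sum_sqrtCol (h : LevyPair (P.ν α) (P.η α) σ K) {δ : ℝ} (hδ : 0 < δ)
    (hδ1 : δ ≤ 1) (H : Euc N →L[ℝ] Euc N →L[ℝ] ℝ) :
    ∑ i, H (P.sqrtCol α δ i) (P.sqrtCol α δ i)
      = 1 / 2 * ∫ z in {z : Euc N | ‖z‖ < δ}, H (P.η α z) (P.η α z) ∂(P.ν α) := by
  have ha := h.diffMatrix_nonneg hδ hδ1
  have hsq := CFC.sqrt_mul_sqrt_self (P.diffMatrix α δ) ha
  have hsymm : (CFC.sqrt (P.diffMatrix α δ)).IsHermitian :=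
    (Matrix.nonneg_iff_posSemidef.1 (CFC.sqrt_nonneg _)).isHermitian
  have hentry : ∀ l m, ∑ i, P.sqrtCol α δ i l * P.sqrtCol α δ i m = P.diffMatrix α δ l m := by
    intro l m
    have h1 := congrFun (congrFun hsq l) m
    rw [Matrix.mul_apply] at h1
    rw [← h1]
    refine Finset.sum_congr rfl fun i _ => ?_
    have h2 : star (CFC.sqrt (P.diffMatrix α δ) m i) = CFC.sqrt (P.diffMatrix α δ) i m := hsymm.apply i m
    simp only [HJBData.sqrtCol]
    rw [← h2, star_trivial]
  rw [Finset.sum_congr rfl fun i _ => bilinear_expand H (P.sqrtCol α δ i),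
    integral_congr_ae (Filter.Eventually.of_forall fun z => bilinear_expand H (P.η α z)),
    ← h.sum_diffMatrix_mul hδ hδ1, Finset.sum_comm]
  refine Finset.sum_congr rfl fun l _ => ?_
  rw [Finset.sum_comm]
  refine Finset.sum_congr rfl fun m _ => ?_
  rw [← hentry, Finset.sum_mul]

/-- The squared lengths of the columns add up to the trace of `a_δ`; this is the preceding identity
for the inner product, estimated by the second moment. -/
theorem norm_sqrtCol_sq_le (h : LevyPair (P.ν α) (P.η α) σ K) {δ : ℝ} (hδ : 0 < δ)
    (hδ1 : δ ≤ 1) (i : Fin N) : ‖P.sqrtCol α δ i‖ ^ 2 ≤ K ^ 3 * δ ^ (2 - σ) := by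
  have hη := h.cont
  have hK := h.K_pos
  obtain ⟨H, hH⟩ : ∃ H : Euc N →L[ℝ] Euc N →L[ℝ] ℝ, ∀ y, H y y = ‖y‖ ^ 2 :=
    ⟨innerSL ℝ, fun y => real_inner_self_eq_norm_sq y⟩
  have h1 := h.sum_sqrtCol hδ hδ1 H
  simp only [hH] at h1
  have h2 := (integrableOn_of_moment (p := 2) (C := K ^ 2) (G := fun z => ‖P.η α z‖ ^ 2)
    (m := K * δ ^ (2 - σ)) (by positivity)
    (by positivity) (h.moment_two δ hδ hδ1) (by fun_prop) fun z hz => by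
      rw [abs_of_nonneg (by positivity), ← mul_pow]
      gcongr
      exact h.lin z (hz.trans_le hδ1)).2
  have h3 := (abs_le.1 h2).2
  have h4 : ‖P.sqrtCol α δ i‖ ^ 2 ≤ ∑ i, ‖P.sqrtCol α δ i‖ ^ 2 :=
    Finset.single_le_sum (f := fun i => ‖P.sqrtCol α δ i‖ ^ 2) (fun _ _ => by positivity)
      (Finset.mem_univ i)
  have h5 : 0 ≤ K ^ 2 * (K * δ ^ (2 - σ)) := by positivity
  calc _ ≤ K ^ 2 * (K * δ ^ (2 - σ)) := by linarith
    _ = _ := by ring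

end LevyPair

/-! ## The scheme as a jump operator, and its consistency -/

theorem exists_atomic_measure {N : ℕ} {ι : Type*} (s : Finset ι) {a : ι → ℝ} (ha : ∀ j, 0 ≤ a j)
    (p : ι → Euc N) : ∃ μ : Measure (Euc N), IsFiniteMeasure μ ∧ μ.real univ = ∑ j ∈ s, a j ∧
      ∀ φ x, jumpOp μ φ x = ∑ j ∈ s, a j * (φ (x + p j) - φ x) := by
  classical
  refine ⟨∑ j ∈ s, ENNReal.ofReal (a j) • Measure.dirac (p j), ⟨?_⟩, ?_, fun φ x => ?_⟩
  · simp only [Measure.coe_finsetSum, Finset.sum_apply, Measure.smul_apply, measure_univ,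
      smul_eq_mul, mul_one]
    exact ENNReal.sum_lt_top.2 fun j _ => ENNReal.ofReal_lt_top
  · simp only [Measure.real, Measure.coe_finsetSum, Finset.sum_apply, Measure.smul_apply,
      measure_univ, smul_eq_mul, mul_one]
    rw [ENNReal.toReal_sum fun j _ => ENNReal.ofReal_ne_top]
    exact Finset.sum_congr rfl fun j _ => ENNReal.toReal_ofReal (ha j)
  · unfold jumpOp
    rw [integral_finsetSum_measure fun j _ =>
      (integrable_dirac (by simp)).smul_measure ENNReal.ofReal_ne_top]
    refine Finset.sum_congr rfl fun j _ => ?_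
    rw [integral_smul_measure, integral_dirac, ENNReal.toReal_ofReal (ha j), smul_eq_mul]

namespace LevyPair

variable {N : ℕ} {A : Type*} {P : HJBData N A} {α : A} {σ K : ℝ}

theorem isFiniteMeasure_restrict_lt (h : LevyPair (P.ν α) (P.η α) σ K) {δ : ℝ} (hδ : 0 < δ)
    (hδ1 : δ ≤ 1) : IsFiniteMeasure ((P.ν α).restrict {z : Euc N | δ < ‖z‖}) :=
  have := h.isFiniteMeasure_restrict hδ hδ1
  isFiniteMeasure_of_le ((P.ν α).restrict {z : Euc N | δ ≤ ‖z‖})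
    (Measure.restrict_mono (show {z : Euc N | δ < ‖z‖} ⊆ {z : Euc N | δ ≤ ‖z‖} from
      fun _ (hz : δ < _) => hz.le) le_rfl)

theorem restrict_lt_eq (h : LevyPair (P.ν α) (P.η α) σ K) {δ : ℝ} (hδ : 0 < δ)
    (hδ1 : δ < 1) : (P.ν α).restrict {z : Euc N | δ < ‖z‖}
      = (P.ν α).restrict {z : Euc N | δ ≤ ‖z‖} := by
  refine Measure.restrict_congr_set ?_
  have h0 : ∀ᵐ z ∂(P.ν α), ‖z‖ ≠ δ := by
    rw [ae_iff]
    simpa using h.sphere δ hδ hδ1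
  filter_upwards [h0] with z hz
  exact propext ⟨fun h' => le_of_lt h', fun h' => lt_of_le_of_ne h' (Ne.symm hz)⟩

theorem integrable_hat (h : LevyPair (P.ν α) (P.η α) σ K) {δ : ℝ} (hδ : 0 < δ)
    (hδ1 : δ ≤ 1) (t : ℝ) (j : Fin N → ℤ) :
    IntegrableOn (fun z => hat t j (P.η α z)) {z : Euc N | δ < ‖z‖} (P.ν α) := by
  have := h.isFiniteMeasure_restrict_lt hδ hδ1
  exact integrable_of_abs_le ((continuous_hat t j).comp h.cont).aestronglyMeasurable (B := 1)
    fun z => by rw [abs_of_nonneg (hat_nonneg _ _ _)]; exact hat_le_one _ _ _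

theorem weight_eq_zero (h : LevyPair (P.ν α) (P.η α) σ K) {t R : ℝ} (ht : 0 < t) (hR : K ≤ R)
    (δ : ℝ) {j : Fin N → ℤ} (hj : j ∉ gridBox N t R) : P.weight α δ t j = 0 := by
  unfold HJBData.weight
  simp [hat_eq_zero_of_notMem_gridBox ht ((h.bdd _).trans hR) hj]

theorem sum_mul_weight (h : LevyPair (P.ν α) (P.η α) σ K) {δ : ℝ} (hδ : 0 < δ)
    (hδ1 : δ ≤ 1) (t : ℝ) (s : Finset (Fin N → ℤ)) (b : (Fin N → ℤ) → ℝ) :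
    ∑ j ∈ s, b j * P.weight α δ t j
      = ∫ z in {z : Euc N | δ < ‖z‖}, (∑ j ∈ s, b j * hat t j (P.η α z)) ∂(P.ν α) := by
  rw [integral_finsetSum _ fun j _ => (h.integrable_hat hδ hδ1 t j).const_mul (b j)]
  simp only [integral_const_mul]
  rfl

/-- The discrete operators combine to a jump operator of a finite (atomic) measure. -/
theorem exists_scheme_measure (h : LevyPair (P.ν α) (P.η α) σ K) {δ k t : ℝ} (hδ : 0 < δ)
    (hδ1 : δ < 1) (hk : 0 < k) (ht : 0 < t) :
    ∃ μ : Measure (Euc N), IsFiniteMeasure μ ∧ μ.real univ ≤ 2 * N / k ^ 2 + K * δ ^ (-σ) ∧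
      ∀ φ x, P.localDiscrete α δ k t φ x + P.nonlocalDiscrete α δ t φ x = jumpOp μ φ x := by
  -- One finite box of indices has to serve the range of `η` and all the points `±k s_i`.
  set R : ℝ := K + k * ∑ i, ‖P.sqrtCol α δ i‖ with hR
  have hsum0 : 0 ≤ ∑ i, ‖P.sqrtCol α δ i‖ := Finset.sum_nonneg fun _ _ => norm_nonneg _
  have hKR : K ≤ R := by rw [hR]; linarith [mul_nonneg hk.le hsum0]
  have hsR : ∀ i, ‖k • P.sqrtCol α δ i‖ ≤ R := fun i => by
    rw [norm_smul, Real.norm_of_nonneg hk.le, hR]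
    have := Finset.single_le_sum (f := fun i => ‖P.sqrtCol α δ i‖) (fun _ _ => norm_nonneg _)
      (Finset.mem_univ i)
    linarith [mul_le_mul_of_nonneg_left this hk.le, h.K_pos]
  set s := gridBox N t R with hs
  have hs1 : ∀ i, ∀ j ∉ s, hat t j (k • P.sqrtCol α δ i) = 0 := fun i j hj =>
    hat_eq_zero_of_notMem_gridBox ht (hsR i) hj
  have hs2 : ∀ i, ∀ j ∉ s, hat t j (-(k • P.sqrtCol α δ i)) = 0 := fun i j hj =>
    hat_eq_zero_of_notMem_gridBox ht (by rw [norm_neg]; exact hsR i) hj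
  have hs3 : ∀ z, ∀ j ∉ s, hat t j (P.η α z) = 0 := fun z j hj =>
    hat_eq_zero_of_notMem_gridBox ht ((h.bdd z).trans hKR) hj
  set a : (Fin N → ℤ) → ℝ := fun j => (∑ i, (hat t j (k • P.sqrtCol α δ i)
    + hat t j (-(k • P.sqrtCol α δ i))) / k ^ 2) + P.weight α δ t j with ha
  have hw0 : ∀ j, 0 ≤ P.weight α δ t j := fun j => integral_nonneg fun z => hat_nonneg _ _ _
  have ha0 : ∀ j, 0 ≤ a j := fun j => add_nonneg (Finset.sum_nonneg fun i _ =>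
    div_nonneg (add_nonneg (hat_nonneg _ _ _) (hat_nonneg _ _ _)) (by positivity)) (hw0 j)
  obtain ⟨μ, hμ, hmass, hJ⟩ := exists_atomic_measure s ha0 (gridNode t)
  refine ⟨μ, hμ, ?_, fun φ x => ?_⟩
  · rw [hmass]
    simp only [ha, Finset.sum_add_distrib]
    gcongr
    · rw [Finset.sum_comm]
      simp only [← Finset.sum_div, Finset.sum_add_distrib, sum_hat_eq_one (hs1 _),
        sum_hat_eq_one (hs2 _)]
      simp
      apply le_of_eq
      ring
    · have h1 := h.sum_mul_weight hδ hδ1.le t s fun _ => 1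
      simp only [one_mul, sum_hat_eq_one (hs3 _)] at h1
      rw [h1, h.restrict_lt_eq hδ hδ1]
      simpa using h.real_tail_le hδ hδ1.le
  · rw [hJ]
    simp only [ha, add_mul, Finset.sum_add_distrib]
    congr 1
    · simp only [Finset.sum_mul]
      rw [Finset.sum_comm]
      unfold HJBData.localDiscrete
      refine Finset.sum_congr rfl fun i _ => ?_
      rw [interpolant_eq_sum (hs1 i), interpolant_eq_sum (hs2 i)]
      have e1 := sum_hat_eq_one (hs1 i)
      have e2 := sum_hat_eq_one (hs2 i)
      -- The hat weights at each of the two points sum to one, so the central value distributes over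
      -- the nodes and only nonnegatively weighted increments of `φ` remain.
      have e3 : (2 : ℝ) * φ x = (∑ j ∈ s, φ x * hat t j (k • P.sqrtCol α δ i))
          + ∑ j ∈ s, φ x * hat t j (-(k • P.sqrtCol α δ i)) := by
        rw [← Finset.mul_sum, ← Finset.mul_sum, e1, e2]; ring
      rw [e3, ← Finset.sum_add_distrib, ← Finset.sum_add_distrib, ← Finset.sum_sub_distrib,
        Finset.sum_div]
      refine Finset.sum_congr rfl fun j _ => ?_
      ring
    · unfold HJBData.nonlocalDiscrete
      rw [tsum_eq_sum fun j hj => by rw [h.weight_eq_zero ht hKR δ hj, mul_zero]]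
      exact Finset.sum_congr rfl fun j _ => mul_comm _ _

/-! ### Consistency of the quadrature, of the second differences and of the small jump correction.
-/

theorem nonlocalDiscrete_eq (h : LevyPair (P.ν α) (P.η α) σ K) {δ t : ℝ} (hδ : 0 < δ)
    (hδ1 : δ < 1) (ht : 0 < t) (φ : Euc N → ℝ) (x : Euc N) :
    P.nonlocalDiscrete α δ t φ x = ∫ z in {z : Euc N | δ ≤ ‖z‖},
      (interpolant t (fun y => φ (x + y)) (P.η α z) - φ x) ∂(P.ν α) := by
  have hs3 : ∀ z, ∀ j ∉ gridBox N t K, hat t j (P.η α z) = 0 := fun z j hj =>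
    hat_eq_zero_of_notMem_gridBox ht (h.bdd z) hj
  unfold HJBData.nonlocalDiscrete
  rw [tsum_eq_sum fun j hj => by rw [h.weight_eq_zero ht le_rfl δ hj, mul_zero],
    h.sum_mul_weight hδ hδ1.le, h.restrict_lt_eq hδ hδ1]
  refine integral_congr_ae (Filter.Eventually.of_forall fun z => ?_)
  simp only
  rw [interpolant_eq_sum (hs3 z)]
  simp only [sub_mul, Finset.sum_sub_distrib, ← Finset.mul_sum, sum_hat_eq_one (hs3 z), mul_one]

theorem continuous_interpolant_comp (h : LevyPair (P.ν α) (P.η α) σ K) {t : ℝ} (ht : 0 < t)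
    (ψ : Euc N → ℝ) : Continuous fun z => interpolant t ψ (P.η α z) := by
  have : (fun z => interpolant t ψ (P.η α z))
      = fun z => ∑ j ∈ gridBox N t K, ψ (gridNode t j) * hat t j (P.η α z) :=
    funext fun z => interpolant_eq_sum (fun j hj =>
      hat_eq_zero_of_notMem_gridBox ht (h.bdd z) hj) _
  rw [this]
  exact continuous_finsetSum _ fun j _ =>
    continuous_const.mul ((continuous_hat t j).comp h.cont)

theorem nonlocalDiscrete_consistency (h : LevyPair (P.ν α) (P.η α) σ K) {δ t : ℝ} (hδ : 0 < δ)
    (hδ1 : δ < 1) (ht : 0 < t) {φ : Euc N → ℝ} (hφ : Continuous φ) {B : ℝ} (hB : ∀ x, |φ x| ≤ B)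
    {M : ℝ} (hM : 0 ≤ M) (h2 : ∀ x y, |φ (x + y) - φ x - fderiv ℝ φ x y| ≤ M * ‖y‖ ^ 2)
    (x : Euc N) :
    |P.nonlocalDiscrete α δ t φ x - jumpOp (largeJumps (P.ν α) (P.η α) δ) φ x|
      ≤ M * (N * t ^ 2) * (K * δ ^ (-σ)) := by
  have := h.isFiniteMeasure_restrict hδ hδ1.le
  have hη := h.cont
  have hb : ∀ z, |interpolant t (fun y => φ (x + y)) (P.η α z) - φ (x + P.η α z)|
      ≤ M * (N * t ^ 2) := fun z => abs_interpolant_sub_le ht hM h2 x _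
  have hi1 := h.integrableOn_increment hδ hδ1.le hφ hB x
  have hi2 : Integrable (fun z => interpolant t (fun y => φ (x + y)) (P.η α z)
      - φ (x + P.η α z)) ((P.ν α).restrict {z : Euc N | δ ≤ ‖z‖}) :=
    integrable_of_abs_le ((h.continuous_interpolant_comp ht _).sub
      (by fun_prop)).aestronglyMeasurable hb
  have hsum : P.nonlocalDiscrete α δ t φ x - jumpOp (largeJumps (P.ν α) (P.η α) δ) φ x
      = ∫ z in {z : Euc N | δ ≤ ‖z‖}, (interpolant t (fun y => φ (x + y)) (P.η α z)
        - φ (x + P.η α z)) ∂(P.ν α) := by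
    rw [h.nonlocalDiscrete_eq hδ hδ1 ht, h.jumpOp_largeJumps _ hφ, sub_eq_iff_eq_add,
      ← integral_add hi2 hi1]
    refine integral_congr_ae (Filter.Eventually.of_forall fun z => ?_)
    simp only
    ring
  rw [hsum, ← Real.norm_eq_abs]
  refine (norm_integral_le_of_norm_le_const (Filter.Eventually.of_forall hb)).trans ?_
  gcongr
  simpa [Measure.real] using h.real_tail_le hδ hδ1.le

/-- Two errors compete: the central difference contributes `k² ‖s_i‖⁴` with `‖s_i‖²` of order
`δ^(2-σ)`, while the interpolation error `t²` is amplified by the division by `k²`. -/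
theorem localDiscrete_consistency (h : LevyPair (P.ν α) (P.η α) σ K) {δ k t : ℝ} (hδ : 0 < δ)
    (hδ1 : δ ≤ 1) (hk : 0 < k) (ht : 0 < t) {φ : Euc N → ℝ} {M₂ M₄ : ℝ} (hM₂ : 0 ≤ M₂)
    (hM₄ : 0 ≤ M₄) (h2 : ∀ x y, |φ (x + y) - φ x - fderiv ℝ φ x y| ≤ M₂ * ‖y‖ ^ 2)
    (x : Euc N) (H : Euc N →L[ℝ] Euc N →L[ℝ] ℝ)
    (h4 : ∀ y, |φ (x + y) + φ (x - y) - 2 * φ x - H y y| ≤ M₄ * ‖y‖ ^ 4) :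
    |P.localDiscrete α δ k t φ x - ∑ i, H (P.sqrtCol α δ i) (P.sqrtCol α δ i)|
      ≤ N * (M₄ * k ^ 2 * (K ^ 3 * δ ^ (2 - σ)) ^ 2 + 2 * (M₂ * (N * t ^ 2)) / k ^ 2) := by
  unfold HJBData.localDiscrete
  rw [← Finset.sum_sub_distrib]
  refine (Finset.abs_sum_le_sum_abs _ _).trans ?_
  calc _ ≤ ∑ _i : Fin N, (M₄ * k ^ 2 * (K ^ 3 * δ ^ (2 - σ)) ^ 2
        + 2 * (M₂ * (N * t ^ 2)) / k ^ 2) := by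
        refine Finset.sum_le_sum fun i _ => ?_
        set s := P.sqrtCol α δ i
        have hs := h.norm_sqrtCol_sq_le hδ hδ1 i
        have e1 := abs_interpolant_sub_le ht hM₂ h2 x (k • s)
        have e2 := abs_interpolant_sub_le ht hM₂ h2 x (-(k • s))
        rw [← sub_eq_add_neg] at e2
        have e3 := h4 (k • s)
        simp only [map_smul, _root_.smul_apply, smul_eq_mul, norm_smul,
          Real.norm_of_nonneg hk.le] at e3
        set I₁ := interpolant t (fun y => φ (x + y)) (k • s)
        set I₂ := interpolant t (fun y => φ (x + y)) (-(k • s))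
        have e4 : (I₁ + I₂ - 2 * φ x) / k ^ 2 - H s s
            = ((I₁ - φ (x + k • s)) + (I₂ - φ (x - k • s))
              + (φ (x + k • s) + φ (x - k • s) - 2 * φ x - k * (k * H s s))) / k ^ 2 := by
          field_simp
          ring
        rw [e4, abs_div, abs_of_pos (show 0 < k ^ 2 by positivity), div_le_iff₀ (by positivity)]
        have e5 : M₄ * (k * ‖s‖) ^ 4 ≤ M₄ * (k ^ 4 * (K ^ 3 * δ ^ (2 - σ)) ^ 2) := by
          have : (k * ‖s‖) ^ 4 = k ^ 4 * (‖s‖ ^ 2) ^ 2 := by ring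
          rw [this]
          gcongr
        have e6 : (M₄ * k ^ 2 * (K ^ 3 * δ ^ (2 - σ)) ^ 2 + 2 * (M₂ * (N * t ^ 2)) / k ^ 2) * k ^ 2
            = M₄ * (k ^ 4 * (K ^ 3 * δ ^ (2 - σ)) ^ 2) + 2 * (M₂ * (N * t ^ 2)) := by
          field_simp
        rw [e6]
        refine (abs_add_le _ _).trans ?_
        have := abs_add_le (I₁ - φ (x + k • s)) (I₂ - φ (x - k • s))
        linarith
    _ = _ := by simp; ring

theorem smallJumpOp_consistency (h : LevyPair (P.ν α) (P.η α) σ K) {δ : ℝ} (hδ : 0 < δ)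
    (hδ1 : δ ≤ 1) {φ : Euc N → ℝ} (hφ : Continuous φ) {M₂ M₄ : ℝ} (hM₂ : 0 ≤ M₂)
    (hM₄ : 0 ≤ M₄) (x : Euc N)
    (h2 : ∀ y, |φ (x + y) - φ x - fderiv ℝ φ x y| ≤ M₂ * ‖y‖ ^ 2)
    (H : Euc N →L[ℝ] Euc N →L[ℝ] ℝ)
    (h4 : ∀ y, |φ (x + y) + φ (x - y) - 2 * φ x - H y y| ≤ M₄ * ‖y‖ ^ 4) :
    |smallJumpOp (P.ν α) (P.η α) δ φ x - ∑ i, H (P.sqrtCol α δ i) (P.sqrtCol α δ i)|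
      ≤ M₄ * K ^ 5 * δ ^ (4 - σ) := by
  have hη := h.cont
  have hK := h.K_pos
  have hq : IntegrableOn (fun z => H (P.η α z) (P.η α z)) {z : Euc N | ‖z‖ < δ} (P.ν α) :=
    (integrableOn_of_moment (p := 2) (C := ‖H‖ * K ^ 2) (m := K * δ ^ (2 - σ)) (by positivity)
      (by positivity) (h.moment_two δ hδ hδ1) (by fun_prop) fun z hz => by
        have h1 := h.lin z (hz.trans_le hδ1)
        calc |H (P.η α z) (P.η α z)| ≤ ‖H‖ * ‖P.η α z‖ * ‖P.η α z‖ := H.le_opNorm₂ _ _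
          _ ≤ ‖H‖ * (K * ‖z‖) * (K * ‖z‖) := by gcongr
          _ = _ := by ring).1
  have hd := integrableOn_of_moment (p := 4) (C := M₄ * K ^ 4) (m := K * δ ^ (4 - σ))
    (G := fun z => φ (x + P.η α z) + φ (x - P.η α z) - 2 * φ x - H (P.η α z) (P.η α z))
    (by positivity) (by positivity) (h.moment_four δ hδ hδ1) (by fun_prop) fun z hz => by
      refine (h4 _).trans ?_
      calc M₄ * ‖P.η α z‖ ^ 4 ≤ M₄ * (K * ‖z‖) ^ 4 := by
            gcongr; exact h.lin z (hz.trans_le hδ1)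
        _ = _ := by ring
  have hs : ∫ z in {z : Euc N | ‖z‖ < δ}, (φ (x + P.η α z) + φ (x - P.η α z) - 2 * φ x) ∂(P.ν α)
      = (∫ z in {z : Euc N | ‖z‖ < δ}, (φ (x + P.η α z) + φ (x - P.η α z) - 2 * φ x
          - H (P.η α z) (P.η α z)) ∂(P.ν α))
        + ∫ z in {z : Euc N | ‖z‖ < δ}, H (P.η α z) (P.η α z) ∂(P.ν α) := by
    rw [← integral_add hd.1 hq]
    simp only [sub_add_cancel]
  rw [h.smallJumpOp_eq_symm hδ hδ1 hφ hM₂ x h2, h.sum_sqrtCol hδ hδ1, hs]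
  have h5 := abs_le.1 hd.2
  have h6 : M₄ * K ^ 4 * (K * δ ^ (4 - σ)) = M₄ * K ^ 5 * δ ^ (4 - σ) := by ring
  have h7 : 0 ≤ M₄ * K ^ 5 * δ ^ (4 - σ) := by positivity
  rw [h6] at h5
  rw [abs_le]
  constructor <;> linarith

/-- Consistency of the full scheme with the Lévy operator. -/
theorem scheme_consistency (h : LevyPair (P.ν α) (P.η α) σ K) {δ k t : ℝ} (hδ : 0 < δ)
    (hδ1 : δ < 1) (hk : 0 < k) (ht : 0 < t) {φ : Euc N → ℝ} {M₂ M₄ : ℝ} (hM₂ : 0 ≤ M₂)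
    (hM₄ : 0 ≤ M₄) (hφ : SmoothBound φ M₂ M₄) {B : ℝ} (hB : ∀ x, |φ x| ≤ B) (x : Euc N) :
    |P.localDiscrete α δ k t φ x + P.nonlocalDiscrete α δ t φ x
        - (smallJumpOp (P.ν α) (P.η α) δ φ x + jumpOp (largeJumps (P.ν α) (P.η α) δ) φ x)|
      ≤ M₄ * K ^ 5 * δ ^ (4 - σ)
        + N * (M₄ * k ^ 2 * (K ^ 3 * δ ^ (2 - σ)) ^ 2 + 2 * (M₂ * (N * t ^ 2)) / k ^ 2)
        + M₂ * (N * t ^ 2) * (K * δ ^ (-σ)) := by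
  have hc := hφ.contDiff.continuous
  obtain ⟨H, hH⟩ := hφ.fourth x
  have h1 := abs_le.1 (h.localDiscrete_consistency hδ hδ1.le hk ht hM₂ hM₄ hφ.second x H hH)
  have h2 := abs_le.1 (h.smallJumpOp_consistency hδ hδ1.le hc hM₂ hM₄ x (hφ.second x) H hH)
  have h3 := abs_le.1 (h.nonlocalDiscrete_consistency hδ hδ1 ht hc hB hM₂ hφ.second x)
  rw [abs_le]
  constructor <;> linarith

end LevyPair

/-! ## Comparison with viscosity sub- and supersolutions -/

/-- A substitute for attained minima on a noncompact space. At a point `p` within `κ` of the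
infimum, subtracting `κ χ p` lowers the value below every value of `g`, so the minimum over the
compact set is global. -/
theorem exists_perturbed_min {X : Type*} [TopologicalSpace X] [Nonempty X] {g : X → ℝ}
    (hg : Continuous g) {b : ℝ} (hb : ∀ x, b ≤ g x) {χ : X → X → ℝ} (hχ : ∀ p, Continuous (χ p))
    (hχ1 : ∀ p, χ p p = 1)
    (hsupp : ∀ p, ∃ s : Set X, IsCompact s ∧ p ∈ s ∧ ∀ x ∉ s, χ p x = 0) {κ : ℝ} (hκ : 0 < κ) :
    ∃ p x, (∀ y, g x - κ * χ p x ≤ g y - κ * χ p y) ∧ ∀ y, g x - κ * χ p x ≤ g y := by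
  have hbdd : BddBelow (range g) := ⟨b, by rintro _ ⟨x, rfl⟩; exact hb x⟩
  obtain ⟨p, hp⟩ := exists_lt_of_ciInf_lt (show (⨅ x, g x) < (⨅ x, g x) + κ by linarith)
  have hinf : ∀ y, g p - κ ≤ g y := fun y => by linarith [ciInf_le hbdd y]
  obtain ⟨s, hs, hps, hs0⟩ := hsupp p
  have hcont : Continuous fun y => g y - κ * χ p y := hg.sub (continuous_const.mul (hχ p))
  obtain ⟨x, -, hmin⟩ := hs.exists_isMinOn ⟨p, hps⟩ hcont.continuousOn
  have hxp : g x - κ * χ p x ≤ g p - κ := by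
    have := hmin hps
    simp only [mem_ofPred_eq, hχ1, mul_one] at this
    exact this
  have hall : ∀ y, g x - κ * χ p x ≤ g y := fun y => hxp.trans (hinf y)
  refine ⟨p, x, fun y => ?_, hall⟩
  by_cases hy : y ∈ s
  · exact hmin hy
  · rw [hs0 y hy, mul_zero, sub_zero]
    exact hall y

theorem unitBump_eq_zero {N : ℕ} {z : Euc N} (hz : 1 ≤ ‖z‖) : unitBump N z = 0 :=
  (unitBump N).zero_of_le_dist (by simpa [unitBump, dist_zero_right] using hz)

theorem unitBump_zero {N : ℕ} : unitBump N 0 = 1 :=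
  (unitBump N).one_of_mem_closedBall (by simp [unitBump])

theorem exists_unitBump_second_bound (N : ℕ) : ∃ C : ℝ, 0 < C ∧ ∀ p x y : Euc N,
    |unitBump N (x + y - p) - unitBump N (x - p)
      - fderiv ℝ (fun x => unitBump N (x - p)) x y| ≤ C * ‖y‖ ^ 2 := by
  obtain ⟨C, hC0, hC⟩ := (isUnitKernel_unitBump (N := N)).exists_second_order_bound
  refine ⟨C, hC0, fun p x y => ?_⟩
  rw [fderiv_comp_sub (f := (unitBump N : Euc N → ℝ)) p]
  have := hC (x - p) y
  rwa [sub_add_eq_add_sub] at this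

theorem unitBump_contDiff_sub {N : ℕ} (p : Euc N) :
    ContDiff ℝ 2 fun x => unitBump N (x - p) :=
  (unitBump N).contDiff.comp (contDiff_id.sub contDiff_const)

theorem le_of_forall_small_add {a b C κ₀ : ℝ} (hκ₀ : 0 < κ₀)
    (h : ∀ κ, 0 < κ → κ < κ₀ → a ≤ b + κ * C) : a ≤ b := by
  by_contra! hab
  have hC : 0 < |C| + 1 := by positivity
  set κ := min (κ₀ / 2) ((a - b) / (2 * (|C| + 1))) with hκ
  have h1 : 0 < κ := lt_min (by linarith) (div_pos (by linarith) (by linarith))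
  have h2 : κ < κ₀ := (min_le_left _ _).trans_lt (by linarith)
  have h3 : κ * (|C| + 1) ≤ (a - b) / 2 := by
    calc κ * (|C| + 1) ≤ (a - b) / (2 * (|C| + 1)) * (|C| + 1) := by
          gcongr; exact min_le_right _ _
      _ = _ := by field_simp
  have h4 := h κ h1 h2
  have h5 : κ * C ≤ κ * |C| := by gcongr; exact le_abs_self C
  nlinarith

namespace HJBData

variable {N : ℕ} {A : Type*}

theorem IsViscositySolution.continuous {P : HJBData N A} {u : Euc N → ℝ}
    (h : P.IsViscositySolution u) : Continuous u :=
  continuous_iff_lower_upperSemicontinuous.2 ⟨h.2.1, h.1.1⟩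

/-- A smooth approximate subsolution lies below a viscosity supersolution. -/
theorem smooth_le_supersolution (P : HJBData N A) {σ K lam : ℝ}
    (hP : ∀ α, LevyPair (P.ν α) (P.η α) σ K) (hK : 0 < K) (hlam : 0 < lam)
    (hc : ∀ α x, lam ≤ P.c α x)
    {u : Euc N → ℝ} (hu : P.IsViscositySupersolution u) (huc : Continuous u)
    {φ : Euc N → ℝ} (hφ : ContDiff ℝ 2 φ) {M : ℝ} (hM : 0 ≤ M)
    (h2 : ∀ x y, |φ (x + y) - φ x - fderiv ℝ φ x y| ≤ M * ‖y‖ ^ 2)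
    {B : ℝ} (hB : ∀ x, |φ x| ≤ B) {r : ℝ} (hr : 0 < r) (hr1 : r < 1) {e : ℝ} (he : 0 ≤ e)
    (hsub : ∀ α x, P.f α x + P.c α x * φ x - (smallJumpOp (P.ν α) (P.η α) r φ x
      + jumpOp (largeJumps (P.ν α) (P.η α) r) φ x) ≤ e) (x : Euc N) :
    φ x - u x ≤ e / lam := by
  obtain ⟨-, ⟨B', hB'⟩, hvisc⟩ := hu
  obtain ⟨C, hC0, hC⟩ := exists_unitBump_second_bound N
  -- The perturbation of size `κ` changes the small jump part by at most `κ C K³ r^(2-σ)` and the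
  -- large jump comparison by at most `κ K r^(-σ)`. Since `r` is fixed while `κ → 0`, the size of
  -- `D` is irrelevant.
  set D : ℝ := C * K ^ 3 * r ^ (2 - σ) + K * r ^ (-σ) with hD
  have hD0 : 0 ≤ D := by positivity
  rw [le_div_iff₀ hlam]
  refine le_of_forall_small_add (C := 1 + D + lam) one_pos fun κ hκ _ => ?_
  obtain ⟨p, y, hmin, hlow⟩ := exists_perturbed_min (g := fun z => u z - φ z)
    (huc.sub hφ.continuous) (b := -(B' + B))
    (fun z => by linarith [(abs_le.1 (hB' z)).1, (abs_le.1 (hB z)).2])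
    (χ := fun p z => unitBump N (z - p)) (fun p => (unitBump_contDiff_sub p).continuous)
    (fun p => by simp only [sub_self]; exact unitBump_zero)
    (fun p => ⟨Metric.closedBall p 1, isCompact_closedBall _ _, by simp, fun z hz =>
      unitBump_eq_zero (by
        rw [← dist_eq_norm]; exact (not_le.1 (fun h => hz (Metric.mem_closedBall.2 h))).le)⟩) hκ
  set χ : Euc N → ℝ := fun z => unitBump N (z - p) with hχ
  have hχs : ContDiff ℝ 2 χ := unitBump_contDiff_sub p
  set ψ : Euc N → ℝ := fun z => φ z + κ * χ z with hψ
  have hψs : ContDiff ℝ 2 ψ := hφ.add (contDiff_const.mul hχs)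
  have htest := hvisc r hr hr1 ψ hψs y fun z => by
    have := hmin z
    simp only [hψ, hχ]
    linarith
  have hlt : ((-κ : ℝ) : EReal) < P.testedHamiltonian r ψ u y :=
    lt_of_lt_of_le (by exact_mod_cast neg_lt_zero.2 hκ) htest
  obtain ⟨α, hα⟩ := lt_iSup_iff.1 hlt
  have hα' := EReal.coe_lt_coe_iff.1 hα
  have hL := hP α
  have hη := hL.cont
  have hχ01 : ∀ z, 0 ≤ χ z ∧ χ z ≤ 1 := fun z => ⟨(unitBump N).nonneg, (unitBump N).le_one⟩
  rw [nonlocalOp_eq P hL hr hr1.le ψ huc hB' y] at hα'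
  have e1 := hL.smallJump_estimate hr hr1.le hφ.continuous hM y (h2 y)
  have e2 := hL.smallJump_estimate hr hr1.le hχs.continuous hC0.le y (hC p y)
  have e3 : smallJumpOp (P.ν α) (P.η α) r ψ y = smallJumpOp (P.ν α) (P.η α) r φ y
      + κ * smallJumpOp (P.ν α) (P.η α) r χ y := by
    have hd : fderiv ℝ ψ y = fderiv ℝ φ y + κ • fderiv ℝ χ y := by
      rw [hψ, fderiv_fun_add (hφ.differentiable (by simp) y)
        ((hχs.differentiable (by simp) y).const_mul κ),
        fderiv_const_mul (hχs.differentiable (by simp) y)]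
    have hψv : ∀ z, ψ z = φ z + κ * χ z := fun _ => rfl
    unfold smallJumpOp
    rw [← integral_const_mul, ← integral_add e1.1 (e2.1.const_mul κ)]
    refine integral_congr_ae (Filter.Eventually.of_forall fun z => ?_)
    simp only [hd, hψv, _root_.add_apply, _root_.smul_apply, smul_eq_mul]
    ring
  have e4 : jumpOp (largeJumps (P.ν α) (P.η α) r) φ y
      - jumpOp (largeJumps (P.ν α) (P.η α) r) u y ≤ κ * (K * r ^ (-σ)) := by
    have := hL.isFiniteMeasure_largeJumps hr hr1.le
    have i1 := integrable_increment (μ := largeJumps (P.ν α) (P.η α) r) hφ.continuous hB y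
    have i2 := integrable_increment (μ := largeJumps (P.ν α) (P.η α) r) huc hB' y
    unfold jumpOp
    rw [← integral_sub i1 i2]
    calc _ ≤ ∫ _z, κ ∂(largeJumps (P.ν α) (P.η α) r) := by
          refine integral_mono (i1.sub i2) (integrable_const _) fun z => ?_
          have h3 := hmin (y + z)
          have h4 : κ * χ y ≤ κ * 1 := by gcongr; exact (hχ01 y).2
          have h5 : 0 ≤ κ * χ (y + z) := mul_nonneg hκ.le (hχ01 _).1
          simp only [hχ] at h4 h5
          simp only
          linarith
      _ ≤ _ := by
          rw [integral_const, smul_eq_mul, mul_comm]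
          gcongr
          exact hL.largeJumps_real_le hr hr1.le
  have e5 := hsub α y
  have e6 : -(κ * smallJumpOp (P.ν α) (P.η α) r χ y) ≤ κ * (C * K ^ 3 * r ^ (2 - σ)) := by
    rw [← mul_neg]
    gcongr
    exact (neg_le_abs _).trans e2.2
  have e7 := hlow x
  have e8 : κ * χ y ≤ κ * 1 := by gcongr; exact (hχ01 y).2
  rw [e3] at hα'
  have e9 : P.c α y * (φ y - u y) ≤ e + κ * (1 + D) := by
    rw [hD]
    linarith
  have e10 : (φ y - u y) * lam ≤ e + κ * (1 + D) := by
    by_cases hs : 0 ≤ φ y - u y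
    · have := mul_le_mul_of_nonneg_right (hc α y) hs
      linarith
    · have h6 : (φ y - u y) * lam ≤ 0 := mul_nonpos_of_nonpos_of_nonneg (by linarith) hlam.le
      have h7 : 0 ≤ κ * (1 + D) := by positivity
      linarith
  have e11 : φ x - u x ≤ φ y - u y + κ := by
    simp only [hχ] at e8
    linarith
  have e12 := mul_le_mul_of_nonneg_right e11 hlam.le
  linarith

end HJBData

/-! ### Doubling of variables against the truncated equation. -/

theorem normSq_second_order {N : ℕ} (θ : ℝ) (q x y : Euc N) :
    HasFDerivAt (fun z : Euc N => ‖z - q‖ ^ 2 / (2 * θ))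
      ((2 * θ)⁻¹ • (2 • innerSL ℝ (x - q))) x ∧
    ‖x + y - q‖ ^ 2 / (2 * θ) - ‖x - q‖ ^ 2 / (2 * θ)
      - ((2 * θ)⁻¹ • (2 • innerSL ℝ (x - q))) y = ‖y‖ ^ 2 / (2 * θ) := by
  constructor
  · have h1 : HasFDerivAt (fun z : Euc N => z - q) (ContinuousLinearMap.id ℝ (Euc N)) x :=
      (hasFDerivAt_id x).sub_const q
    have h2 := (h1.norm_sq).const_mul ((2 * θ)⁻¹)
    simp only [div_eq_inv_mul]
    exact h2
  · have h1 : x + y - q = (x - q) + y := by abel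
    rw [h1, norm_add_sq_real]
    simp only [_root_.smul_apply, innerSL_apply_apply, smul_eq_mul, nsmul_eq_mul]
    push_cast
    ring

namespace HJBData

variable {N : ℕ} {A : Type*}

/-- A viscosity subsolution lies below Lipschitz supersolutions of the truncated equation,
up to an error vanishing with the truncation. -/
theorem subsolution_le_truncated (P : HJBData N A) {σ K K' lam : ℝ}
    (hP : ∀ α, LevyPair (P.ν α) (P.η α) σ K) (hK : 0 < K) (hK' : 0 ≤ K') (hlam : 0 < lam)
    (hc : ∀ α x, lam ≤ P.c α x) (hf : ∀ α x y, |P.f α x - P.f α y| ≤ K' * ‖x - y‖)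
    (hcl : ∀ α x y, |P.c α x - P.c α y| ≤ K' * ‖x - y‖)
    {u : Euc N → ℝ} (hu : P.IsViscositySubsolution u) (huc : Continuous u)
    {B : ℝ} (hB : ∀ x, |u x| ≤ B) {w : Euc N → ℝ} {B' L : ℝ} (hL0 : 0 ≤ L)
    (hB' : ∀ x, |w x| ≤ B') (hL : ∀ x y, |w x - w y| ≤ L * ‖x - y‖) {r : ℝ} (hr : 0 < r)
    (hr1 : r < 1) (hsup : ∀ x, ∀ κ > 0, ∃ α, -κ ≤ P.f α x + P.c α x * w x
      - jumpOp (largeJumps (P.ν α) (P.η α) r) w x) {θ : ℝ} (hθ : 0 < θ) (x : Euc N) :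
    u x - w x ≤ (K' * (1 + B) * ((2 * L + 2) * θ) + K ^ 3 * r ^ (2 - σ) / (2 * θ)) / lam := by
  obtain ⟨-, -, hvisc⟩ := hu
  have hwc := continuous_of_abs_sub_le hL
  have hB0 : 0 ≤ B := (abs_nonneg _).trans (hB 0)
  obtain ⟨C, hC0, hC⟩ := exists_unitBump_second_bound N
  set D : ℝ := C * K ^ 3 * r ^ (2 - σ) + K * r ^ (-σ) with hD
  have hD0 : 0 ≤ D := by positivity
  rw [le_div_iff₀ hlam]
  refine le_of_forall_small_add (C := 1 + D + lam) hθ fun κ hκ hκθ => ?_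
  -- `w` is only Lipschitz and cannot enter a test function, hence the doubling with penalty `‖z₁ -
  -- z₂‖² / (2θ)`. The inequality for `w` holds pointwise, so only `u` has to be tested.
  obtain ⟨⟨p₁, p₂⟩, ⟨y₁, y₂⟩, hmin, hlow⟩ := exists_perturbed_min
    (g := fun z : Euc N × Euc N => w z.2 - u z.1 + ‖z.1 - z.2‖ ^ 2 / (2 * θ))
    (by fun_prop) (b := -(B' + B))
    (fun z => by
      have : 0 ≤ ‖z.1 - z.2‖ ^ 2 / (2 * θ) := by positivity
      linarith [(abs_le.1 (hB' z.2)).1, (abs_le.1 (hB z.1)).2])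
    (χ := fun p z => unitBump N (z.1 - p.1) * unitBump N (z.2 - p.2))
    (fun p => ((unitBump_contDiff_sub p.1).continuous.comp continuous_fst).mul
      ((unitBump_contDiff_sub p.2).continuous.comp continuous_snd))
    (fun p => by simp only [sub_self, unitBump_zero, mul_one])
    (fun p => ⟨Metric.closedBall p.1 1 ×ˢ Metric.closedBall p.2 1,
      (isCompact_closedBall _ _).prod (isCompact_closedBall _ _), by simp, fun z hz => by
        have hz' : ¬(dist z.1 p.1 ≤ 1 ∧ dist z.2 p.2 ≤ 1) := hz
        by_cases h1 : dist z.1 p.1 ≤ 1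
        · have h2 : ¬dist z.2 p.2 ≤ 1 := fun h2 => hz' ⟨h1, h2⟩
          rw [unitBump_eq_zero (z := z.2 - p.2) (by rw [← dist_eq_norm]; exact (not_le.1 h2).le),
            mul_zero]
        · rw [unitBump_eq_zero (z := z.1 - p.1) (by rw [← dist_eq_norm]; exact (not_le.1 h1).le),
            zero_mul]⟩) hκ
  simp only [Prod.forall] at hmin hlow
  have hb01 : ∀ z : Euc N, 0 ≤ unitBump N z ∧ unitBump N z ≤ 1 :=
    fun z => ⟨(unitBump N).nonneg, (unitBump N).le_one⟩
  have hbb : ∀ z z' : Euc N, 0 ≤ κ * (unitBump N z * unitBump N z') ∧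
      κ * (unitBump N z * unitBump N z') ≤ κ := fun z z' =>
    ⟨mul_nonneg hκ.le (mul_nonneg (hb01 z).1 (hb01 z').1),
      mul_le_of_le_one_right hκ.le (mul_le_one₀ (hb01 z).2 (hb01 z').1 (hb01 z').2)⟩
  set q : ℝ := unitBump N (y₂ - p₂) with hq
  have hq01 := hb01 (y₂ - p₂)
  set a : ℝ := ‖y₁ - y₂‖ with ha
  -- the doubled variables stay close
  have hclose : a ≤ (2 * L + 2) * θ := by
    have h1 := hmin y₁ y₁
    simp only [sub_self, norm_zero] at h1
    have h2 := (hbb (y₁ - p₁) (y₂ - p₂)).2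
    have h3 := (hbb (y₁ - p₁) (y₁ - p₂)).1
    have h4 := (abs_le.1 (hL y₁ y₂)).2
    have h5 : a ^ 2 / (2 * θ) ≤ L * a + κ := by
      simp only [zero_pow two_ne_zero, zero_div] at h1
      linarith
    rw [div_le_iff₀ (by positivity)] at h5
    have ha0 : 0 ≤ a := norm_nonneg _
    by_contra! hcon
    have h6 : (2 * L + 2) * θ * a < a * a := by
      have : 0 < a := lt_of_le_of_lt (by positivity) hcon
      gcongr
    have h7 : 2 * θ ≤ a := by nlinarith
    have h8 : κ * θ ≤ θ * θ := by gcongr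
    nlinarith
  set χ : Euc N → ℝ := fun z => unitBump N (z - p₁) with hχ
  have hχs : ContDiff ℝ 2 χ := unitBump_contDiff_sub p₁
  set ψ : Euc N → ℝ := fun z => ‖z - y₂‖ ^ 2 / (2 * θ) - κ * q * χ z with hψ
  have hψs : ContDiff ℝ 2 ψ :=
    (((contDiff_id.sub contDiff_const).norm_sq ℝ).div_const _).sub (contDiff_const.mul hχs)
  have htest := hvisc r hr hr1 ψ hψs y₁ fun z => by
    have := hmin z y₂
    simp only [hψ, hχ]
    linarith
  obtain ⟨α, hα⟩ := hsup y₂ κ hκ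
  have hLP := hP α
  have hα' : P.f α y₁ + P.c α y₁ * u y₁ - P.nonlocalOp α r ψ u y₁ ≤ 0 := by
    have := (le_iSup (fun α => ((P.f α y₁ + P.c α y₁ * u y₁
      - P.nonlocalOp α r ψ u y₁ : ℝ) : EReal)) α).trans htest
    exact_mod_cast this
  rw [nonlocalOp_eq P hLP hr hr1.le ψ huc hB y₁] at hα'
  -- The penalty has the exact second order remainder `‖y‖² / (2θ)`, and the bump adds at most `κ C
  -- ‖y‖²`.
  have hsmall := (hLP.smallJump_estimate hr hr1.le hψs.continuous
    (M := 1 / (2 * θ) + κ * C) (by positivity) y₁ (fun y => by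
      obtain ⟨hd1, hd2⟩ := normSq_second_order θ y₂ y₁ y
      have hd3 : fderiv ℝ ψ y₁ = ((2 * θ)⁻¹ • (2 • innerSL ℝ (y₁ - y₂)))
          - (κ * q) • fderiv ℝ χ y₁ :=
        (hd1.sub ((hχs.differentiable (by simp) y₁).hasFDerivAt.const_mul (κ * q))).fderiv
      have hψv : ∀ z, ψ z = ‖z - y₂‖ ^ 2 / (2 * θ) - κ * q * χ z := fun _ => rfl
      have e1 : ψ (y₁ + y) - ψ y₁ - fderiv ℝ ψ y₁ y
          = ‖y‖ ^ 2 / (2 * θ) - κ * q * (χ (y₁ + y) - χ y₁ - fderiv ℝ χ y₁ y) := by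
        have e0 : ((κ * q) • fderiv ℝ χ y₁) y = κ * q * fderiv ℝ χ y₁ y := rfl
        rw [hd3, ← hd2, hψv, hψv, _root_.sub_apply, e0]
        ring
      rw [e1]
      refine (abs_sub _ _).trans ?_
      rw [abs_of_nonneg (by positivity), abs_mul, abs_of_nonneg (mul_nonneg hκ.le hq01.1), add_mul]
      refine add_le_add (le_of_eq (by ring)) ?_
      calc κ * q * |χ (y₁ + y) - χ y₁ - fderiv ℝ χ y₁ y| ≤ κ * 1 * (C * ‖y‖ ^ 2) := by
            gcongr
            · exact hq01.2
            · exact hC p₁ y₁ y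
        _ = _ := by ring)).2
  -- Both variables jump by the same vector, as `η` does not depend on `x`. The penalty is unchanged
  -- and only the bump is left to pay for.
  have hJ : jumpOp (largeJumps (P.ν α) (P.η α) r) u y₁
      - jumpOp (largeJumps (P.ν α) (P.η α) r) w y₂ ≤ κ * (K * r ^ (-σ)) := by
    have := hLP.isFiniteMeasure_largeJumps hr hr1.le
    have i1 := integrable_increment (μ := largeJumps (P.ν α) (P.η α) r) huc hB y₁
    have i2 := integrable_increment (μ := largeJumps (P.ν α) (P.η α) r) hwc hB' y₂
    unfold jumpOp
    rw [← integral_sub i1 i2]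
    calc _ ≤ ∫ _z, κ ∂(largeJumps (P.ν α) (P.η α) r) := by
          refine integral_mono (i1.sub i2) (integrable_const _) fun z => ?_
          have h3 := hmin (y₁ + z) (y₂ + z)
          rw [add_sub_add_right_eq_sub] at h3
          have h4 := (hbb (y₁ - p₁) (y₂ - p₂)).2
          have h5 := (hbb (y₁ + z - p₁) (y₂ + z - p₂)).1
          simp only
          linarith
      _ ≤ _ := by
          rw [integral_const, smul_eq_mul, mul_comm]
          gcongr
          exact hLP.largeJumps_real_le hr hr1.le
  have e1 : P.f α y₂ - P.f α y₁ ≤ K' * a := by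
    have := (le_abs_self _).trans (hf α y₂ y₁)
    rwa [norm_sub_rev] at this
  have e2 : -((P.c α y₁ - P.c α y₂) * u y₁) ≤ K' * a * B := by
    refine (neg_le_abs _).trans ?_
    rw [abs_mul]
    exact mul_le_mul (hcl α _ _) (hB _) (abs_nonneg _) (by positivity)
  have e3 := (abs_le.1 hsmall).2
  set E : ℝ := K' * (1 + B) * ((2 * L + 2) * θ) + K ^ 3 * r ^ (2 - σ) / (2 * θ) with hE
  have e4 : K' * (1 + B) * a ≤ K' * (1 + B) * ((2 * L + 2) * θ) := by gcongr
  have e5 : (1 / (2 * θ) + κ * C) * K ^ 3 * r ^ (2 - σ)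
      = K ^ 3 * r ^ (2 - σ) / (2 * θ) + κ * (C * K ^ 3 * r ^ (2 - σ)) := by ring
  have e6 : P.c α y₂ * (u y₁ - w y₂) ≤ E + κ * (1 + D) := by
    rw [hE, hD]
    linarith
  have hE0 : 0 ≤ E := by positivity
  have e7 : (u y₁ - w y₂) * lam ≤ E + κ * (1 + D) := by
    by_cases hs : 0 ≤ u y₁ - w y₂
    · have := mul_le_mul_of_nonneg_right (hc α y₂) hs
      linarith
    · have h6 : (u y₁ - w y₂) * lam ≤ 0 :=
        mul_nonpos_of_nonpos_of_nonneg (by linarith) hlam.le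
      have h7 : 0 ≤ κ * (1 + D) := by positivity
      linarith
  have e8 : u x - w x ≤ u y₁ - w y₂ + κ := by
    have h1 := hlow x x
    have h2 := (hbb (y₁ - p₁) (y₂ - p₂)).2
    have h3 : 0 ≤ a ^ 2 / (2 * θ) := by positivity
    simp only [sub_self, norm_zero, zero_pow two_ne_zero, zero_div] at h1
    linarith
  have e9 := mul_le_mul_of_nonneg_right e8 hlam.le
  linarith

end HJBData

/-! ## The rate of convergence -/

/-- With `ε = h^((4-σ)/(4+σ))` the prescribed powers make `δ^(4-σ)` and `k² δ^(4-2σ)` equal to `ε⁴`,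
and `h²/k²` and `h² δ^(-σ)` equal to `ε²`, up to constants. These balance the factors `ε⁻³` and
`ε⁻¹` of the consistency error exactly. -/
theorem parameter_rates {σ c₁ c₂ h k δ : ℝ} (hσ0 : 0 < σ) (hσ2 : σ < 2) (hc₁ : 0 < c₁)
    (hc₂ : 0 < c₂) (hh : 0 < h) (hk1 : c₁ * h ^ (2 * σ / (4 + σ)) ≤ k)
    (hk2 : k ≤ c₂ * h ^ (2 * σ / (4 + σ))) (hδ1 : c₁ * h ^ (4 / (4 + σ)) ≤ δ)
    (hδ2 : δ ≤ c₂ * h ^ (4 / (4 + σ))) :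
    δ ^ (4 - σ) ≤ c₂ ^ (4 - σ) * (h ^ ((4 - σ) / (4 + σ))) ^ 4 ∧
    k ^ 2 * (δ ^ (2 - σ)) ^ 2 ≤ c₂ ^ 2 * (c₂ ^ (2 - σ)) ^ 2 * (h ^ ((4 - σ) / (4 + σ))) ^ 4 ∧
    h ^ 2 / k ^ 2 ≤ (c₁ ^ 2)⁻¹ * (h ^ ((4 - σ) / (4 + σ))) ^ 2 ∧
    h ^ 2 * δ ^ (-σ) ≤ c₁ ^ (-σ) * (h ^ ((4 - σ) / (4 + σ))) ^ 2 := by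
  have hk0 : 0 < k := lt_of_lt_of_le (by positivity) hk1
  have hδ0 : 0 < δ := lt_of_lt_of_le (by positivity) hδ1
  have hs : 4 + σ ≠ 0 := by positivity
  have hpow : ∀ (a : ℝ) (n : ℕ), (h ^ a) ^ n = h ^ (a * n) := fun a n =>
    (Real.rpow_mul_natCast hh.le a n).symm
  have hsq : h ^ 2 = h ^ (2 : ℝ) := (Real.rpow_two h).symm
  refine ⟨?_, ?_, ?_, ?_⟩
  · calc δ ^ (4 - σ) ≤ (c₂ * h ^ (4 / (4 + σ))) ^ (4 - σ) :=
          Real.rpow_le_rpow hδ0.le hδ2 (by linarith)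
      _ = _ := by
          rw [Real.mul_rpow hc₂.le (by positivity), ← Real.rpow_mul hh.le, hpow]
          congr 2
          push_cast
          field_simp
  · have h1 : δ ^ (2 - σ) ≤ (c₂ * h ^ (4 / (4 + σ))) ^ (2 - σ) :=
      Real.rpow_le_rpow hδ0.le hδ2 (by linarith)
    calc k ^ 2 * (δ ^ (2 - σ)) ^ 2
        ≤ (c₂ * h ^ (2 * σ / (4 + σ))) ^ 2 * ((c₂ * h ^ (4 / (4 + σ))) ^ (2 - σ)) ^ 2 := by
          gcongr
      _ = c₂ ^ 2 * (c₂ ^ (2 - σ)) ^ 2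
          * ((h ^ (2 * σ / (4 + σ))) ^ 2 * (h ^ (4 / (4 + σ) * (2 - σ))) ^ 2) := by
          rw [Real.mul_rpow hc₂.le (by positivity), ← Real.rpow_mul hh.le]
          ring
      _ = _ := by
          rw [hpow, hpow, hpow, ← Real.rpow_add hh]
          congr 2
          push_cast
          field_simp
          ring
  · calc h ^ 2 / k ^ 2 ≤ h ^ 2 / (c₁ * h ^ (2 * σ / (4 + σ))) ^ 2 := by gcongr
      _ = (c₁ ^ 2)⁻¹ * (h ^ 2 / (h ^ (2 * σ / (4 + σ))) ^ 2) := by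
          rw [mul_pow]; field_simp
      _ = _ := by
          rw [hpow, hpow, hsq, ← Real.rpow_sub hh]
          congr 2
          push_cast
          field_simp
          ring
  · calc h ^ 2 * δ ^ (-σ) ≤ h ^ 2 * (c₁ * h ^ (4 / (4 + σ))) ^ (-σ) := by
          gcongr 1
          exact Real.rpow_le_rpow_of_nonpos (by positivity) hδ1 (by linarith)
      _ = c₁ ^ (-σ) * (h ^ (2 : ℝ) * h ^ (4 / (4 + σ) * (-σ))) := by
          rw [Real.mul_rpow hc₁.le (by positivity), ← Real.rpow_mul hh.le, hsq]
          ring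
      _ = _ := by
          rw [hpow, ← Real.rpow_add hh]
          congr 2
          push_cast
          field_simp
          ring

/-- The consistency error of the scheme at the optimal mollification scale. -/
theorem consistency_error_le {N : ℕ} {K T σ c₁ c₂ h k δ e : ℝ} (hK : 0 ≤ K) (hT : 0 ≤ T)
    (he : 0 < e) (r₁ : δ ^ (4 - σ) ≤ c₂ ^ (4 - σ) * e ^ 4)
    (r₂ : k ^ 2 * (δ ^ (2 - σ)) ^ 2 ≤ c₂ ^ 2 * (c₂ ^ (2 - σ)) ^ 2 * e ^ 4)
    (r₃ : h ^ 2 / k ^ 2 ≤ (c₁ ^ 2)⁻¹ * e ^ 2) (r₄ : h ^ 2 * δ ^ (-σ) ≤ c₁ ^ (-σ) * e ^ 2) :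
    T / e ^ 3 * K ^ 5 * δ ^ (4 - σ)
        + N * (T / e ^ 3 * k ^ 2 * (K ^ 3 * δ ^ (2 - σ)) ^ 2 + 2 * (T / e * (N * h ^ 2)) / k ^ 2)
        + T / e * (N * h ^ 2) * (K * δ ^ (-σ))
      ≤ T * (K ^ 5 * c₂ ^ (4 - σ) + N * K ^ 6 * (c₂ ^ 2 * (c₂ ^ (2 - σ)) ^ 2)
        + 2 * N ^ 2 * (c₁ ^ 2)⁻¹ + N * K * c₁ ^ (-σ)) * e := by
  calc _ = T / e ^ 3 * K ^ 5 * δ ^ (4 - σ)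
        + T / e ^ 3 * (N * K ^ 6) * (k ^ 2 * (δ ^ (2 - σ)) ^ 2)
        + T / e * (2 * N ^ 2) * (h ^ 2 / k ^ 2) + T / e * (N * K) * (h ^ 2 * δ ^ (-σ)) := by ring
    _ ≤ T / e ^ 3 * K ^ 5 * (c₂ ^ (4 - σ) * e ^ 4)
        + T / e ^ 3 * (N * K ^ 6) * (c₂ ^ 2 * (c₂ ^ (2 - σ)) ^ 2 * e ^ 4)
        + T / e * (2 * N ^ 2) * ((c₁ ^ 2)⁻¹ * e ^ 2) + T / e * (N * K) * (c₁ ^ (-σ) * e ^ 2) := by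
        gcongr
    _ = _ := by field_simp

theorem HJBData.IsSchemeSolution.isJumpSolution {N : ℕ} {A : Type*} {P : HJBData N A}
    {h k δ : ℝ} {v : Euc N → ℝ} (hv : P.IsSchemeSolution h k δ v) {μ : A → Measure (Euc N)}
    (hμ : ∀ α φ x, P.localDiscrete α δ k h φ x + P.nonlocalDiscrete α δ h φ x
      = jumpOp (μ α) φ x) : IsJumpSolution μ P.f P.c v := by
  have e : ∀ α x, P.f α x + P.c α x * v x - P.localDiscrete α δ k h v x
      - P.nonlocalDiscrete α δ h v x = P.f α x + P.c α x * v x - jumpOp (μ α) v x := by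
    intro α x
    rw [← hμ]
    ring
  obtain ⟨-, -, hsol⟩ := hv
  simp only [e] at hsol
  refine ⟨fun α x => ?_, fun x κ hκ => ?_⟩
  · have := (le_iSup (fun α => ((P.f α x + P.c α x * v x - jumpOp (μ α) v x : ℝ) : EReal))
      α).trans (hsol x).le
    exact_mod_cast this
  · have hlt : ((-κ : ℝ) : EReal)
        < ⨆ α, ((P.f α x + P.c α x * v x - jumpOp (μ α) v x : ℝ) : EReal) := by
      rw [hsol x]
      exact_mod_cast neg_lt_zero.2 hκ
    obtain ⟨α, hα⟩ := lt_iSup_iff.1 hlt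
    exact ⟨α, (EReal.coe_lt_coe_iff.1 hα).le⟩
-- The convergence rate theorem.
theorem mainTheorem2 {N : ℕ} (hN : 1 ≤ N)
    {A : Type*} [MetricSpace A] [TopologicalSpace.SeparableSpace A] [Nonempty A]
    (P : HJBData N A) (σ : ℝ) (hσ0 : 0 < σ) (hσ2 : σ < 2)
    (h1 : P.A1) (h2 : P.A2) (h3 : P.A3) (h4 : P.A4) (h5 : P.A5) (h6 : P.A6 σ) (h7 : P.A7)
    (c₁ c₂ : ℝ) (hc₁ : 0 < c₁) :
    ∃ C : ℝ, 0 < C ∧ ∀ h k δ : ℝ, 0 < h → h < 1 →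
      c₁ * h ^ (2 * σ / (4 + σ)) ≤ k → k ≤ c₂ * h ^ (2 * σ / (4 + σ)) →
      c₁ * h ^ (4 / (4 + σ)) ≤ δ → δ ≤ c₂ * h ^ (4 / (4 + σ)) → δ < 1 →
      ∀ u v : Euc N → ℝ, P.IsViscositySolution u → P.IsSchemeSolution h k δ v →
        ∀ x, |u x - v x| ≤ C * h ^ ((4 - σ) / (4 + σ)) := by

  obtain ⟨⟨lam, hlam, hc⟩, -⟩ := id h1
  obtain ⟨K₂, hK₂, hA2⟩ := id h2
  obtain ⟨K, hP⟩ := exists_levyPair hN P hσ0 hσ2 h1 h2 h3 h4 h5 h6 h7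
  have hK : 0 < K := (hP (Classical.arbitrary A)).K_pos
  have hfK : ∀ α x, |P.f α x| ≤ K₂ := fun α => (hA2 α).1
  have hfl : ∀ α x y, |P.f α x - P.f α y| ≤ K₂ * ‖x - y‖ := fun α => (hA2 α).2.1
  have hcK : ∀ α x, |P.c α x| ≤ K₂ := fun α => (hA2 α).2.2.1
  have hcl : ∀ α x y, |P.c α x - P.c α y| ≤ K₂ * ‖x - y‖ := fun α => (hA2 α).2.2.2.1
  set B : ℝ := K₂ / lam with hB
  have hB0 : 0 < B := by positivity
  set L : ℝ := K₂ * (1 + B) / lam with hL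
  have hL0 : 0 < L := by positivity
  obtain ⟨Cm, hCm, hmoll⟩ := exists_smoothBound_mollify N
  set T : ℝ := Cm * L with hT
  have hT0 : 0 < T := by positivity
  -- Positivity of `c₂` is not among the hypotheses; enlarging it weakens the upper bounds
  -- harmlessly.
  set c₃ : ℝ := max c₂ 1 with hc₃
  have hc₃0 : 0 < c₃ := lt_of_lt_of_le one_pos (le_max_right _ _)
  set C' : ℝ := T * (K ^ 5 * c₃ ^ (4 - σ) + N * K ^ 6 * (c₃ ^ 2 * (c₃ ^ (2 - σ)) ^ 2)
        + 2 * N ^ 2 * (c₁ ^ 2)⁻¹ + N * K * c₁ ^ (-σ)) with hC'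
  have hC'0 : 0 ≤ C' := by positivity
  refine ⟨L + (K₂ * (1 + B) + C') / lam, by positivity, ?_⟩
  intro h k δ hh hh1 hk1 hk2 hδ1 hδ2 hδlt u v hu hv x
  have hk0 : 0 < k := lt_of_lt_of_le (by positivity) hk1
  have hδ0 : 0 < δ := lt_of_lt_of_le (by positivity) hδ1
  -- The mollification scale coincides with the rate: both the mollification error and the
  -- consistency error are then multiples of `e`.
  set e : ℝ := h ^ ((4 - σ) / (4 + σ)) with he
  have he0 : 0 < e := by positivity
  obtain ⟨r₁, r₂, r₃, r₄⟩ := parameter_rates hσ0 hσ2 hc₁ hc₃0 hh hk1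
    (hk2.trans (by gcongr; exact le_max_left _ _)) hδ1
    (hδ2.trans (by gcongr; exact le_max_left _ _))
  have hcons : ∀ α (φ : Euc N → ℝ), SmoothBound φ (T / e) (T / e ^ 3) → (∀ x, |φ x| ≤ B) → ∀ x,
      |P.localDiscrete α δ k h φ x + P.nonlocalDiscrete α δ h φ x
        - (smallJumpOp (P.ν α) (P.η α) δ φ x
          + jumpOp (largeJumps (P.ν α) (P.η α) δ) φ x)| ≤ C' * e := fun α φ hφ hφB x =>
    ((hP α).scheme_consistency hδ0 hδlt hk0 hh (by positivity) (by positivity) hφ hφB x).trans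
      (consistency_error_le hK.le hT0.le he0 r₁ r₂ r₃ r₄)
  choose μ hμfin hμmass hμ using fun α =>
    (hP α).exists_scheme_measure hδ0 hδlt hk0 hh
  have hvJ := hv.isJumpSolution hμ
  obtain ⟨hvc, ⟨Bv, hBv⟩, -⟩ := hv
  have hM0 : 0 ≤ 2 * N / k ^ 2 + K * δ ^ (-σ) := by positivity
  have hvB : ∀ x, |v x| ≤ B := jump_solution_bound hM0 hμmass hlam hK₂.le hc hfK hvc hBv hvJ
  have hvL : ∀ x y, |v x - v y| ≤ L * ‖x - y‖ :=
    jump_solution_lipschitz hM0 hμmass hlam hK₂.le hc hfl hcl hvc hvB hvJ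
  have huc := hu.continuous
  obtain ⟨Bu, hBu⟩ := hu.1.2.1
  have hBu0 : 0 ≤ Bu := (abs_nonneg _).trans (hBu 0)
  set S : ℝ := K₂ * (1 + B) * e + C' * e with hS
  have hS0 : 0 ≤ S := by positivity
  have hgoal : (L + (K₂ * (1 + B) + C') / lam) * e = L * e + S / lam := by rw [hS]; ring
  rw [hgoal, abs_le]
  constructor
  -- Upper bound for `v - u`: the mollified `v` is a smooth approximate subsolution of the equation.
  · have hsm := hmoll L v hL0.le hvL e he0
    have hmb := abs_mollify_le hvc hvB e
    have hmain := P.smooth_le_supersolution hP hK hlam hc hu.2 huc hsm.contDiff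
      (M := T / e) (by positivity) hsm.second hmb hδ0 hδlt hS0 (fun α y => by
        have e1 := mollify_subsolution hvB hvL hK₂.le (hfl α) (hcl α) (hvJ.1 α) he0.le y
        have e2 := (abs_le.1 (hcons α _ hsm hmb y)).2
        rw [hμ] at e2
        linarith) x
    have e3 := (abs_le.1 (abs_mollify_sub_le hvB hvL hL0.le he0.le x)).1
    linarith
  · have hp : 0 < 2 - σ := by linarith
    -- Upper bound for `u - v`, with an extra error proportional to the doubling parameter `θ`.
    -- Constants that depend on `e` or on the a priori bound `Bu` of `u` multiply `θ` and disappear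
    -- in the limit. The restriction on `θ` ensures `r ≤ δ` below.
    refine le_of_forall_small_add
      (C := (K₂ * (1 + Bu) * (2 * L + 2) + K ^ 3 / 2 + T / e * K ^ 3) / lam)
      (κ₀ := min 1 (δ ^ ((2 - σ) / 2))) (by positivity) fun θ hθ hθ1 => ?_
    -- This choice gives `r^(2-σ) = θ²`, so the doubling error `K³ r^(2-σ) / (2θ)` is linear in `θ`.
    set r : ℝ := θ ^ (2 / (2 - σ)) with hr
    have hr0 : 0 < r := by positivity
    have hθle : θ ≤ 1 := (hθ1.trans_le (min_le_left _ _)).le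
    have hrδ : r ≤ δ := by
      have e1 : r ≤ (δ ^ ((2 - σ) / 2)) ^ (2 / (2 - σ)) :=
        Real.rpow_le_rpow hθ.le (hθ1.trans_le (min_le_right _ _)).le (by positivity)
      rwa [← Real.rpow_mul hδ0.le, show (2 - σ) / 2 * (2 / (2 - σ)) = 1 by field_simp,
        Real.rpow_one] at e1
    have hr1 : r < 1 := hrδ.trans_lt hδlt
    have hrpow : r ^ (2 - σ) = θ ^ 2 := by
      rw [hr, ← Real.rpow_mul hθ.le, show 2 / (2 - σ) * (2 - σ) = 2 by field_simp, Real.rpow_two]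
    have hfin : ∀ α, IsFiniteMeasure (largeJumps (P.ν α) (P.η α) r) := fun α =>
      (hP α).isFiniteMeasure_largeJumps hr0 hr1.le
    obtain ⟨w, hwB, hwL, hwJ⟩ := exists_jump_solution
      (μ := fun α => largeJumps (P.ν α) (P.η α) r) (M := K * r ^ (-σ)) (by positivity)
      (fun α => (hP α).largeJumps_real_le hr0 hr1.le) hlam hK₂ hc hcK hfK hfl hcl
    have hwc := continuous_of_abs_sub_le hwL
    have hsm := hmoll L w hL0.le hwL e he0
    have hmb := abs_mollify_le hwc hwB e
    have hmc := hsm.contDiff.continuous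
    have e1 := P.subsolution_le_truncated hP hK hK₂.le hlam hc hfl hcl hu.1 huc hBu hL0.le hwB hwL
      hr0 hr1 hwJ.2 hθ x
    have e2 := (abs_le.1 (abs_mollify_sub_le hwB hwL hL0.le he0.le x)).1
    -- The total error is absorbed into the source term, which makes the mollified `w` an exact
    -- subsolution of a shifted scheme. Besides mollification and consistency it contains `T / e *
    -- K³ r^(2-σ)`, the price of the jumps below `r` that the equation for `w` omits.
    have e3 := jump_comparison hM0 hμmass hlam hc
      (f₁ := fun α y => P.f α y - (S + T / e * K ^ 3 * r ^ (2 - σ))) (f₂ := P.f) (c₂ := P.c)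
      (e := S + T / e * K ^ 3 * r ^ (2 - σ)) hmc hvc hmb hvB (by positivity)
      (fun α y => by
        have d1 := mollify_subsolution hwB hwL hK₂.le (hfl α) (hcl α) (hwJ.1 α) he0.le y
        have d2 := (abs_le.1 (hcons α _ hsm hmb y)).1
        have d3 := (hP α).smallJumpOp_add_jumpOp hr0 hrδ hδlt.le hmc hmb
          (show 0 ≤ T / e by positivity) y (hsm.second y)
        have d4 := (abs_le.1 ((hP α).smallJump_estimate hr0 hr1.le hmc
          (show 0 ≤ T / e by positivity) y (hsm.second y)).2).1
        rw [hμ] at d2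
        linarith)
      hvJ.2 (fun α y => by simp) x
    rw [hrpow] at e1 e3
    have e4 : K ^ 3 * θ ^ 2 / (2 * θ) = K ^ 3 / 2 * θ := by field_simp
    rw [e4] at e1
    have e5 : T / e * K ^ 3 * θ ^ 2 ≤ T / e * K ^ 3 * θ := by
      gcongr
      exact pow_le_of_le_one hθ.le hθle two_ne_zero
    have e6 : (S + T / e * K ^ 3 * θ ^ 2) / lam ≤ (S + T / e * K ^ 3 * θ) / lam := by gcongr
    have e7 : L * e + S / lam
        + θ * ((K₂ * (1 + Bu) * (2 * L + 2) + K ^ 3 / 2 + T / e * K ^ 3) / lam)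
        = (K₂ * (1 + Bu) * ((2 * L + 2) * θ) + K ^ 3 / 2 * θ) / lam + L * e
          + (S + T / e * K ^ 3 * θ) / lam := by ring
    rw [e7]
    linarith
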